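/- Let $p$ be a prime, $F_0$ a $p$-adic local field with ring of integers $\mathcal{O}$, and let $q_0$ be the cardinality of its residue field. Let $R$ be a commutative ring and $r\ge 0$ an integer. We consider three independent cases: (uH) unramified Hermitian, where $F/F_0$ is an unramified quadratic extension; (S) symmetric, where $F=F_0$, $q=q_0$, $p\neq 2$ and $2\in R^\times$; (A) alternating, where $F=F_0$, $q=q_0$. Put $\mathrm{Sign}=\{1\}$ in the cases (uH), (A), and $\mathrm{Sign}=\mathcal{O}^\times/(\mathcal{O}^\times)^2=\mathbb{F}_q^\times/(\mathbb{F}_q^\times)^2=\{\pm1\}$ in the case (S), where $\epsilon\in\mathrm{Sign}$ denotes the class of $-1$. Let $\mathrm{Typ}_r=(\mathbb{Z}\times\mathrm{Sign})^r$, and for $e\in\mathbb{Z}^r$, $\chi\in\mathrm{Sign}^r$ write $\delta(e,\chi)$ for the corresponding basis element of the free $R$-module $R[\mathrm{Typ}_r]$. Concatenation makes $R[\mathrm{Typ}]=\bigoplus_{r\ge0}R[\mathrm{Typ}_r]$ a graded ring. Let $\mathrm{Rel}\subseteq R[\mathrm{Typ}]$ be the homogeneous two-sided ideal generated by the following elements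 of degree $2$, and $\mathrm{Rel}_r=\mathrm{Rel}\cap R[\mathrm{Typ}_r]$. In the cases (uH) and (A), write $(a,b)$ for $\delta((a,b),(1,1))$. The generators are $(a,a+1)-(a+1,a)$ for $a\in\mathbb{Z}$, and, for all integers $a<b$, $$(a,b)-(a+1,b-1)-c_{b-a-1}\bigl((b,a)-(b-1,a+1)\bigr),$$ where $c_k=(-q_0)^{k}$ in the case (uH) and $c_k=q^{2k}$ in the case (A). In the case (S), identify $s\in\{\pm1\}$ with a character of $\mathrm{Sign}=\{\pm1\}$, where $s=1$ is the trivial and $s=-1$ the nontrivial one, and put $$[a,s_1;b,s_2]=\sum_{\chi_1,\chi_2\in\mathrm{Sign}}s_1(\chi_1)s_2(\chi_2)\,\delta\bigl((a,b),(\chi_1,\chi_2)\bigr),$$ $$H_s(a,b)=-[a,s;b,s]+[a-1,s;b+1,s]-\epsilon\bigl([a,-s;b,-s]-[a+1,-s;b-1,-s]\bigr).$$ The generators are, for $a,b\in\mathbb{Z}$ and $s,s_1,s_2\in\{\pm1\}$, 1. for $b-a\ge1$ odd, $\;[a,s_1;b,s_2]-[a+1,s_2;b-1,s_1]-q^{(b-a-1)/2}\bigl([b,s_2;a,s_1]-[b-1,s_1;a+1,s_2]\bigr)$;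 2. for $b-a\ge0$ even, $\;[a,s;b,-s]+q^{(b-a)/2}[b,s;a,-s]$; 3. for $b-a\ge2$ even, $\;H_s(a+1,b-1)+q^{(b-a-2)/2}H_s(b-1,a+1)$. Let $\mathrm{Typ}^0_r$ be the set of pairs $(e^0,\chi^0)$ of functions $e^0\colon\mathbb{Z}\to\mathbb{Z}_{\ge0}$ and $\chi^0\colon\mathbb{Z}\to\mathrm{Sign}$ such that $e^0$ has finite support, $\sum_i e^0(i)=r$, and $\chi^0(i)=1$ whenever $e^0(i)=0$; let $R[\mathrm{Typ}^0_r]$ be the free $R$-module on it. Then in each of the three cases there is an isomorphism of $R$-modules $$\mathrm{str}\colon R[\mathrm{Typ}_r]/\mathrm{Rel}_r\xrightarrow{\ \sim\ }R[\mathrm{Typ}^0_r]$$ such that, for every $(e,\chi)\in\mathrm{Typ}_r$ with $e_1\ge\cdots\ge e_r$, we have $\mathrm{str}(\delta(e,\chi))=(e^0,\chi^0)$, where $e^0(i)=\#\{k\colon e_k=i\}$ and $\chi^0(i)=\prod_{k\colon e_k=i}\chi_k$. Moreover, $\mathrm{str}$ is the only $R$-linear map $R[\mathrm{Typ}_r]/\mathrm{Rel}_r\to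 R[\mathrm{Typ}^0_r]$ with this property. -/

import Mathlib

namespace Straightening

/-- `Typ_r = (ℤ × Sign)^r`, for an arbitrary set of signs. -/
abbrev Typ (S : Type) (r : ℕ) : Type := Fin r → ℤ × S

/-- The noncommutative ring `R[Typ]`, where `Typ = ⨆_r Typ_r` is the monoid of finite words
in `ℤ × Sign` under concatenation. -/
abbrev TypRing (R : Type*) [CommRing R] (S : Type) := MonoidAlgebra R (FreeMonoid (ℤ × S))

/-- `Typ⁰`: pairs `(e⁰, χ⁰)` with `e⁰ : ℤ → ℤ_{≥ 0}` of finite support, `χ⁰ : ℤ → Sign` and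
`χ⁰ i = 1` whenever `e⁰ i = 0`. -/
@[ext]
structure TypZero (S : Type) [CommGroup S] where
  /-- the multiplicities -/
  e : ℤ →₀ ℕ
  /-- the signs -/
  χ : ℤ → S
  χ_eq_one : ∀ i, e i = 0 → χ i = 1

/-- `Typ⁰_r`: the elements `(e⁰, χ⁰)` of `Typ⁰` with `∑ i, e⁰ i = r`. -/
abbrev TypZeroOfRank (S : Type) [CommGroup S] (r : ℕ) : Type :=
  {t : TypZero S // (t.e.sum fun _ m => m) = r}

/-- The multiplicity / sign data of `(e, χ) ∈ Typ_r`: the pair `(e⁰, χ⁰)` with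
`e⁰ i = #{k | e_k = i}` and `χ⁰ i = ∏_{k : e_k = i} χ_k`. -/
noncomputable def typData {S : Type} [CommGroup S] {r : ℕ} (v : Typ S r) : TypZeroOfRank S r :=
  ⟨{ e := Finsupp.onFinset (Finset.univ.image fun k => (v k).1)
        (fun i => (Finset.univ.filter fun k => (v k).1 = i).card) (by
          intro i hi
          obtain ⟨k, hk⟩ := Finset.card_ne_zero.mp hi
          exact Finset.mem_image.mpr ⟨k, Finset.mem_univ k, (Finset.mem_filter.mp hk).2⟩)
     χ := fun i => ∏ k ∈ Finset.univ.filter (fun k => (v k).1 = i), (v k).2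
     χ_eq_one := by
        intro i hi
        rw [Finsupp.onFinset_apply, Finset.card_eq_zero] at hi
        rw [hi, Finset.prod_empty] }, by
    rw [Finsupp.onFinset_sum _ (fun _ => rfl)]
    rw [← Finset.card_eq_sum_card_image (fun k => (v k).1) Finset.univ, Finset.card_univ,
      Fintype.card_fin]⟩

section Relations

variable (R : Type*) [CommRing R]

/-- The inclusion `R[Typ_r] → R[Typ]` of the graded piece of degree `r`. -/
noncomputable def inclusion (S : Type) (r : ℕ) : (Typ S r →₀ R) →ₗ[R] TypRing R S :=
  Finsupp.linearCombination R fun v =>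
    MonoidAlgebra.single (FreeMonoid.ofList (List.ofFn v)) (1 : R)

/-- The degree `r` part of the two-sided ideal of `R[Typ]` generated by `gens`,
as a submodule of `R[Typ_r]`. -/
def relPart {S : Type} (gens : Set (TypRing R S)) (r : ℕ) : Submodule R (Typ S r →₀ R) where
  carrier := {x | inclusion R S r x ∈ TwoSidedIdeal.span gens}
  add_mem' := by
    intro x y hx hy
    simp only [Set.mem_ofPred_eq, map_add] at *
    exact TwoSidedIdeal.add_mem _ hx hy
  zero_mem' := by
    simp only [Set.mem_ofPred_eq, map_zero]
    exact TwoSidedIdeal.zero_mem _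
  smul_mem' := by
    intro c x hx
    simp only [Set.mem_ofPred_eq, map_smul] at *
    rw [Algebra.smul_def]
    exact TwoSidedIdeal.mul_mem_left _ _ _ hx

/-- The element `δ((a, b))` of `R[Typ_2]`, in the cases where `Sign` is trivial. -/
noncomputable def pair (a b : ℤ) : TypRing R Unit :=
  MonoidAlgebra.single (FreeMonoid.of (a, ()) * FreeMonoid.of (b, ())) 1

/-- The generators of `Rel` in the unramified Hermitian case: `Rel(a)`, and `Rel(a, b)` for
`b > a`, written as `b = a + k + 1`. Here `q₀` is the cardinality of the residue field of the
base field. -/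
def relHermitian (q₀ : ℕ) : Set (TypRing R Unit) :=
  {x | ∃ a : ℤ, x = pair R a (a + 1) - pair R (a + 1) a} ∪
  {x | ∃ (a b : ℤ) (k : ℕ), b = a + k + 1 ∧
    x = pair R a b - pair R (a + 1) (b - 1)
      - (-(q₀ : R)) ^ k • (pair R b a - pair R (b - 1) (a + 1))}

/-- The generators of `Rel` in the alternating case: `Rel(a)`, and `Rel(a, b)` for
`b > a`, written as `b = a + k + 1`. -/
def relAlternating (q : ℕ) : Set (TypRing R Unit) :=
  {x | ∃ a : ℤ, x = pair R a (a + 1) - pair R (a + 1) a} ∪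
  {x | ∃ (a b : ℤ) (k : ℕ), b = a + k + 1 ∧
    x = pair R a b - pair R (a + 1) (b - 1)
      - (q : R) ^ (2 * k) • (pair R b a - pair R (b - 1) (a + 1))}

/-- The value at `χ ∈ {±1}` of the character of `{±1}` indexed by `s ∈ {±1}`: the trivial
character for `s = 1`, the identity character for `s = -1`. -/
def signChar (s χ : ℤˣ) : ℤˣ := if s = 1 then 1 else χ

/-- The element `((a, s₁), (b, s₂))^Σ = ∑_{χ₁, χ₂} s₁(χ₁) s₂(χ₂) δ((a, χ₁), (b, χ₂))`
of `R[Typ_2]`, in the symmetric case. -/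
noncomputable def pairSigma (a : ℤ) (s₁ : ℤˣ) (b : ℤ) (s₂ : ℤˣ) : TypRing R ℤˣ :=
  ∑ χ₁ : ℤˣ, ∑ χ₂ : ℤˣ,
    MonoidAlgebra.single (FreeMonoid.of (a, χ₁) * FreeMonoid.of (b, χ₂))
      (((signChar s₁ χ₁ * signChar s₂ χ₂ : ℤˣ) : ℤ) : R)

/-- `RelHalf((a, s), (b, s))` -/
noncomputable def relHalf (ε : ℤˣ) (a b : ℤ) (s : ℤˣ) : TypRing R ℤˣ :=
  - pairSigma R a s b s + pairSigma R (a - 1) s (b + 1) s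
    - ((ε : ℤ) : R) • (pairSigma R a (-s) b (-s) - pairSigma R (a + 1) (-s) (b - 1) (-s))

/-- The generators of `Rel` in the symmetric case. The three families are
`Rel((a, s₁), (b, s₂))` for `b - a = 2 * k + 1`, `Rel((a, s), (b, -s))` for `b - a = 2 * k`,
and `Rel((a, s), (b, s))` for `b - a = 2 * k + 2`, where `k ≥ 0`. -/
def relSymmetric (q : ℕ) (ε : ℤˣ) : Set (TypRing R ℤˣ) :=
  {x | ∃ (a b : ℤ) (s₁ s₂ : ℤˣ) (k : ℕ), b = a + 2 * k + 1 ∧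
    x = pairSigma R a s₁ b s₂ - pairSigma R (a + 1) s₂ (b - 1) s₁
      - (q : R) ^ k • (pairSigma R b s₂ a s₁ - pairSigma R (b - 1) s₁ (a + 1) s₂)} ∪
  {x | ∃ (a b : ℤ) (s : ℤˣ) (k : ℕ), b = a + 2 * k ∧
    x = pairSigma R a s b (-s) + (q : R) ^ k • pairSigma R b s a (-s)} ∪
  {x | ∃ (a b : ℤ) (s : ℤˣ) (k : ℕ), b = a + 2 * k + 2 ∧
    x = relHalf R ε (a + 1) (b - 1) s + (q : R) ^ k • relHalf R ε (b - 1) (a + 1) s}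

variable {R}

/-- A linear map `R[Typ_r] / Rel_r → R[Typ⁰_r]` is a *straightening map* if it sends the class
of `δ(e, χ)` to `(e⁰, χ⁰)` whenever `e_1 ≥ ⋯ ≥ e_r`. -/
def IsStraightening {S : Type} [CommGroup S] {gens : Set (TypRing R S)} {r : ℕ}
    (f : ((Typ S r →₀ R) ⧸ relPart R gens r) →ₗ[R] (TypZeroOfRank S r →₀ R)) : Prop :=
  ∀ v : Typ S r, (Antitone fun k => (v k).1) →
    f (Submodule.Quotient.mk (Finsupp.single v 1)) = Finsupp.single (typData v) 1

end Relations

open scoped Classical in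
/-- The natural map `𝔽_q^× → 𝔽_q^× / (𝔽_q^×)² = {±1}`, for a finite field of odd order. -/
noncomputable def sign (k : Type*) [Field k] (x : kˣ) : ℤˣ := if IsSquare x then 1 else -1

end Straightening

open Straightening
open scoped ValuativeRel

/-!
In the Hermitian and alternating cases, and after a Fourier transform in the signs in the symmetric
case, all relations have the form `B(a, a) = 0` and `B(a, b) + t ^ k B(b, a) = 0` for `b = a + m k`,
`k > 0`; here `t` is `-q`, `q ^ 2` or `q`, and `m` is `1`, `1` or `2`.

Read from left to right, the relations rewrite a word into words with a smaller value of
`∑ i, (a i + i) ^ 2`, where `a i` are the exponents, as long as the word is not normal. Hence the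
normal words span.

For their independence, take `t` to be an indeterminate and `v` with `v ^ m = t⁻¹`. Words of length
`r`, multiplied by suitable powers of `v`, become monomials in `u 1, …, u r` with coefficients in a
tensor power. A unitary solution `k` of the Yang–Baxter equation makes
`F ↦ k(u i, u (i + 1)) F(…, u (i + 1), u i, …)` satisfy the Coxeter relations of the symmetric
group. Up to relabelling signs, a relation becomes the product of a symmetric function and a vector
fixed by such an operator, for `k` the scalar `(u j - v u i) / (u i - v u j)`, respectively a tensor
product of two six-vertex matrices, so antisymmetrization kills all relations. At `v = 0` the matrix
`k` degenerates to a diagonal matrix of monomials, so the antisymmetrized normal words have distinct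
leading monomials and are independent. As `ℤ[t] → R` can be applied to the projection along the
ideal, the indeterminate may be replaced by any element of any ring.
-/

namespace Straightening

section Antisymmetrizer

/-- The relations satisfied by the adjacent transpositions in a symmetric group. -/
structure IsCoxeter {A : Type*} [Monoid A] (s : ℕ → A) : Prop where
  sq : ∀ i, s i * s i = 1
  comm : ∀ i j, i + 2 ≤ j → s i * s j = s j * s i
  braid : ∀ i, s i * s (i + 1) * s i = s (i + 1) * s i * s (i + 1)

variable {A : Type*} [Ring A] {s : ℕ → A}

/-- The alternating sum `1 - s_{n-1} + s_{n-1} s_{n-2} - ⋯ ± s_{n-1} ⋯ s_0` over the minimal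
representatives of the cosets of `S_n` in `S_{n+1}`. -/
def shuffle (s : ℕ → A) : ℕ → A
  | 0 => 1
  | n + 1 => 1 - s n * shuffle s n

/-- The antisymmetrizer of `S_n`, factored along the chain `S_1 ⊂ S_2 ⊂ ⋯ ⊂ S_n`; here
`s_0, …, s_{n-2}` stand for the adjacent transpositions. -/
def antisymm (s : ℕ → A) : ℕ → A
  | 0 => 1
  | n + 1 => antisymm s n * shuffle s n

namespace IsCoxeter

theorem one_sub_mul_one_add (h : IsCoxeter s) (i : ℕ) : (1 - s i) * (1 + s i) = 0 := by
  rw [sub_mul, one_mul, mul_add, mul_one, h.sq]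
  abel

theorem shuffle_mul (h : IsCoxeter s) {n j : ℕ} (hj : n + 1 ≤ j) :
    shuffle s n * s j = s j * shuffle s n := by
  induction n with
  | zero => simp only [shuffle, one_mul, mul_one]
  | succ n ih =>
    calc shuffle s (n + 1) * s j
        = s j - s n * (shuffle s n * s j) := by simp only [shuffle]; noncomm_ring
      _ = s j - s n * s j * shuffle s n := by rw [ih (by omega), mul_assoc]
      _ = s j * shuffle s (n + 1) := by
        rw [h.comm n j (by omega), shuffle]; noncomm_ring

theorem shuffle_succ_succ_mul (h : IsCoxeter s) (n : ℕ) :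
    shuffle s (n + 2) * (1 + s (n + 1)) = (1 + s n) * (s (n + 1) * s n * shuffle s n) := by
  have hbraid : s (n + 1) * s n * shuffle s n * s (n + 1) =
      s n * (s (n + 1) * s n * shuffle s n) := by
    calc _ = s (n + 1) * s n * s (n + 1) * shuffle s n := by
          rw [mul_assoc, h.shuffle_mul le_rfl, mul_assoc, mul_assoc, mul_assoc]
      _ = _ := by rw [← h.braid]; simp only [mul_assoc]
  calc shuffle s (n + 2) * (1 + s (n + 1))
      = (1 - s (n + 1)) * (1 + s (n + 1)) + s (n + 1) * s n * shuffle s n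
          + s (n + 1) * s n * shuffle s n * s (n + 1) := by
        simp only [shuffle]; noncomm_ring
    _ = (1 + s n) * (s (n + 1) * s n * shuffle s n) := by
        rw [h.one_sub_mul_one_add, hbraid]; noncomm_ring

theorem mul_shuffle_mul (h : IsCoxeter s) {n : ℕ} {a : A}
    (ha : ∀ j, j + 1 < n → a * (1 + s j) = 0) : ∀ i < n, a * shuffle s n * (1 + s i) = 0 := by
  induction n generalizing a with
  | zero => intro i hi; omega
  | succ n ih =>
    intro i hi
    rcases Nat.lt_succ_iff_lt_or_eq.mp hi with hi | rfl
    · have hcomm : ∀ j, j + 1 < n → a * s n * (1 + s j) = 0 := fun j hj => by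
        rw [mul_assoc, mul_add, mul_one, ← h.comm j n (by omega), ← one_add_mul, ← mul_assoc,
          ha j (by omega), zero_mul]
      calc a * shuffle s (n + 1) * (1 + s i)
          = a * (1 + s i) - a * s n * shuffle s n * (1 + s i) := by
            simp only [shuffle]; noncomm_ring
        _ = 0 := by rw [ih hcomm i hi, ha i (by omega), sub_zero]
    · rcases i with _ | i
      · rw [shuffle, shuffle, mul_one, mul_assoc, h.one_sub_mul_one_add, mul_zero]
      · rw [mul_assoc, h.shuffle_succ_succ_mul, ← mul_assoc, ha i (by omega), zero_mul]

theorem antisymm_mul_one_add (h : IsCoxeter s) {n i : ℕ} (hi : i + 1 < n) :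
    antisymm s n * (1 + s i) = 0 := by
  induction n generalizing i with
  | zero => omega
  | succ n ih => exact h.mul_shuffle_mul (fun _ hj => ih hj) i (by omega)

theorem antisymm_apply_eq_zero {R M : Type*} [Ring R] [AddCommGroup M] [Module R M]
    [IsAddTorsionFree M] {s : ℕ → Module.End R M} (h : IsCoxeter s) {n i : ℕ} (hi : i + 1 < n)
    {x : M} (hx : s i x = x) : antisymm s n x = 0 := by
  have hdouble := LinearMap.congr_fun (h.antisymm_mul_one_add hi) x
  rw [Module.End.mul_apply, LinearMap.add_apply, Module.End.one_apply, hx, ← two_nsmul, map_nsmul,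
    LinearMap.zero_apply] at hdouble
  exact (nsmul_eq_zero_iff_right two_ne_zero).mp hdouble

end IsCoxeter

end Antisymmetrizer

section PermutedFamily

open Equiv

variable {R M : Type*} [Ring R] [AddCommGroup M] [Module R M] {s : ℕ → Module.End R M} {n : ℕ}

theorem shuffle_mem {U : AddSubgroup M} (hU : ∀ j < n, ∀ x ∈ U, s j x ∈ U) {x : M} (hx : x ∈ U) :
    shuffle s n x ∈ U := by
  induction n with
  | zero => exact hx
  | succ n ih => exact U.sub_mem hx (hU n (by omega) _ (ih fun j hj => hU j (by omega)))

theorem antisymm_mem {U : AddSubgroup M} (hU : ∀ j, j + 1 < n → ∀ x ∈ U, s j x ∈ U) {x : M}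
    (hx : x ∈ U) : antisymm s n x ∈ U := by
  induction n generalizing x with
  | zero => exact hx
  | succ n ih =>
    exact ih (fun j hj => hU j (by omega)) (shuffle_mem (fun j hj => hU j (by omega)) hx)

/-- The permutations of `{0, …, n - 1}`, as permutations of `ℕ`. -/
def permsBelow (n : ℕ) : Subgroup (Perm ℕ) where
  carrier := {π | ∀ j, n ≤ j → π j = j}
  mul_mem' hπ hρ j hj := by rw [Perm.mul_apply, hρ j hj, hπ j hj]
  one_mem' _ _ := rfl
  inv_mem' hπ j hj := Perm.inv_eq_iff_eq.mpr (hπ j hj).symm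

theorem permsBelow_mono {m n : ℕ} (h : m ≤ n) : permsBelow m ≤ permsBelow n :=
  fun _ hπ j hj => hπ j (h.trans hj)

theorem swap_mem_permsBelow {i : ℕ} (hi : i + 1 < n) : swap i (i + 1) ∈ permsBelow n :=
  fun _ hj => swap_apply_of_ne_of_ne (by omega) (by omega)

variable {E : Perm ℕ → M}

theorem map_mem_closure_image {i : ℕ} (hE : ∀ π, s i (E π) = E (π * swap i (i + 1)))
    {P Q : Set (Perm ℕ)} (hPQ : ∀ π ∈ P, π * swap i (i + 1) ∈ Q) {x : M}
    (hx : x ∈ AddSubgroup.closure (E '' P)) : s i x ∈ AddSubgroup.closure (E '' Q) := by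
  have hle : AddSubgroup.closure (E '' P) ≤
      (AddSubgroup.closure (E '' Q)).comap (s i).toAddMonoidHom := by
    rw [AddSubgroup.closure_le]
    rintro _ ⟨π, hπ, rfl⟩
    exact AddSubgroup.mem_comap.mpr (AddSubgroup.subset_closure ⟨_, hPQ π hπ, (hE π).symm⟩)
  exact hle hx

theorem shuffle_sub_mem_closure (hE : ∀ i < n, ∀ π, s i (E π) = E (π * swap i (i + 1))) :
    shuffle s n (E 1) - E 1 ∈
      AddSubgroup.closure (E '' {π | π ∈ permsBelow (n + 1) ∧ π n ≠ n}) := by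
  rcases n with _ | n
  · simpa only [shuffle, Module.End.one_apply, sub_self] using zero_mem _
  have hshuffle : shuffle s n (E 1) ∈ AddSubgroup.closure (E '' permsBelow (n + 1)) :=
    shuffle_mem (fun j hj x hx => map_mem_closure_image (hE j (by omega))
      (fun π hπ => mul_mem hπ (swap_mem_permsBelow (by omega))) hx)
      (AddSubgroup.subset_closure ⟨1, one_mem _, rfl⟩)
  have hstep := map_mem_closure_image (Q := {π | π ∈ permsBelow (n + 2) ∧ π (n + 1) ≠ n + 1})
    (hE n (by omega)) (fun π hπ => ⟨mul_mem (permsBelow_mono (Nat.le_succ _) hπ)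
      (swap_mem_permsBelow (by omega)), fun h => ?_⟩) hshuffle
  · rw [shuffle, LinearMap.sub_apply, Module.End.one_apply, sub_sub_cancel_left]
    exact neg_mem hstep
  · rw [Perm.mul_apply, swap_apply_right] at h
    exact absurd (π.injective (h.trans (hπ (n + 1) le_rfl).symm)) (by omega)

theorem antisymm_sub_mem_closure (hE : ∀ i, i + 1 < n → ∀ π, s i (E π) = E (π * swap i (i + 1))) :
    antisymm s n (E 1) - E 1 ∈ AddSubgroup.closure (E '' {π | π ∈ permsBelow n ∧ π ≠ 1}) := by
  induction n with
  | zero => simpa only [antisymm, Module.End.one_apply, sub_self] using zero_mem _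
  | succ n ih =>
    have hmove : antisymm s n (shuffle s n (E 1) - E 1) ∈
        AddSubgroup.closure (E '' {π | π ∈ permsBelow (n + 1) ∧ π n ≠ n}) := by
      refine antisymm_mem (fun j hj x hx => map_mem_closure_image (hE j (by omega)) ?_ hx)
        (shuffle_sub_mem_closure fun i hi => hE i (by omega))
      rintro π ⟨hπ, hne⟩
      refine ⟨mul_mem hπ (swap_mem_permsBelow (by omega)), ?_⟩
      rwa [Perm.mul_apply, swap_apply_of_ne_of_ne (by omega) (by omega)]
    have hsplit : antisymm s (n + 1) (E 1) - E 1 =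
        (antisymm s n (E 1) - E 1) + antisymm s n (shuffle s n (E 1) - E 1) := by
      rw [antisymm, Module.End.mul_apply, map_sub]
      abel
    rw [hsplit]
    refine add_mem (AddSubgroup.closure_mono (Set.image_mono ?_)
      (ih fun i hi => hE i (by omega))) (AddSubgroup.closure_mono (Set.image_mono ?_) hmove)
    · exact fun π hπ => ⟨permsBelow_mono (Nat.le_succ n) hπ.1, hπ.2⟩
    · rintro π ⟨hπ, hne⟩
      exact ⟨hπ, fun h => hne (by rw [h, Perm.one_apply])⟩

end PermutedFamily

section RMatrix

open Matrix
open scoped Kronecker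

variable {C C' 𝓡 𝓡' : Type*} [CommRing 𝓡] [CommRing 𝓡']

section Put

variable {X : Type*}

/-- The sequence `x` with the entries in positions `i` and `i + 1` replaced by `a` and `b`. -/
def put (x : ℕ → X) (i : ℕ) (a b : X) : ℕ → X :=
  Function.update (Function.update x i a) (i + 1) b

variable (x : ℕ → X) (i : ℕ) (a b c : X)

theorem put_apply (j : ℕ) :
    put x i a b j = if j = i + 1 then b else if j = i then a else x j := by
  simp only [put, Function.update_apply]

@[simp] theorem put_left : put x i a b i = a := by simp [put_apply]

@[simp] theorem put_right : put x i a b (i + 1) = b := by simp [put_apply]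

theorem put_of_ne {j : ℕ} (h : j ≠ i) (h' : j ≠ i + 1) : put x i a b j = x j := by
  simp [put_apply, h, h']

@[simp] theorem put_self : put x i (x i) (x (i + 1)) = x := by simp [put]

@[simp] theorem put_put (a' b' : X) : put (put x i a b) i a' b' = put x i a' b' := by
  funext j
  simp only [put_apply]
  split_ifs <;> rfl

theorem put_comm {j : ℕ} (h : i + 2 ≤ j) (a' b' : X) :
    put (put x i a b) j a' b' = put (put x j a' b') i a b := by
  funext l
  simp only [put_apply]
  split_ifs <;> first | rfl | omega

theorem put_update (a' b' : X) :
    put (Function.update (put x i a b) (i + 2) c) i a' b' =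
      Function.update (put x i a' b') (i + 2) c := by
  funext l
  simp only [put_apply, Function.update_apply]
  split_ifs <;> first | rfl | omega

theorem put_succ_update (b' c' : X) :
    put (Function.update (put x i a b) (i + 2) c) (i + 1) b' c' =
      Function.update (put x i a b') (i + 2) c' := by
  funext l
  simp only [put_apply, Function.update_apply]
  split_ifs <;> rfl

end Put

/-- The values of `F` at the sequences with variables `i`, `j`, `l` in positions `p`, `p + 1`,
`p + 2`, as a function of the three colours. -/
def slice {C Y : Type*} (F : (ℕ → ℕ × C) → Y) (x : ℕ → ℕ × C) (p i j l : ℕ) (c : C × C × C) : Y :=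
  F (Function.update (put x p (i, c.1) (j, c.2.1)) (p + 2) (l, c.2.2))

theorem slice_self {C Y : Type*} (F : (ℕ → ℕ × C) → Y) (x : ℕ → ℕ × C) (p : ℕ) :
    slice F x p (x p).1 (x (p + 1)).1 (x (p + 2)).1 ((x p).2, (x (p + 1)).2, (x (p + 2)).2) =
      F x := by
  simp [slice]

/-- A family of matrices `k i j`, acting on pairs of colours and indexed by the pairs of variables
with indices `i` and `j`. -/
abbrev RMatrix (C 𝓡 : Type*) : Type _ := ℕ → ℕ → Matrix (C × C) (C × C) 𝓡

namespace RMatrix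

variable (k : RMatrix C 𝓡)

/-- Change of the base ring. -/
def map (f : 𝓡 →+* 𝓡') : RMatrix C 𝓡' := fun i j => (k i j).map f

/-- The tensor product, acting on pairs of colours. -/
def tensor (k' : RMatrix C' 𝓡) : RMatrix (C × C') 𝓡 := fun i j =>
  (k i j ⊗ₖ k' i j).submatrix (Equiv.prodProdProdComm C C' C C') (Equiv.prodProdProdComm C C' C C')

theorem tensor_apply (k' : RMatrix C' 𝓡) (i j : ℕ) (c d : (C × C') × (C × C')) :
    k.tensor k' i j c d =
      k i j (c.1.1, c.2.1) (d.1.1, d.2.1) * k' i j (c.1.2, c.2.2) (d.1.2, d.2.2) := rfl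

theorem map_tensor (k' : RMatrix C' 𝓡) (f : 𝓡 →+* 𝓡') :
    (k.tensor k').map f = (k.map f).tensor (k'.map f) := by
  funext i j
  ext c d
  exact map_mul f _ _

section Op

variable [Fintype C]

/-- The operator with `(op F)(…, u_i, u_{i+1}, …) = k(u_i, u_{i+1}) F(…, u_{i+1}, u_i, …)` on
vector-valued functions. Both a variable and a colour are attached to every position, a variable
being represented by its index. -/
def op (i : ℕ) : Module.End 𝓡 ((ℕ → ℕ × C) → 𝓡) where
  toFun F x := ∑ d, k (x i).1 (x (i + 1)).1 ((x i).2, (x (i + 1)).2) d *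
    F (put x i ((x (i + 1)).1, d.1) ((x i).1, d.2))
  map_add' F G := by
    funext x
    simp only [Pi.add_apply, mul_add, Finset.sum_add_distrib]
  map_smul' r F := by
    funext x
    simp only [Pi.smul_apply, smul_eq_mul, Finset.mul_sum, RingHom.id_apply, mul_left_comm]

theorem op_apply (i : ℕ) (F : (ℕ → ℕ × C) → 𝓡) (x : ℕ → ℕ × C) :
    k.op i F x = ∑ d, k (x i).1 (x (i + 1)).1 ((x i).2, (x (i + 1)).2) d *
      F (put x i ((x (i + 1)).1, d.1) ((x i).1, d.2)) := rfl

theorem op_mul_comp_shift {P : (ℕ → ℕ × C) → 𝓡} {i : ℕ} (hP : ∀ x a b, P (put x i a b) = P x)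
    (G : (ℕ → ℕ × C) → 𝓡) :
    k.op i (fun x => P x * G fun j => x (i + j)) = fun x => P x * k.op 0 G fun j => x (i + j) := by
  funext x
  have hshift (a b : ℕ × C) : (fun j => put x i a b (i + j)) = put (fun j => x (i + j)) 0 a b := by
    funext j
    simp only [put_apply, Nat.add_left_cancel_iff, zero_add, Nat.add_eq_left]
  simp only [op_apply, hP, hshift, Finset.mul_sum, mul_left_comm, zero_add, add_zero]

theorem map_op (f : 𝓡 →+* 𝓡') (i : ℕ) (F : (ℕ → ℕ × C) → 𝓡) :
    (k.map f).op i (f ∘ F) = f ∘ k.op i F := by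
  funext x
  simp only [op_apply, map, Matrix.map_apply, Function.comp_apply, map_sum, map_mul]

theorem map_shuffle (f : 𝓡 →+* 𝓡') (n : ℕ) (F : (ℕ → ℕ × C) → 𝓡) :
    shuffle (k.map f).op n (f ∘ F) = f ∘ shuffle k.op n F := by
  induction n with
  | zero => rfl
  | succ n ih =>
    funext x
    simp only [shuffle, LinearMap.sub_apply, Module.End.one_apply, Module.End.mul_apply, ih, map_op,
      Pi.sub_apply, Function.comp_apply, map_sub]

theorem map_antisymm (f : 𝓡 →+* 𝓡') (n : ℕ) (F : (ℕ → ℕ × C) → 𝓡) :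
    antisymm (k.map f).op n (f ∘ F) = f ∘ antisymm k.op n F := by
  induction n generalizing F with
  | zero => rfl
  | succ n ih => simp only [antisymm, Module.End.mul_apply, map_shuffle, ih]

end Op

variable [DecidableEq C]

/-- The action of a matrix on the first two of three colours. -/
def lift₁ (A : Matrix (C × C) (C × C) 𝓡) : Matrix (C × C × C) (C × C × C) 𝓡 :=
  of fun c d => if c.2.2 = d.2.2 then A (c.1, c.2.1) (d.1, d.2.1) else 0

/-- The action of a matrix on the last two of three colours. -/
def lift₂ (A : Matrix (C × C) (C × C) 𝓡) : Matrix (C × C × C) (C × C × C) 𝓡 :=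
  of fun c d => if c.1 = d.1 then A c.2 d.2 else 0

variable [Fintype C]

/-- Unitarity and the Yang–Baxter equation. -/
structure IsBraided : Prop where
  unitary : ∀ i j, k i j * k j i = 1
  yangBaxter : ∀ i j l, lift₁ (k i j) * lift₂ (k i l) * lift₁ (k j l) =
    lift₂ (k j l) * lift₁ (k i l) * lift₂ (k i j)

variable [DecidableEq C'] [Fintype C']

theorem IsBraided.tensor {k : RMatrix C 𝓡} {k' : RMatrix C' 𝓡} (h : k.IsBraided)
    (h' : k'.IsBraided) : (k.tensor k').IsBraided where
  unitary i j := by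
    rw [RMatrix.tensor, RMatrix.tensor, submatrix_mul_equiv, ← mul_kronecker_mul, h.unitary,
      h'.unitary, one_kronecker_one, submatrix_one_equiv]
  yangBaxter i j l := by
    let e : (C × C') × (C × C') × (C × C') ≃ (C × C × C) × (C' × C' × C') :=
      ⟨fun c => ((c.1.1, c.2.1.1, c.2.2.1), (c.1.2, c.2.1.2, c.2.2.2)),
        fun c => ((c.1.1, c.2.1), (c.1.2.1, c.2.2.1), (c.1.2.2, c.2.2.2)),
        fun _ => rfl, fun _ => rfl⟩
    have hlift₁ (i j) : lift₁ (k.tensor k' i j) =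
        (lift₁ (k i j) ⊗ₖ lift₁ (k' i j)).submatrix e e := by
      ext c d
      simp only [lift₁, e, of_apply, submatrix_apply, kronecker_apply, Equiv.coe_fn_mk,
        ite_zero_mul_ite_zero, Prod.ext_iff, tensor_apply]
    have hlift₂ (i j) : lift₂ (k.tensor k' i j) =
        (lift₂ (k i j) ⊗ₖ lift₂ (k' i j)).submatrix e e := by
      ext c d
      simp only [lift₂, e, of_apply, submatrix_apply, kronecker_apply, Equiv.coe_fn_mk,
        ite_zero_mul_ite_zero, Prod.ext_iff, tensor_apply]
    simp only [hlift₁, hlift₂, submatrix_mul_equiv, ← mul_kronecker_mul, h.yangBaxter,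
      h'.yangBaxter]

theorem slice_op (F : (ℕ → ℕ × C) → 𝓡) (x : ℕ → ℕ × C) (p i j l : ℕ) :
    slice (k.op p F) x p i j l = lift₁ (k i j) *ᵥ slice F x p j i l := by
  funext ⟨a, b, c⟩
  simp only [slice, op_apply, put_update, mulVec, dotProduct, lift₁, of_apply,
    Fintype.sum_prod_type, ite_mul, zero_mul, Finset.sum_ite_eq, Finset.mem_univ, if_true]
  simp

theorem slice_op_succ (F : (ℕ → ℕ × C) → 𝓡) (x : ℕ → ℕ × C) (p i j l : ℕ) :
    slice (k.op (p + 1) F) x p i j l = lift₂ (k j l) *ᵥ slice F x p i l j := by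
  funext ⟨a, b, c⟩
  simp only [slice, op_apply, put_succ_update, mulVec, dotProduct, lift₂, of_apply,
    Fintype.sum_prod_type, ite_mul, zero_mul, Finset.sum_ite_irrel, Finset.sum_const_zero,
    Finset.sum_ite_eq, Finset.mem_univ, if_true]
  simp

theorem IsBraided.isCoxeter_op {k : RMatrix C 𝓡} (hk : k.IsBraided) : IsCoxeter k.op where
  sq i := by
    ext F x
    calc (k.op i * k.op i) F x
        = ∑ d, ∑ e, k (x i).1 (x (i + 1)).1 ((x i).2, (x (i + 1)).2) d *
            (k (x (i + 1)).1 (x i).1 d e * F (put x i ((x i).1, e.1) ((x (i + 1)).1, e.2))) := by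
          simp only [Module.End.mul_apply, op_apply, put_left, put_right, put_put, Finset.mul_sum]
      _ = ∑ e, (k (x i).1 (x (i + 1)).1 * k (x (i + 1)).1 (x i).1) ((x i).2, (x (i + 1)).2) e *
            F (put x i ((x i).1, e.1) ((x (i + 1)).1, e.2)) := by
          rw [Finset.sum_comm]
          simp only [mul_apply, Finset.sum_mul, mul_assoc]
      _ = F x := by simp [hk.unitary, one_apply]
  comm i j hij := by
    ext F x
    have hj (a b) : put x i a b j = x j := put_of_ne _ _ _ _ (by omega) (by omega)
    have hj' (a b) : put x i a b (j + 1) = x (j + 1) := put_of_ne _ _ _ _ (by omega) (by omega)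
    have hi (a b) : put x j a b i = x i := put_of_ne _ _ _ _ (by omega) (by omega)
    have hi' (a b) : put x j a b (i + 1) = x (i + 1) := put_of_ne _ _ _ _ (by omega) (by omega)
    simp only [Module.End.mul_apply, op_apply, hj, hj', hi, hi', Finset.mul_sum]
    rw [Finset.sum_comm]
    simp only [put_comm _ _ _ _ hij, mul_left_comm]
  braid p := by
    ext F x
    refine (slice_self _ x p).symm.trans (Eq.trans ?_ (slice_self _ x p))
    simp only [Module.End.mul_apply, slice_op, slice_op_succ, mulVec_mulVec, ← mul_assoc,
      hk.yangBaxter]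

end RMatrix

end RMatrix

section WordAlgebra

variable {R : Type*} [CommRing R] {S : Type}

section Words

variable (R) in
/-- The basis element of `R[Typ]` given by a word. -/
noncomputable def wd (l : List (ℤ × S)) : TypRing R S :=
  MonoidAlgebra.single (FreeMonoid.ofList l) 1

theorem wd_append (l l' : List (ℤ × S)) : wd R (l ++ l') = wd R l * wd R l' := by
  simp [wd, MonoidAlgebra.single_mul_single, FreeMonoid.ofList_append]

theorem span_range_wd : Submodule.span R (Set.range (wd R : List (ℤ × S) → TypRing R S)) = ⊤ := by
  refine (Submodule.eq_top_iff').mpr fun x => ?_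
  induction x using MonoidAlgebra.induction_linear with
  | zero => exact zero_mem _
  | add x y hx hy => exact add_mem hx hy
  | single m r =>
    have : MonoidAlgebra.single m r = r • wd R (FreeMonoid.toList m) := by
      simp [wd, MonoidAlgebra.smul_single]
    exact this ▸ Submodule.smul_mem _ _ (Submodule.subset_span ⟨_, rfl⟩)

variable {M : Type*} [AddCommGroup M] [Module R M]

theorem linearMap_ext_wd {f g : TypRing R S →ₗ[R] M} (h : ∀ l, f (wd R l) = g (wd R l)) : f = g :=
  LinearMap.ext_on_range span_range_wd h

theorem map_mem_of_wd {f : TypRing R S →ₗ[R] M} {N : Submodule R M} (h : ∀ l, f (wd R l) ∈ N)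
    (x : TypRing R S) : f x ∈ N := by
  have : Submodule.span R (Set.range (wd R)) ≤ N.comap f :=
    Submodule.span_le.mpr (Set.range_subset_iff.mpr h)
  exact this (span_range_wd (R := R) (S := S) ▸ Submodule.mem_top)

/-- The linear map on `R[Typ]` with given values on words. -/
noncomputable def wdLift (f : List (ℤ × S) → M) : TypRing R S →ₗ[R] M :=
  (Finsupp.linearCombination R fun w => f (FreeMonoid.toList w)) ∘ₗ
    (MonoidAlgebra.coeffLinearEquiv R).toLinearMap

@[simp] theorem wdLift_wd (f : List (ℤ × S) → M) (l : List (ℤ × S)) : wdLift f (wd R l) = f l := by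
  have : (MonoidAlgebra.coeffLinearEquiv R) (wd R l) = Finsupp.single (FreeMonoid.ofList l) 1 := rfl
  simp [wdLift, this]

section BaseChange

variable {R' : Type*} [CommRing R'] (φ : R →+* R')

theorem mapRingHom_wd (l : List (ℤ × S)) : MonoidAlgebra.mapRingHom _ φ (wd R l) = wd R' l := by
  simp [wd]

theorem mapRingHom_smul (c : R) (x : TypRing R S) :
    MonoidAlgebra.mapRingHom _ φ (c • x) = φ c • MonoidAlgebra.mapRingHom _ φ x := by
  simp only [Algebra.smul_def, map_mul]
  simp [MonoidAlgebra.coe_algebraMap]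

end BaseChange

end Words

section RelIdeal

/-- The two-sided ideal generated by `gens`, as an `R`-submodule of `R[Typ]`. -/
noncomputable def relIdeal (gens : Set (TypRing R S)) : Submodule R (TypRing R S) :=
  (TwoSidedIdeal.asIdeal (TwoSidedIdeal.span gens)).restrictScalars R

variable {gens : Set (TypRing R S)} {x : TypRing R S}

theorem mem_relIdeal : x ∈ relIdeal gens ↔ x ∈ TwoSidedIdeal.span gens :=
  TwoSidedIdeal.mem_asIdeal

theorem subset_relIdeal (hx : x ∈ gens) : x ∈ relIdeal gens :=
  mem_relIdeal.mpr (TwoSidedIdeal.subset_span hx)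

theorem mul_mem_relIdeal (hx : x ∈ relIdeal gens) (a b : TypRing R S) : a * x * b ∈ relIdeal gens :=
  mem_relIdeal.mpr
    (TwoSidedIdeal.mul_mem_right _ _ _ (TwoSidedIdeal.mul_mem_left _ _ _ (mem_relIdeal.mp hx)))

theorem relIdeal_le {N : Submodule R (TypRing R S)}
    (h : ∀ g ∈ gens, ∀ u w, wd R u * g * wd R w ∈ N) : relIdeal gens ≤ N := by
  intro x hx
  rw [mem_relIdeal, TwoSidedIdeal.mem_span_iff_mem_addSubgroup_closure] at hx
  refine (AddSubgroup.closure_le N.toAddSubgroup).mpr ?_ hx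
  rintro _ ⟨_, ⟨a, -, g, hg, rfl⟩, b, -, rfl⟩
  have hleft (w) : a * g * wd R w ∈ N :=
    map_mem_of_wd (f := LinearMap.mulRight R (wd R w) ∘ₗ LinearMap.mulRight R g)
      (fun u => h g hg u w) a
  exact map_mem_of_wd (f := LinearMap.mulLeft R (a * g)) hleft b

end RelIdeal

section Spanning

/-- The sum of the squares of `a_i + i`, for a word with exponents `a_k, a_{k+1}, …`. -/
def shiftedNormSq : ℕ → List (ℤ × S) → ℕ
  | _, [] => 0
  | k, a :: l => (a.1 + k).natAbs ^ 2 + shiftedNormSq (k + 1) l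

theorem shiftedNormSq_append (k : ℕ) (l l' : List (ℤ × S)) :
    shiftedNormSq k (l ++ l') = shiftedNormSq k l + shiftedNormSq (k + l.length) l' := by
  induction l generalizing k with
  | nil => simp [shiftedNormSq]
  | cons a l ih => simp only [List.cons_append, shiftedNormSq, ih, List.length_cons,
      add_right_comm k, add_assoc]

/-- The words of length two that are closer to being antitone than `[x, y]`. -/
def straighter (x y : ℤ × S) : Set (List (ℤ × S)) :=
  {l | ∃ x' y' : ℤ × S, x.1 < x'.1 ∧ x'.1 ≤ y.1 ∧ x'.1 + y'.1 = x.1 + y.1 ∧ l = [x', y']}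

theorem shiftedNormSq_lt {x y : ℤ × S} {l : List (ℤ × S)} (hl : l ∈ straighter x y)
    (u w : List (ℤ × S)) :
    shiftedNormSq 0 (u ++ l ++ w) < shiftedNormSq 0 (u ++ [x, y] ++ w) := by
  obtain ⟨x', y', hx, hy, hsum, rfl⟩ := hl
  have hy' : y'.1 = x.1 + y.1 - x'.1 := by omega
  suffices h : shiftedNormSq u.length [x', y'] < shiftedNormSq u.length [x, y] by
    simp only [shiftedNormSq_append, List.length_append, List.length_cons]
    simpa using h
  zify
  simp only [shiftedNormSq, Nat.cast_add, Nat.cast_pow, Int.natCast_natAbs, sq_abs, hy']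
  push_cast
  nlinarith [mul_pos (sub_pos.mpr hx) (show (0 : ℤ) < y.1 - x'.1 + 1 by omega)]

theorem exists_of_not_isChain {α : Type*} {N : α → α → Prop} {l : List α} (h : ¬ l.IsChain N) :
    ∃ u x y w, l = u ++ [x, y] ++ w ∧ ¬ N x y := by
  induction l with
  | nil => exact absurd .nil h
  | cons a l ih =>
    rcases l with _ | ⟨b, l⟩
    · exact absurd (.singleton a) h
    · by_cases hab : N a b
      · obtain ⟨u, x, y, w, hl, hxy⟩ := ih fun h' => h (List.isChain_cons_cons.mpr ⟨hab, h'⟩)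
        exact ⟨a :: u, x, y, w, by simp [hl], hxy⟩
      · exact ⟨[], a, b, l, rfl, hab⟩

theorem wd_mem_span_sup_relIdeal {gens : Set (TypRing R S)} {N : ℤ × S → ℤ × S → Prop}
    (h : ∀ x y, ¬ N x y → wd R [x, y] ∈ Submodule.span R (wd R '' straighter x y) ⊔ relIdeal gens)
    (l : List (ℤ × S)) :
    wd R l ∈ Submodule.span R (wd R '' {n | n.IsChain N ∧ n.length = l.length}) ⊔
      relIdeal gens := by
  induction hm : shiftedNormSq 0 l using Nat.strong_induction_on generalizing l with
  | _ m ih =>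
  by_cases hl : l.IsChain N
  · exact Submodule.mem_sup_left (Submodule.subset_span ⟨l, ⟨hl, rfl⟩, rfl⟩)
  · obtain ⟨u, x, y, w, rfl, hxy⟩ := exists_of_not_isChain hl
    set W := Submodule.span R (wd R '' {n | n.IsChain N ∧ n.length = (u ++ [x, y] ++ w).length}) ⊔
      relIdeal gens
    let f := LinearMap.mulRight R (wd R w) ∘ₗ LinearMap.mulLeft R (wd R u)
    have hstraighter : Submodule.span R (wd R '' straighter x y) ≤ W.comap f := by
      refine Submodule.span_le.mpr ?_
      rintro _ ⟨l', hl', rfl⟩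
      have hlength : (u ++ l' ++ w).length = (u ++ [x, y] ++ w).length := by
        obtain ⟨x', y', -, -, -, rfl⟩ := hl'
        simp
      have := ih _ (hm ▸ shiftedNormSq_lt hl' u w) _ rfl
      rwa [hlength, wd_append, wd_append] at this
    have hrel : relIdeal gens ≤ W.comap f := fun z hz =>
      Submodule.mem_sup_right (mul_mem_relIdeal hz _ _)
    have := sup_le hstraighter hrel (h x y hxy)
    rwa [Submodule.mem_comap, LinearMap.comp_apply, LinearMap.mulLeft_apply,
      LinearMap.mulRight_apply, ← wd_append, ← wd_append] at this

end Spanning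

section NormalSpan

variable (R) in
/-- The span of the normal words, these being the chains for the relation `N`. -/
noncomputable def normalSpan (N : ℤ × S → ℤ × S → Prop) : Submodule R (TypRing R S) :=
  Submodule.span R (wd R '' {n | n.IsChain N})

variable {gens : Set (TypRing R S)} {N : ℤ × S → ℤ × S → Prop}

theorem codisjoint_normalSpan
    (h : ∀ x y, ¬ N x y → wd R [x, y] ∈ Submodule.span R (wd R '' straighter x y) ⊔ relIdeal gens) :
    Codisjoint (normalSpan R N) (relIdeal gens) := by
  have hle (l : List (ℤ × S)) : Submodule.span R
      (wd R '' {n | n.IsChain N ∧ n.length = l.length}) ≤ normalSpan R N :=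
    Submodule.span_mono (Set.image_mono fun _ hn => hn.1)
  exact codisjoint_iff.mpr (Submodule.eq_top_iff'.mpr (map_mem_of_wd (f := LinearMap.id) fun l =>
    sup_le_sup_right (hle l) _ (wd_mem_span_sup_relIdeal h l)))

theorem disjoint_normalSpan (h : ∀ c ∈ Finsupp.supported R R {n : List (ℤ × S) | n.IsChain N},
    Finsupp.linearCombination R (wd R) c ∈ relIdeal gens → c = 0) :
    Disjoint (normalSpan R N) (relIdeal gens) := by
  refine Submodule.disjoint_def.mpr fun x hx hrel => ?_
  obtain ⟨c, hc, rfl⟩ := (Finsupp.mem_span_image_iff_linearCombination R).mp hx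
  rw [h c hc hrel, map_zero]

variable {R' : Type*} [CommRing R']

theorem disjoint_normalSpan_map (φ : R →+* R') {gens' : Set (TypRing R' S)}
    (h : IsCompl (normalSpan R N) (relIdeal gens))
    (hg : gens' ⊆ MonoidAlgebra.mapRingHom _ φ '' gens) :
    Disjoint (normalSpan R' N) (relIdeal gens') := by
  let Φ : TypRing R S →+* TypRing R' S := MonoidAlgebra.mapRingHom _ φ
  let ν := (normalSpan R N).projection (relIdeal gens) h
  let ν' : TypRing R' S →ₗ[R'] TypRing R' S := wdLift fun l => Φ (ν (wd R l))
  have hcomm : ∀ x, ν' (Φ x) = Φ (ν x) := by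
    intro x
    have hx : x ∈ Submodule.span R (Set.range (wd R : List (ℤ × S) → TypRing R S)) :=
      span_range_wd (R := R) (S := S) ▸ Submodule.mem_top
    induction hx using Submodule.span_induction with
    | zero => simp only [map_zero]
    | add x y _ _ hx hy => simp only [map_add, hx, hy]
    | smul a x _ hx => simp only [Φ, map_smul, mapRingHom_smul] at hx ⊢; rw [hx]
    | mem x hx => obtain ⟨l, rfl⟩ := hx; simp only [Φ, ν', mapRingHom_wd, wdLift_wd]
  have hker : relIdeal gens' ≤ LinearMap.ker ν' := relIdeal_le fun g' hg' u w => by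
    obtain ⟨g, hgg, rfl⟩ := hg hg'
    have hzero : ν (wd R u * g * wd R w) = 0 := LinearMap.mem_ker.mp
      ((Submodule.ker_projection h).symm ▸ mul_mem_relIdeal (subset_relIdeal hgg) _ _)
    rw [LinearMap.mem_ker, ← mapRingHom_wd φ, ← mapRingHom_wd φ, ← map_mul, ← map_mul]
    exact (hcomm _).trans (by rw [hzero, map_zero])
  have hfix : Set.EqOn ν' (LinearMap.id (R := R')) (wd R' '' {n | n.IsChain N}) := by
    rintro _ ⟨n, hn, rfl⟩
    have : ν (wd R n) = wd R n :=
      Submodule.projection_apply_of_mem_left h (Submodule.subset_span ⟨n, hn, rfl⟩)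
    simp only [ν', wdLift_wd, this, LinearMap.id_apply, Φ, mapRingHom_wd]
  exact Submodule.disjoint_def.mpr fun x hx hrel =>
    (LinearMap.eqOn_span hfix hx).symm.trans (LinearMap.mem_ker.mp (hker hrel))

end NormalSpan

end WordAlgebra

section WordFunctions

variable {S C 𝓡 : Type*} [CommRing 𝓡]

/-- The sum of the exponents of a word. -/
def degree (l : List (ℤ × S)) : ℤ := (l.map Prod.fst).sum

theorem degree_append (l l' : List (ℤ × S)) : degree (l ++ l') = degree l + degree l' := by
  simp [degree]

variable [DecidableEq C]

/-- The function of a variable and a colour given by a letter: a power of the variable, supported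
on one colour. -/
def letter (z : ℕ → 𝓡ˣ) (col : ℤ × S → C) (a : ℤ × S) (x : ℕ × C) : 𝓡 :=
  if x.2 = col a then ↑(z x.1 ^ a.1) else 0

/-- The function given by a word, namely the product of the functions `letter a_i` in the entries of
a sequence, twisted by the power `V ^ ∑ i * a_i` that makes the relations independent of the
position at which they are applied. -/
def wordFun (z : ℕ → 𝓡ˣ) (V : 𝓡ˣ) (col : ℤ × S → C) : List (ℤ × S) → (ℕ → ℕ × C) → 𝓡
  | [], _ => 1
  | a :: l, x => ↑(V ^ degree l) * letter z col a (x 0) * wordFun z V col l fun j => x (j + 1)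

variable (z : ℕ → 𝓡ˣ) (V : 𝓡ˣ) (col : ℤ × S → C)

theorem wordFun_pair (a b : ℤ × S) (x : ℕ → ℕ × C) :
    wordFun z V col [a, b] x = ↑(V ^ b.1) * letter z col a (x 0) * letter z col b (x 1) := by
  simp [wordFun, degree]

theorem wordFun_append (l l' : List (ℤ × S)) (x : ℕ → ℕ × C) :
    wordFun z V col (l ++ l') x = ↑((V ^ l.length) ^ degree l') * wordFun z V col l x *
      wordFun z V col l' fun j => x (l.length + j) := by
  induction l generalizing x with
  | nil => simp [wordFun]
  | cons a l ih =>
    have hpow : V ^ degree (l ++ l') * (V ^ l.length) ^ degree l' =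
        V ^ degree l * (V ^ (l.length + 1)) ^ degree l' := by
      rw [degree_append, zpow_add, pow_succ', mul_zpow, mul_assoc]
    have hshift : (fun j => x (l.length + j + 1)) = fun j => x (l.length + 1 + j) := by
      simp only [add_right_comm]
    simp only [List.cons_append, wordFun, ih, List.length_cons, hshift]
    replace hpow := congrArg Units.val hpow
    simp only [Units.val_mul] at hpow
    linear_combination letter z col a (x 0) * wordFun z V col l (fun j => x (j + 1)) *
      wordFun z V col l' (fun j => x (l.length + 1 + j)) * hpow

theorem wordFun_congr (l : List (ℤ × S)) {x y : ℕ → ℕ × C} (h : ∀ j < l.length, x j = y j) :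
    wordFun z V col l x = wordFun z V col l y := by
  induction l generalizing x y with
  | nil => rfl
  | cons a l ih =>
    rw [wordFun, wordFun, h 0 (by simp), ih fun j hj => h (j + 1) (by simpa using hj)]

variable (u w : List (ℤ × S)) (N : ℤ)

/-- The contribution of `u` and `w` to the function given by `u ++ l ++ w`, where `l` has length `2`
and degree `N`. -/
def sandwich (x : ℕ → ℕ × C) : 𝓡 :=
  ↑((V ^ u.length) ^ N * (V ^ (u.length + 2)) ^ degree w) * wordFun z V col u x *
    wordFun z V col w fun j => x (u.length + 2 + j)

theorem sandwich_put (x : ℕ → ℕ × C) (a b : ℕ × C) :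
    sandwich z V col u w N (put x u.length a b) = sandwich z V col u w N x := by
  have hu : wordFun z V col u (put x u.length a b) = wordFun z V col u x :=
    wordFun_congr z V col u fun j hj => put_of_ne _ _ _ _ (by omega) (by omega)
  have hw (j : ℕ) : put x u.length a b (u.length + 2 + j) = x (u.length + 2 + j) :=
    put_of_ne _ _ _ _ (by omega) (by omega)
  simp only [sandwich, hu, hw]

theorem wordFun_append_pair_append {a b : ℤ × S} (h : a.1 + b.1 = N) (x : ℕ → ℕ × C) :
    wordFun z V col (u ++ [a, b] ++ w) x =
      sandwich z V col u w N x * wordFun z V col [a, b] fun j => x (u.length + j) := by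
  have hdegree : degree [a, b] = N := by simpa [degree] using h
  simp only [wordFun_append, sandwich, hdegree, List.length_append, List.length_cons,
    List.length_nil, zero_add, Nat.reduceAdd, Units.val_mul]
  ring

end WordFunctions

section WordMap

variable {𝓡 C : Type*} {S : Type} [CommRing 𝓡]

variable (𝓡 S) in
/-- The combinations of words of length two and degree `N`. -/
noncomputable def pairSpan (N : ℤ) : Submodule 𝓡 (TypRing 𝓡 S) :=
  Submodule.span 𝓡 {x | ∃ a b : ℤ × S, a.1 + b.1 = N ∧ x = wd 𝓡 [a, b]}

theorem wd_mem_pairSpan {a b : ℤ × S} {N : ℤ} (h : a.1 + b.1 = N) : wd 𝓡 [a, b] ∈ pairSpan 𝓡 S N :=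
  Submodule.subset_span ⟨a, b, h, rfl⟩

variable [DecidableEq C] (z : ℕ → 𝓡ˣ) (V : 𝓡ˣ) (col : ℤ × S → C)

/-- The linear extension of `wordFun` from the words of length `r`, all other words being sent
to `0`. -/
noncomputable def wordMap (r : ℕ) : TypRing 𝓡 S →ₗ[𝓡] ((ℕ → ℕ × C) → 𝓡) :=
  wdLift fun l => if l.length = r then wordFun z V col l else 0

theorem wordMap_wd (r : ℕ) (l : List (ℤ × S)) :
    wordMap z V col r (wd 𝓡 l) = if l.length = r then wordFun z V col l else 0 :=
  wdLift_wd _ _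

variable {N : ℤ} {y : TypRing 𝓡 S} (hy : y ∈ pairSpan 𝓡 S N) {u w : List (ℤ × S)} {r : ℕ}
include hy

theorem wordMap_mul_mul (hr : u.length + 2 + w.length = r) :
    wordMap z V col r (wd 𝓡 u * y * wd 𝓡 w) = fun x =>
      sandwich z V col u w N x * wordMap z V col 2 y fun j => x (u.length + j) := by
  induction hy using Submodule.span_induction with
  | zero => simp only [mul_zero, zero_mul, map_zero, Pi.zero_apply]; rfl
  | add x y _ _ hx hy => simp only [mul_add, add_mul, map_add, hx, hy, Pi.add_apply]; rfl
  | smul c x _ hx =>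
    simp only [mul_smul_comm, smul_mul_assoc, map_smul, hx, Pi.smul_apply]
    rfl
  | mem y hy =>
    obtain ⟨a, b, hab, rfl⟩ := hy
    have hlength : (u ++ [a, b] ++ w).length = r := by simp; omega
    funext x
    rw [← wd_append, ← wd_append, wordMap_wd, if_pos hlength, wordMap_wd, if_pos (by rfl),
      wordFun_append_pair_append z V col u w N hab]

theorem wordMap_mul_mul_of_ne (hr : u.length + 2 + w.length ≠ r) :
    wordMap z V col r (wd 𝓡 u * y * wd 𝓡 w) = 0 := by
  induction hy using Submodule.span_induction with
  | zero => simp only [mul_zero, zero_mul, map_zero]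
  | add x y _ _ hx hy => simp only [mul_add, add_mul, map_add, hx, hy, add_zero]
  | smul c x _ hx => simp only [mul_smul_comm, smul_mul_assoc, map_smul, hx, smul_zero]
  | mem y hy =>
    obtain ⟨a, b, -, rfl⟩ := hy
    have hlength : (u ++ [a, b] ++ w).length ≠ r := by simp; omega
    rw [← wd_append, ← wd_append, wordMap_wd, if_neg hlength]

omit hy in
theorem relIdeal_le_ker_antisymm_comp_wordMap [Fintype C] [IsAddTorsionFree 𝓡] {k : RMatrix C 𝓡}
    (hk : k.IsBraided) {gens : Set (TypRing 𝓡 S)} (hgens : ∀ g ∈ gens, ∃ N, g ∈ pairSpan 𝓡 S N ∧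
      k.op 0 (wordMap z V col 2 g) = wordMap z V col 2 g) (r : ℕ) :
    relIdeal gens ≤ LinearMap.ker (antisymm k.op r ∘ₗ wordMap z V col r) := by
  refine relIdeal_le fun g hg u w => LinearMap.mem_ker.mpr ?_
  obtain ⟨N, hpair, hfix⟩ := hgens g hg
  rw [LinearMap.comp_apply]
  by_cases hr : u.length + 2 + w.length = r
  · have hfixed := k.op_mul_comp_shift (sandwich_put z V col u w N) (wordMap z V col 2 g)
    rw [hfix] at hfixed
    rw [wordMap_mul_mul z V col hpair hr]
    exact hk.isCoxeter_op.antisymm_apply_eq_zero (by omega) hfixed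
  · rw [wordMap_mul_mul_of_ne z V col hpair hr, map_zero]

end WordMap

section LeadingCoefficient

open Equiv

variable {C : Type*}

section Heights

/-- The exponents by which `shiftMatrix` deviates from a permutation of the variables. -/
def height (κ : C → C → ℤ) (c : ℕ → C) (j : ℕ) : ℤ := ∑ l ∈ Finset.range j, κ (c l) (c (l + 1))

theorem height_succ (κ : C → C → ℤ) (c : ℕ → C) (j : ℕ) :
    height κ c (j + 1) = height κ c j + κ (c j) (c (j + 1)) :=
  Finset.sum_range_succ _ _

theorem height_congr {κ : C → C → ℤ} {c c' : ℕ → C} {n : ℕ} (h : ∀ j < n, c j = c' j) :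
    Set.EqOn (height κ c) (height κ c') (Set.Iio n) := fun j hj => by
  refine Finset.sum_congr rfl fun l hl => ?_
  have := Finset.mem_range.mp hl
  rw [h l (by grind), h (l + 1) (by grind)]

end Heights

section Positions

variable {S : Type*} [Inhabited S]

/-- The exponents of a word, continued by arbitrary values. -/
def exps (l : List (ℤ × S)) (j : ℕ) : ℤ := (l.getD j default).1

/-- The colours of a word, continued by arbitrary values. -/
def cols (col : ℤ × S → C) (l : List (ℤ × S)) (j : ℕ) : C := col (l.getD j default)

theorem eq_of_exps_eq_of_cols_eq {col : ℤ × S → C}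
    (hcol : ∀ a b, col a = col b → a.1 = b.1 → a = b)
    {l l' : List (ℤ × S)} (hlength : l.length = l'.length)
    (h : ∀ j < l.length, cols col l j = cols col l' j ∧ exps l j = exps l' j) : l = l' := by
  refine List.ext_getElem hlength fun j hj hj' => ?_
  have hj'' := h j hj
  simp only [cols, exps, List.getD_eq_getElem _ _ hj, List.getD_eq_getElem _ _ hj'] at hj''
  exact hcol _ _ hj''.1 hj''.2

theorem strictAntiOn_of_isChain {col : ℤ × S → C} {κ : C → C → ℤ}
    {N : ℤ × S → ℤ × S → Prop} (hN : ∀ a b, N a b → b.1 < a.1 + κ (col a) (col b))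
    {l : List (ℤ × S)} (hl : l.IsChain N) :
    StrictAntiOn (exps l - height κ (cols col l)) (Set.Iio l.length) := by
  refine strictAntiOn_of_succ_lt Set.ordConnected_Iio fun j _ _ hj => ?_
  have hlt : j + 1 < l.length := hj
  have hchain := hN _ _ (List.isChain_iff_getElem.mp hl j hlt)
  simp only [Order.succ_eq_add_one, Pi.sub_apply, height_succ, exps, cols,
    List.getD_eq_getElem _ _ hlt, List.getD_eq_getElem _ _ (Nat.lt_of_succ_lt hlt)]
  linarith

end Positions

variable {𝓡 : Type*} [CommRing 𝓡] [DecidableEq C]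

/-- The diagonal matrices `(u_j / u_i) ^ κ(c, d)`. -/
def shiftMatrix (z : ℕ → 𝓡ˣ) (κ : C → C → ℤ) : RMatrix C 𝓡 := fun i j =>
  Matrix.diagonal fun c => ↑(z i ^ (-κ c.1 c.2) * z j ^ κ c.1 c.2)

theorem shiftMatrix_tensor {C' : Type*} [DecidableEq C'] (z : ℕ → 𝓡ˣ) (κ : C → C → ℤ)
    (κ' : C' → C' → ℤ) : (shiftMatrix z κ).tensor (shiftMatrix z κ') =
      shiftMatrix z fun c d => κ c.1 d.1 + κ' c.2 d.2 := by
  funext i j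
  rw [RMatrix.tensor, shiftMatrix, shiftMatrix, Matrix.diagonal_kronecker_diagonal,
    Matrix.submatrix_diagonal_equiv]
  refine congrArg Matrix.diagonal (funext fun c => ?_)
  simp only [Function.comp_apply, Equiv.prodProdProdComm_apply, neg_add, zpow_add, Units.val_mul]
  ring

theorem op_shiftMatrix [Fintype C] (z : ℕ → 𝓡ˣ) (κ : C → C → ℤ) (i : ℕ) (F : (ℕ → ℕ × C) → 𝓡)
    (x : ℕ → ℕ × C) : (shiftMatrix z κ).op i F x =
      ↑(z (x i).1 ^ (-κ (x i).2 (x (i + 1)).2) * z (x (i + 1)).1 ^ κ (x i).2 (x (i + 1)).2) *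
        F (put x i ((x (i + 1)).1, (x i).2) ((x i).1, (x (i + 1)).2)) := by
  simp only [RMatrix.op_apply, shiftMatrix, Matrix.diagonal_apply, ite_mul, zero_mul,
    Finset.sum_ite_eq, Finset.mem_univ, if_true]

section Monomials

/-- The product of the `f_j`-th powers of the variables, supported on the colours `c_0, c_1, …`. -/
def monoFun (z : ℕ → 𝓡ˣ) (n : ℕ) (c : ℕ → C) (f : ℕ → ℤ) (x : ℕ → ℕ × C) : 𝓡 :=
  ∏ j ∈ Finset.range n, if (x j).2 = c j then ↑(z (x j).1 ^ f j) else 0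

theorem op_shiftMatrix_monoFun [Fintype C] (z : ℕ → 𝓡ˣ) (κ : C → C → ℤ) {n : ℕ} (c : ℕ → C)
    (e : ℕ → ℤ) {i : ℕ} (hi : i + 1 < n) :
    (shiftMatrix z κ).op i (monoFun z n c (e + height κ c)) =
      monoFun z n c (e ∘ swap i (i + 1) + height κ c) := by
  have hsplit (f : ℕ → ℤ) (x : ℕ → ℕ × C) : monoFun z n c f x =
      (∏ j ∈ Finset.range n \ {i, i + 1}, if (x j).2 = c j then (↑(z (x j).1 ^ f j) : 𝓡) else 0) *
        ((if (x i).2 = c i then ↑(z (x i).1 ^ f i) else 0) *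
          if (x (i + 1)).2 = c (i + 1) then ↑(z (x (i + 1)).1 ^ f (i + 1)) else 0) := by
    rw [monoFun, ← Finset.prod_pair (f := fun j => if (x j).2 = c j then (↑(z (x j).1 ^ f j) : 𝓡)
      else 0) (Nat.ne_add_one i)]
    refine (Finset.prod_sdiff fun j hj => Finset.mem_range.mpr ?_).symm
    rcases Finset.mem_insert.mp hj with rfl | hj
    · omega
    · rwa [Finset.mem_singleton.mp hj]
  funext x
  rw [op_shiftMatrix, hsplit, hsplit, mul_left_comm]
  congr 1
  · refine Finset.prod_congr rfl fun j hj => ?_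
    simp only [Finset.mem_sdiff, Finset.mem_insert, Finset.mem_singleton, not_or] at hj
    rw [put_of_ne _ _ _ _ hj.2.1 hj.2.2, Pi.add_apply, Pi.add_apply, Function.comp_apply,
      swap_apply_of_ne_of_ne hj.2.1 hj.2.2]
  · simp only [put_left, put_right, Pi.add_apply, Function.comp_apply, swap_apply_left,
      swap_apply_right, height_succ]
    by_cases hc : (x i).2 = c i
    · by_cases hc' : (x (i + 1)).2 = c (i + 1)
      · simp only [hc, hc', if_true, ← Units.val_mul]
        rw [mul_comm (_ ^ (e i + _)), mul_mul_mul_comm, ← zpow_add, ← zpow_add]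
        ring_nf
      · simp only [if_neg hc', mul_zero]
    · simp only [if_neg hc, mul_zero, zero_mul]

end Monomials

theorem eq_one_of_strictMono {π : Perm ℕ} (h : StrictMono π) : π = 1 := by
  let f : ℕ ≃o ℕ := ⟨π, h.le_iff_le⟩
  exact congrArg RelIso.toEquiv (Subsingleton.elim f (OrderIso.refl ℕ))

theorem eq_one_of_strictAntiOn {π : Perm ℕ} {n : ℕ} (hπ : π ∈ permsBelow n) {e : ℕ → ℤ}
    (he : StrictAntiOn e (Set.Iio n)) (heπ : StrictAntiOn (e ∘ π) (Set.Iio n)) : π = 1 := by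
  have hlt {i : ℕ} (hi : i < n) : π i < n := by
    by_contra h
    have := π.injective (hπ (π i) (not_lt.mp h))
    omega
  refine eq_one_of_strictMono fun i j hij => ?_
  rcases lt_or_ge j n with hj | hj
  · exact (he.lt_iff_gt (hlt hj) (hlt (hij.trans hj))).mp (heπ (hij.trans hj) hj hij)
  · rw [hπ j hj]
    rcases lt_or_ge i n with hi | hi
    · exact (hlt hi).trans_le hj
    · rwa [hπ i hi]

section LaurentRing

/-- The ring of Laurent polynomials in infinitely many variables. -/
abbrev LaurentRing : Type := AddMonoidAlgebra ℤ (ℕ →₀ ℤ)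

/-- The variables of `LaurentRing`. -/
noncomputable def laurentVar (i : ℕ) : LaurentRingˣ where
  val := AddMonoidAlgebra.single (Finsupp.single i 1) 1
  inv := AddMonoidAlgebra.single (Finsupp.single i (-1)) 1
  val_inv := by
    rw [AddMonoidAlgebra.single_mul_single, ← Finsupp.single_add]
    simp [AddMonoidAlgebra.one_def]
  inv_val := by
    rw [AddMonoidAlgebra.single_mul_single, ← Finsupp.single_add]
    simp [AddMonoidAlgebra.one_def]

theorem laurentVar_zpow (i : ℕ) (m : ℤ) :
    (↑(laurentVar i ^ m) : LaurentRing) = AddMonoidAlgebra.single (Finsupp.single i m) 1 := by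
  induction m using Int.induction_on with
  | zero => simp [AddMonoidAlgebra.one_def]
  | succ n ih =>
    rw [zpow_add_one, Units.val_mul, ih, laurentVar, AddMonoidAlgebra.single_mul_single,
      ← Finsupp.single_add, mul_one]
  | pred n ih =>
    rw [zpow_sub_one, Units.val_mul, ih, laurentVar, Units.inv_mk,
      AddMonoidAlgebra.single_mul_single, ← Finsupp.single_add, mul_one, sub_eq_add_neg]

/-- The coefficient of the monomial with exponents `f_0, …, f_{n-1}` in the value of a function at
the sequence of all variables, with colours `c_0, c_1, …`. -/
noncomputable def monoCoeff (n : ℕ) (c : ℕ → C) (f : ℕ → ℤ) :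
    ((ℕ → ℕ × C) → LaurentRing) →+ ℤ where
  toFun F := (F fun j => (j, c j)).coeff (∑ j ∈ Finset.range n, Finsupp.single j (f j))
  map_zero' := by simp
  map_add' F G := by simp

theorem monoCoeff_monoFun (n : ℕ) (c c' : ℕ → C) (f f' : ℕ → ℤ) :
    monoCoeff n c f (monoFun laurentVar n c' f') =
      if ∀ j < n, c j = c' j ∧ f j = f' j then 1 else 0 := by
  have hdef : monoCoeff n c f (monoFun laurentVar n c' f') =
    (monoFun laurentVar n c' f' fun j => (j, c j)).coeff
      (∑ j ∈ Finset.range n, Finsupp.single j (f j)) := rfl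
  rw [hdef]
  by_cases hc : ∀ j < n, c j = c' j
  · have hmono : (monoFun laurentVar n c' f' fun j => (j, c j)) = AddMonoidAlgebra.single
        (∑ j ∈ Finset.range n, Finsupp.single j (f' j)) 1 := by
      rw [← Finset.prod_const_one (s := Finset.range n), ← AddMonoidAlgebra.prod_single]
      exact Finset.prod_congr rfl fun j hj => by
        rw [if_pos (hc j (Finset.mem_range.mp hj)), laurentVar_zpow]
    have hexp (f : ℕ → ℤ) {i : ℕ} (hi : i < n) :
        (∑ j ∈ Finset.range n, Finsupp.single j (f j)) i = f i := by
      simp [Finsupp.finsetSum_apply, Finsupp.single_apply, hi]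
    rw [hmono, AddMonoidAlgebra.coeff_single, Finsupp.single_apply]
    refine if_congr ⟨fun h j hj => ⟨hc j hj, ?_⟩, fun h => ?_⟩ rfl rfl
    · rw [← hexp f hj, ← hexp f' hj, h]
    · exact Finset.sum_congr rfl fun j hj => by rw [(h j (Finset.mem_range.mp hj)).2]
  · rw [if_neg fun h => hc fun j hj => (h j hj).1]
    push Not at hc
    obtain ⟨j, hj, hne⟩ := hc
    rw [monoFun, Finset.prod_eq_zero (Finset.mem_range.mpr hj) (if_neg hne)]
    rfl

end LaurentRing

section Words

variable {S : Type*}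

variable (z : ℕ → 𝓡ˣ) (V : 𝓡ˣ) (col : ℤ × S → C)

/-- The exponent `∑ i * a_i` of the twist in `wordFun`. -/
def weight : List (ℤ × S) → ℤ
  | [] => 0
  | _ :: l => degree l + weight l

theorem wordFun_eq_weight (l : List (ℤ × S)) (x : ℕ → ℕ × C) :
    wordFun z V col l x = ↑(V ^ weight l) * wordFun z 1 col l x := by
  induction l generalizing x with
  | nil => simp [wordFun, weight]
  | cons a l ih =>
    rw [wordFun, wordFun, ih, one_zpow, weight, zpow_add, Units.val_mul, Units.val_one]
    ring

theorem map_wordFun {𝓡' : Type*} [CommRing 𝓡'] (f : 𝓡 →+* 𝓡') (l : List (ℤ × S))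
    (x : ℕ → ℕ × C) :
    f (wordFun z V col l x) = wordFun (Units.map f ∘ z) (Units.map f V) col l x := by
  induction l generalizing x with
  | nil => exact map_one f
  | cons a l ih =>
    have hletter (y) : f (letter z col a y) = letter (Units.map f ∘ z) col a y := by
      rw [letter, letter, apply_ite f, map_zero, Function.comp_apply, ← map_zpow]
      rfl
    rw [wordFun, wordFun, map_mul, map_mul, ih, hletter, ← map_zpow]
    rfl

variable [Inhabited S]

theorem wordFun_one (l : List (ℤ × S)) :
    wordFun z 1 col l = monoFun z l.length (cols col l) (exps l) := by
  funext x
  induction l generalizing x with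
  | nil => rfl
  | cons a l ih =>
    rw [wordFun, ih, one_zpow, Units.val_one, one_mul, monoFun, monoFun, List.length_cons,
      Finset.prod_range_succ', mul_comm]
    rfl

variable {col} {κ : C → C → ℤ} {N : ℤ × S → ℤ × S → Prop}

/-- The coefficient in a function of the monomial corresponding to a word. -/
noncomputable def wordCoeff (col : ℤ × S → C) (b : List (ℤ × S)) :
    ((ℕ → ℕ × C) → LaurentRing) →+ ℤ :=
  monoCoeff b.length (cols col b) (exps b)

theorem wordCoeff_antisymm_wordFun [Fintype C] [DecidableEq S]
    (hcol : ∀ a b, col a = col b → a.1 = b.1 → a = b)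
    (hN : ∀ a b, N a b → b.1 < a.1 + κ (col a) (col b)) {b n : List (ℤ × S)} (hb : b.IsChain N)
    (hn : n.IsChain N) (hbn : b.length = n.length) :
    wordCoeff col b (antisymm (shiftMatrix laurentVar κ).op b.length
      (wordFun laurentVar 1 col n)) = if n = b then 1 else 0 := by
  set e := exps n - height κ (cols col n) with he
  let E (π : Perm ℕ) := monoFun laurentVar b.length (cols col n) (e ∘ π + height κ (cols col n))
  have hE (i : ℕ) (hi : i + 1 < b.length) (π : Perm ℕ) :
      (shiftMatrix laurentVar κ).op i (E π) = E (π * swap i (i + 1)) :=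
    op_shiftMatrix_monoFun laurentVar κ _ _ hi
  have hE_one : wordFun laurentVar 1 col n = E 1 := by
    rw [wordFun_one, ← hbn]
    simp only [E, Perm.coe_one, Function.comp_id, he, sub_add_cancel]
  have hzero : AddSubgroup.closure (E '' {π | π ∈ permsBelow b.length ∧ π ≠ 1}) ≤
      (wordCoeff col b).ker := by
    rw [AddSubgroup.closure_le]
    rintro _ ⟨π, ⟨hπ, hne⟩, rfl⟩
    refine (monoCoeff_monoFun _ _ _ _ _).trans (if_neg fun h => hne ?_)
    refine eq_one_of_strictAntiOn hπ (hbn ▸ strictAntiOn_of_isChain hN hn)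
      ((strictAntiOn_of_isChain hN hb).congr fun j hj => ?_)
    rw [Pi.sub_apply, (h j hj).2, height_congr (fun j hj => (h j hj).1) hj, Pi.add_apply,
      add_sub_cancel_right]
  have hlead : wordCoeff col b (antisymm (shiftMatrix laurentVar κ).op b.length (E 1)) =
      wordCoeff col b (E 1) :=
    sub_eq_zero.mp ((map_sub _ _ _).symm.trans (hzero (antisymm_sub_mem_closure hE)))
  rw [hE_one, hlead, ← hE_one, wordFun_one, ← hbn]
  refine (monoCoeff_monoFun _ _ _ _ _).trans (if_congr ⟨fun h => ?_, ?_⟩ rfl rfl)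
  · exact (eq_of_exps_eq_of_cols_eq hcol hbn h).symm
  · rintro rfl
    exact fun _ _ => ⟨rfl, rfl⟩

end Words

end LeadingCoefficient

section Independence

open LaurentPolynomial

theorem eq_zero_of_sum_map_mul_eq_zero {ι X L : Type*} [DecidableEq ι] [CommRing L] {s : Finset ι}
    {p : ι → PowerSeries ℤ} {Y : ι → X → PowerSeries L} {f : ι → (X → L) →+ ℤ}
    (hY : ∀ b ∈ s, ∀ n ∈ s, f b (PowerSeries.constantCoeff ∘ Y n) = if n = b then 1 else 0)
    (h : ∀ x, ∑ n ∈ s, PowerSeries.map (Int.castRingHom L) (p n) * Y n x = 0) :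
    ∀ n ∈ s, p n = 0 := by
  suffices hcoeff : ∀ m, ∀ n ∈ s, PowerSeries.coeff m (p n) = 0 from
    fun n hn => PowerSeries.ext fun m => hcoeff m n hn
  intro m
  induction m using Nat.strong_induction_on with | _ m ih =>
  intro b hb
  have hterm (x : X) : ∀ n ∈ s, PowerSeries.coeff m (PowerSeries.map (Int.castRingHom L) (p n) *
      Y n x) = (PowerSeries.coeff m (p n) • (PowerSeries.constantCoeff ∘ Y n)) x := by
    intro n hn
    rw [PowerSeries.coeff_mul, Finset.sum_eq_single (m, 0)]
    · rw [PowerSeries.coeff_map, PowerSeries.coeff_zero_eq_constantCoeff_apply, eq_intCast,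
        ← zsmul_eq_mul, Pi.smul_apply, Function.comp_apply]
    · rintro ⟨i, j⟩ hij hne
      have hsum : i + j = m := Finset.HasAntidiagonal.mem_antidiagonal.mp hij
      have hi : i < m := by
        rcases Nat.eq_zero_or_pos j with rfl | hj
        · exact absurd (by rw [← hsum, add_zero]) hne
        · omega
      rw [PowerSeries.coeff_map, ih i hi n hn, map_zero, zero_mul]
    · exact fun hm => absurd (Finset.HasAntidiagonal.mem_antidiagonal.mpr (add_zero m)) hm
  have hlead : ∑ n ∈ s, PowerSeries.coeff m (p n) • (PowerSeries.constantCoeff ∘ Y n) = 0 :=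
    funext fun x => by
      rw [Finset.sum_apply, ← Finset.sum_congr rfl (hterm x), ← map_sum, h x, map_zero,
        Pi.zero_apply]
  have hcoeff := congrArg (f b) hlead
  rw [map_sum, map_zero, Finset.sum_congr rfl fun n hn => by
    rw [map_zsmul, hY b hb n hn, smul_eq_mul, mul_ite, mul_one, mul_zero]] at hcoeff
  rwa [Finset.sum_ite_eq' s b, if_pos hb] at hcoeff

section LaurentSeries

variable (L : Type*) [CommRing L]

/-- The variable of the ring of Laurent series. -/
noncomputable def seriesVar : (LaurentSeries L)ˣ where
  val := HahnSeries.single 1 1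
  inv := HahnSeries.single (-1) 1
  val_inv := by simp
  inv_val := by simp

/-- The inclusion of the Laurent polynomials in the Laurent series. -/
noncomputable def laurentToSeries : ℤ[T;T⁻¹] →+* LaurentSeries L :=
  LaurentPolynomial.eval₂ (Int.castRingHom _) (seriesVar L)

theorem laurentToSeries_T (m : ℤ) : laurentToSeries L (T m) = ↑(seriesVar L ^ m) :=
  LaurentPolynomial.eval₂_T _ _ _

theorem laurentToSeries_toLaurent (p : Polynomial ℤ) : laurentToSeries L p.toLaurent =
    HahnSeries.ofPowerSeries ℤ L (PowerSeries.map (Int.castRingHom L) p) := by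
  have hcomp : (laurentToSeries L).comp Polynomial.toLaurent =
      ((HahnSeries.ofPowerSeries ℤ L).comp (PowerSeries.map (Int.castRingHom L))).comp
        Polynomial.coeToPowerSeries.ringHom := by
    refine Polynomial.ringHom_ext (by simp) ?_
    simp [laurentToSeries_T, seriesVar]
  exact RingHom.congr_fun hcomp p

variable {L}

theorem eq_zero_of_sum_laurentToSeries_mul_eq_zero {ι X : Type*} [DecidableEq ι] {s : Finset ι}
    {d : ι → ℤ[T;T⁻¹]} {Y : ι → X → PowerSeries L} {f : ι → (X → L) →+ ℤ}
    (hY : ∀ b ∈ s, ∀ n ∈ s, f b (PowerSeries.constantCoeff ∘ Y n) = if n = b then 1 else 0)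
    (h : ∀ x, ∑ n ∈ s, laurentToSeries L (d n) * HahnSeries.ofPowerSeries ℤ L (Y n x) = 0) :
    ∀ n ∈ s, d n = 0 := by
  obtain ⟨⟨_, k, rfl⟩, hk⟩ := IsLocalization.exist_integer_multiples_of_finset
    (Submonoid.powers (Polynomial.X : Polynomial ℤ)) (s.image d)
  choose! p hp using fun n (hn : n ∈ s) => hk (d n) (Finset.mem_image_of_mem d hn)
  have hpd (n) (hn : n ∈ s) : (p n).toLaurent = T k * d n := by
    refine (hp n hn).trans ((Algebra.smul_def (Polynomial.X ^ k) (d n)).trans ?_)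
    rw [LaurentPolynomial.algebraMap_eq_toLaurent, Polynomial.toLaurent_X_pow]
  have hp_zero : ∀ n ∈ s, (p n : PowerSeries ℤ) = 0 := by
    refine eq_zero_of_sum_map_mul_eq_zero hY fun x =>
      HahnSeries.ofPowerSeries_injective (Γ := ℤ) ?_
    calc HahnSeries.ofPowerSeries ℤ L (∑ n ∈ s, PowerSeries.map (Int.castRingHom L) (p n) * Y n x)
        = laurentToSeries L (T k) * ∑ n ∈ s, laurentToSeries L (d n) *
            HahnSeries.ofPowerSeries ℤ L (Y n x) := by
          rw [map_sum, Finset.mul_sum]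
          refine Finset.sum_congr rfl fun n hn => ?_
          rw [map_mul, ← laurentToSeries_toLaurent, hpd n hn, map_mul, mul_assoc]
      _ = HahnSeries.ofPowerSeries ℤ L 0 := by rw [h x, mul_zero, map_zero]
  intro n hn
  have hT : IsUnit (T k : ℤ[T;T⁻¹]) := LaurentPolynomial.isUnit_T _
  rw [← hT.mul_right_eq_zero, ← hpd n hn, Polynomial.coe_eq_zero_iff.mp (hp_zero n hn), map_zero]

end LaurentSeries

instance : IsAddTorsionFree (LaurentSeries LaurentRing) where
  nsmul_right_injective n hn x y hxy := by
    ext t i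
    have h : n • (x.coeff t).coeff i = n • (y.coeff t).coeff i :=
      congrArg (fun F => (HahnSeries.coeff F t).coeff i) hxy
    exact nsmul_right_injective hn h

/-- The variables of `LaurentRing`, in the ring of Laurent series. -/
noncomputable def seriesLaurentVar : ℕ → (LaurentSeries LaurentRing)ˣ :=
  Units.map ((HahnSeries.ofPowerSeries ℤ LaurentRing).comp PowerSeries.C) ∘ laurentVar

variable {C : Type*} {S : Type} [Fintype C] [DecidableEq C]

theorem map_mem_relIdeal {R R' : Type*} [CommRing R] [CommRing R'] (φ : R →+* R')
    {gens : Set (TypRing R S)} {x : TypRing R S} (hx : x ∈ relIdeal gens) :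
    MonoidAlgebra.mapRingHom _ φ x ∈ relIdeal (MonoidAlgebra.mapRingHom _ φ '' gens) := by
  rw [mem_relIdeal] at hx ⊢
  have hle : TwoSidedIdeal.span gens ≤ (TwoSidedIdeal.span (MonoidAlgebra.mapRingHom
      (FreeMonoid (ℤ × S)) φ '' gens)).comap (MonoidAlgebra.mapRingHom _ φ) :=
    TwoSidedIdeal.span_le.mpr fun g hg =>
      (TwoSidedIdeal.mem_comap _).mpr (TwoSidedIdeal.subset_span ⟨g, hg, rfl⟩)
  exact (TwoSidedIdeal.mem_comap _).mp (hle hx)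

theorem antisymm_wordFun_series (k : RMatrix C (PowerSeries LaurentRing)) (col : ℤ × S → C)
    (r : ℕ) (l : List (ℤ × S)) (x : ℕ → ℕ × C) :
    antisymm (k.map (HahnSeries.ofPowerSeries ℤ LaurentRing)).op r
      (wordFun seriesLaurentVar (seriesVar LaurentRing)⁻¹ col l) x =
    laurentToSeries LaurentRing (T (-weight l)) * HahnSeries.ofPowerSeries ℤ LaurentRing
      (antisymm k.op r (PowerSeries.C ∘ wordFun laurentVar 1 col l) x) := by
  have hwordFun : wordFun seriesLaurentVar (seriesVar LaurentRing)⁻¹ col l =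
      laurentToSeries LaurentRing (T (-weight l)) • (HahnSeries.ofPowerSeries ℤ LaurentRing ∘
        PowerSeries.C ∘ wordFun laurentVar 1 col l) := by
    funext y
    have hmap := map_wordFun laurentVar 1 col
      ((HahnSeries.ofPowerSeries ℤ LaurentRing).comp PowerSeries.C) l y
    rw [map_one] at hmap
    rw [wordFun_eq_weight, inv_zpow', laurentToSeries_T, seriesLaurentVar, ← hmap]
    rfl
  rw [hwordFun, map_smul, RMatrix.map_antisymm]
  rfl

variable {R : Type*} [CommRing R]

theorem sum_laurentToSeries_mul_antisymm_eq_zero {col : ℤ × S → C}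
    {k : RMatrix C (PowerSeries LaurentRing)}
    (hk : (k.map (HahnSeries.ofPowerSeries ℤ LaurentRing)).IsBraided)
    {φ : R →+* ℤ[T;T⁻¹]} {gens : Set (TypRing R S)}
    (hgens : ∀ g ∈ MonoidAlgebra.mapRingHom _ ((laurentToSeries LaurentRing).comp φ) '' gens,
      ∃ d, g ∈ pairSpan _ S d ∧
        (k.map (HahnSeries.ofPowerSeries ℤ LaurentRing)).op 0
          (wordMap seriesLaurentVar (seriesVar LaurentRing)⁻¹ col 2 g) =
            wordMap seriesLaurentVar (seriesVar LaurentRing)⁻¹ col 2 g)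
    {c : List (ℤ × S) →₀ R} (hrel : Finsupp.linearCombination R (wd R) c ∈ relIdeal gens)
    (r : ℕ) (x : ℕ → ℕ × C) :
    ∑ n ∈ c.support with n.length = r,
      laurentToSeries LaurentRing (φ (c n) * T (-weight n)) *
        HahnSeries.ofPowerSeries ℤ LaurentRing
          (antisymm k.op r (PowerSeries.C ∘ wordFun laurentVar 1 col n) x) = 0 := by
  have hker := congrFun (LinearMap.mem_ker.mp (relIdeal_le_ker_antisymm_comp_wordMap
    seriesLaurentVar (seriesVar LaurentRing)⁻¹ col hk hgens r (map_mem_relIdeal _ hrel))) x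
  simp only [Finsupp.linearCombination_apply, Finsupp.sum, map_sum, mapRingHom_smul,
    mapRingHom_wd, LinearMap.comp_apply, map_smul, wordMap_wd] at hker
  rw [Finset.sum_apply, Pi.zero_apply] at hker
  refine (Finset.sum_filter _ _).trans ((Finset.sum_congr rfl fun n _ => ?_).trans hker)
  rw [Pi.smul_apply, smul_eq_mul]
  split_ifs with hn
  · rw [antisymm_wordFun_series, map_mul, mul_assoc]
    rfl
  · rw [map_zero, Pi.zero_apply, mul_zero]

theorem disjoint_normalSpan_of_isBraided [Inhabited S] {col : ℤ × S → C} {κ : C → C → ℤ}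
    {N : ℤ × S → ℤ × S → Prop} (hcol : ∀ a b, col a = col b → a.1 = b.1 → a = b)
    (hN : ∀ a b, N a b → b.1 < a.1 + κ (col a) (col b))
    {k : RMatrix C (PowerSeries LaurentRing)}
    (hk : (k.map (HahnSeries.ofPowerSeries ℤ LaurentRing)).IsBraided)
    (hκ : k.map PowerSeries.constantCoeff = shiftMatrix laurentVar κ)
    {φ : R →+* ℤ[T;T⁻¹]} (hφ : Function.Injective φ) {gens : Set (TypRing R S)}
    (hgens : ∀ g ∈ MonoidAlgebra.mapRingHom _ ((laurentToSeries LaurentRing).comp φ) '' gens,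
      ∃ d, g ∈ pairSpan _ S d ∧
        (k.map (HahnSeries.ofPowerSeries ℤ LaurentRing)).op 0
          (wordMap seriesLaurentVar (seriesVar LaurentRing)⁻¹ col 2 g) =
            wordMap seriesLaurentVar (seriesVar LaurentRing)⁻¹ col 2 g) :
    Disjoint (normalSpan R N) (relIdeal gens) := by
  classical
  refine disjoint_normalSpan fun c hc hrel => Finsupp.ext fun b => ?_
  set s := c.support.filter fun n => n.length = b.length
  have hlength : ∀ n ∈ s, n.length = b.length := fun n hn => (Finset.mem_filter.mp hn).2
  have hchain : ∀ n ∈ s, n.IsChain N := fun n hn => hc (Finset.mem_filter.mp hn).1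
  let Y (n : List (ℤ × S)) : (ℕ → ℕ × C) → PowerSeries LaurentRing :=
    antisymm k.op b.length (PowerSeries.C ∘ wordFun laurentVar 1 col n)
  have hlead : ∀ b' ∈ s, ∀ n ∈ s, wordCoeff col b' (PowerSeries.constantCoeff ∘ Y n) =
      if n = b' then 1 else 0 := by
    intro b' hb' n hn
    rw [← wordCoeff_antisymm_wordFun hcol hN (hchain b' hb') (hchain n hn)
      ((hlength b' hb').trans (hlength n hn).symm), ← hκ, hlength b' hb', ← RMatrix.map_antisymm]
    rfl
  by_contra hne
  have hb : b ∈ s := Finset.mem_filter.mpr ⟨Finsupp.mem_support_iff.mpr hne, rfl⟩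
  have hzero := eq_zero_of_sum_laurentToSeries_mul_eq_zero hlead
    (sum_laurentToSeries_mul_antisymm_eq_zero hk hgens hrel b.length) b hb
  exact hne (hφ (((LaurentPolynomial.isUnit_T _).mul_left_eq_zero.mp hzero).trans
    (map_zero φ).symm))

end Independence

section Specialization

open Polynomial LaurentPolynomial

/-- The homomorphism from polynomials to Laurent polynomials with `X ↦ T⁻ᵐ`. -/
noncomputable def inversePowerHom (m : ℕ) : ℤ[X] →+* ℤ[T;T⁻¹] :=
  (LaurentPolynomial.invert (R := ℤ)).toRingHom.comp (toLaurent.comp (expand ℤ m).toRingHom)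

theorem inversePowerHom_injective {m : ℕ} (hm : 0 < m) :
    Function.Injective (inversePowerHom m) :=
  (LaurentPolynomial.invert (R := ℤ)).injective.comp
    (toLaurent_injective.comp (expand_injective hm))

theorem laurentToSeries_inversePowerHom_X (L : Type*) [CommRing L] (m : ℕ) :
    laurentToSeries L (inversePowerHom m X) = ↑((seriesVar L)⁻¹ ^ m) := by
  have hX : inversePowerHom m X = T (-(m : ℤ)) := by simp [inversePowerHom]
  rw [hX, laurentToSeries_T, zpow_neg, zpow_natCast, inv_pow]

theorem exists_inverse_laurentVar_pow_sub {n : ℕ} (hn : n ≠ 0) :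
    ∃ d : ℕ → ℕ → PowerSeries LaurentRing,
      (∀ i j, HahnSeries.ofPowerSeries ℤ LaurentRing (d i j) *
        ((seriesLaurentVar i : LaurentSeries LaurentRing) ^ n -
          (seriesVar LaurentRing : LaurentSeries LaurentRing) ^ n * seriesLaurentVar j ^ n) = 1) ∧
      ∀ i j, PowerSeries.constantCoeff (d i j) * (laurentVar i : LaurentRing) ^ n = 1 := by
  let D (i j : ℕ) : PowerSeries LaurentRing :=
    PowerSeries.C (laurentVar i : LaurentRing) ^ n -
      PowerSeries.X ^ n * PowerSeries.C (laurentVar j : LaurentRing) ^ n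
  have hD (i j : ℕ) : PowerSeries.constantCoeff (D i j) = (laurentVar i : LaurentRing) ^ n := by
    simp [D, hn]
  choose d hd using fun i j => (show IsUnit (D i j) by
    rw [PowerSeries.isUnit_iff_constantCoeff, hD]
    exact (laurentVar i).isUnit.pow n).exists_left_inv
  refine ⟨d, fun i j => ?_, fun i j => by rw [← hD i j, ← map_mul, hd, map_one]⟩
  have h := congrArg (HahnSeries.ofPowerSeries ℤ LaurentRing) (hd i j)
  simp only [D, map_mul, map_sub, map_pow, map_one, HahnSeries.ofPowerSeries_X] at h
  exact h

end Specialization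

section PairWords

variable {R : Type*} [CommRing R] {S : Type}

theorem wd_mem_span_straighter {a b a' b' : ℤ} {s₁ s₂ s₁' s₂' : S} (ha : a < a') (hb : a' ≤ b)
    (hsum : a' + b' = a + b) : wd R [(a', s₁'), (b', s₂')] ∈
      Submodule.span R (wd R '' straighter (a, s₁) (b, s₂)) :=
  Submodule.subset_span ⟨_, ⟨_, _, ha, hb, hsum, rfl⟩, rfl⟩

variable {C : Type*} [DecidableEq C]

theorem wordMap_pair (z : ℕ → Rˣ) (V : Rˣ) (col : ℤ × S → C) (a b : ℤ × S) (x : ℕ → ℕ × C) :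
    wordMap z V col 2 (wd R [a, b]) x =
      ↑(V ^ b.1) * letter z col a (x 0) * letter z col b (x 1) := by
  rw [wordMap_wd, if_pos (by rfl), wordFun_pair]

end PairWords

section FixedVectors

open Matrix

variable {C C' 𝓡 : Type*} [CommRing 𝓡] [Fintype C] [Fintype C']

namespace RMatrix

/-- Invariance under `op 0` of the function of two variables and two colours given by `G`. -/
def IsFixed (k : RMatrix C 𝓡) (G : ℕ → ℕ → C × C → 𝓡) : Prop :=
  ∀ i j, k i j *ᵥ G j i = G i j

variable {k : RMatrix C 𝓡} {G : ℕ → ℕ → C × C → 𝓡}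

theorem IsFixed.op_eq_self (h : k.IsFixed G) {s : ℕ → ℕ → 𝓡} (hs : ∀ i j, s i j = s j i)
    {F : (ℕ → ℕ × C) → 𝓡}
    (hF : ∀ x, F x = s (x 0).1 (x 1).1 * G (x 0).1 (x 1).1 ((x 0).2, (x 1).2)) :
    k.op 0 F = F := by
  funext x
  rw [op_apply, hF, ← h (x 0).1, hs, mulVec, dotProduct, Finset.mul_sum]
  simp only [hF, zero_add, put_left, put_right, mul_left_comm]

theorem IsFixed.tensor (h : k.IsFixed G) {k' : RMatrix C' 𝓡} {G' : ℕ → ℕ → C' × C' → 𝓡}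
    (h' : k'.IsFixed G') : (k.tensor k').IsFixed fun i j c =>
      G i j (c.1.1, c.2.1) * G' i j (c.1.2, c.2.2) := by
  intro i j
  funext c
  change _ = G i j (c.1.1, c.2.1) * G' i j (c.1.2, c.2.2)
  rw [← h i j, ← h' i j, mulVec, mulVec, mulVec, dotProduct, dotProduct, dotProduct,
    Fintype.sum_mul_sum, ← Fintype.sum_prod_type',
    ← (Equiv.prodProdProdComm C C' C C').sum_comp]
  exact Finset.sum_congr rfl fun d _ => mul_mul_mul_comm _ _ _ _

end RMatrix

end FixedVectors

section Reflection

variable {R : Type*} [CommRing R] {S : Type} {ι : Type*}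

/-- The relations `B i a a = 0` and `B i a b + t ^ k • B i b a = 0`, where `b = a + m * k`, given by
families `B` of elements of `R[Typ]`. The relations of all three cases are of this form, up to
factors of `2` in the relations `B i a a = 0`. -/
def reflectionGens (m : ℕ) (t : R) (B : ι → ℤ → ℤ → TypRing R S) : Set (TypRing R S) :=
  {x | ∃ i a, x = B i a a} ∪
  {x | ∃ i a, ∃ k : ℕ, x = B i a (a + m * k) + t ^ k • B i (a + m * k) a}

theorem image_reflectionGens {R' : Type*} [CommRing R'] (φ : R →+* R') (m : ℕ) (t : R)
    {B : ι → ℤ → ℤ → TypRing R S} {B' : ι → ℤ → ℤ → TypRing R' S}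
    (hB : ∀ i a b, MonoidAlgebra.mapRingHom _ φ (B i a b) = B' i a b) :
    MonoidAlgebra.mapRingHom _ φ '' reflectionGens m t B = reflectionGens m (φ t) B' := by
  have hrefl (i a) (k : ℕ) :
      MonoidAlgebra.mapRingHom _ φ (B i a (a + m * k) + t ^ k • B i (a + m * k) a) =
        B' i a (a + m * k) + φ t ^ k • B' i (a + m * k) a := by
    rw [map_add, mapRingHom_smul, map_pow, hB, hB]
  ext x
  constructor
  · rintro ⟨_, ⟨i, a, rfl⟩ | ⟨i, a, k, rfl⟩, rfl⟩
    exacts [.inl ⟨i, a, hB i a a⟩, .inr ⟨i, a, k, hrefl i a k⟩]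
  · rintro (⟨i, a, rfl⟩ | ⟨i, a, k, rfl⟩)
    exacts [⟨_, .inl ⟨i, a, rfl⟩, hB i a a⟩, ⟨_, .inr ⟨i, a, k, rfl⟩, hrefl i a k⟩]

theorem exists_mem_pairSpan_of_mem_reflectionGens {m : ℕ} {t : R} {B : ι → ℤ → ℤ → TypRing R S}
    (hB : ∀ i, ∃ e, ∀ a b, B i a b ∈ pairSpan R S (a + b + e)) {x : TypRing R S}
    (hx : x ∈ reflectionGens m t B) : ∃ N, x ∈ pairSpan R S N := by
  obtain ⟨i, a, rfl⟩ | ⟨i, a, k, rfl⟩ := hx <;> obtain ⟨e, he⟩ := hB i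
  · exact ⟨_, he a a⟩
  · exact ⟨_, add_mem (he a _) (Submodule.smul_mem _ _ (add_comm a (a + m * k) ▸ he _ a))⟩

theorem mem_sup_relIdeal_reflectionGens {m : ℕ} {t : R} {B : ι → ℤ → ℤ → TypRing R S}
    {P : Submodule R (TypRing R S)} {x : TypRing R S} (i : ι) (a : ℤ) (k : ℕ)
    (h : x - B i a (a + m * k) ∈ P) (h' : 0 < k → B i (a + m * k) a ∈ P) :
    x ∈ P ⊔ relIdeal (reflectionGens m t B) := by
  obtain rfl | hk := Nat.eq_zero_or_pos k
  · exact Submodule.mem_sup.mpr ⟨_, h, B i a a, subset_relIdeal (.inl ⟨i, a, rfl⟩), by simp⟩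
  · exact Submodule.mem_sup.mpr ⟨_, sub_mem h (P.smul_mem (t ^ k) (h' hk)), _,
      subset_relIdeal (.inr ⟨i, a, k, rfl⟩), by abel⟩

variable {C 𝓡 : Type*} [CommRing 𝓡] [Fintype C] [DecidableEq C] {k : RMatrix C 𝓡}
  {z : ℕ → 𝓡ˣ} {V : 𝓡ˣ} {col : ℤ × S → C}

theorem op_wordMap_eq_self_of_mem_reflectionGens {m : ℕ} {B : ι → ℤ → ℤ → TypRing 𝓡 S}
    (hB : ∀ i (c : ℤ), ∃ (s : ℕ → ℕ → 𝓡) (G : ℕ → ℕ → C × C → 𝓡), k.IsFixed G ∧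
      (∀ i j, s i j = s j i) ∧ ∀ a b, a ≡ c [ZMOD m] → b ≡ c [ZMOD m] → ∀ x,
      wordMap z V col 2 (B i a b) x =
        ↑(V ^ b * z (x 0).1 ^ a * z (x 1).1 ^ b) * s (x 0).1 (x 1).1 *
          G (x 0).1 (x 1).1 ((x 0).2, (x 1).2)) {x : TypRing 𝓡 S}
    (hx : x ∈ reflectionGens m ((V : 𝓡) ^ m) B) :
    k.op 0 (wordMap z V col 2 x) = wordMap z V col 2 x := by
  obtain ⟨i, a, rfl⟩ | ⟨i, a, n, rfl⟩ := hx <;> obtain ⟨s, G, hG, hs, h⟩ := hB i a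
  · refine hG.op_eq_self (s := fun i j => ↑(V ^ a * z i ^ a * z j ^ a) * s i j)
      (fun i j => by rw [mul_right_comm (V ^ a), hs]) (h a a rfl rfl)
  · have hb : a + m * n ≡ a [ZMOD m] := Int.ModEq.symm (Int.modEq_iff_dvd.mpr (by simp))
    have hpow : ((V : 𝓡) ^ m) ^ n * ↑(V ^ a) = ↑(V ^ (a + m * n)) := by
      rw [zpow_add, zpow_mul, zpow_natCast, zpow_natCast, mul_comm]
      push_cast
      rfl
    refine hG.op_eq_self (s := fun i j => ↑(V ^ (a + m * n)) *
      (↑(z i ^ a * z j ^ (a + m * n)) + ↑(z j ^ a * z i ^ (a + m * n))) * s i j)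
      (fun i j => by rw [hs]; ring) fun x => ?_
    simp only [map_add, map_smul, Pi.add_apply, Pi.smul_apply, smul_eq_mul, h a _ rfl hb,
      h _ a hb rfl, ← hpow, Units.val_mul]
    ring

end Reflection

section HallLittlewood

open Polynomial LaurentPolynomial

section Matrix

variable {𝓡 : Type*} [CommRing 𝓡]

/-- The scalar `R`-matrix with entries `(z j - v z i) / (z i - v z j)`, where the inverse of the
denominator is passed as `d i j`. It is fixed by the products of a symmetric function and
`z j - v z i`, as are the Hall–Littlewood relations. -/
def hlMatrix (v : 𝓡) (z : ℕ → 𝓡) (d : ℕ → ℕ → 𝓡) : RMatrix Unit 𝓡 :=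
  fun i j => Matrix.of fun _ _ => d i j * (z j - v * z i)

theorem map_hlMatrix {𝓡' : Type*} [CommRing 𝓡'] (f : 𝓡 →+* 𝓡') (v : 𝓡) (z : ℕ → 𝓡)
    (d : ℕ → ℕ → 𝓡) :
    (hlMatrix v z d).map f = hlMatrix (f v) (f ∘ z) fun i j => f (d i j) := by
  funext i j
  ext
  simp [RMatrix.map, hlMatrix]

variable {v : 𝓡} {z : ℕ → 𝓡} {d : ℕ → ℕ → 𝓡}

theorem isBraided_hlMatrix (hd : ∀ i j, d i j * (z i - v * z j) = 1) :
    (hlMatrix v z d).IsBraided where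
  unitary i j := by
    ext
    rw [Matrix.mul_apply, Fintype.sum_subsingleton _ ((), ()), Matrix.one_apply,
      if_pos (Subsingleton.elim _ _)]
    simp only [hlMatrix, Matrix.of_apply]
    linear_combination d j i * (z j - v * z i) * hd i j + hd j i
  yangBaxter i j l := by
    ext
    simp [hlMatrix, RMatrix.lift₁, RMatrix.lift₂, Matrix.mul_apply]
    ring

theorem isFixed_hlMatrix (hd : ∀ i j, d i j * (z i - v * z j) = 1) :
    (hlMatrix v z d).IsFixed fun i j _ => z j - v * z i := by
  intro i j
  funext c
  rw [Matrix.mulVec, dotProduct, Fintype.sum_subsingleton _ ((), ()), hlMatrix, Matrix.of_apply]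
  linear_combination (z j - v * z i) * hd i j

theorem hlMatrix_zero_eq_shiftMatrix {z : ℕ → 𝓡ˣ} (hd : ∀ i j, d i j * (z i : 𝓡) = 1) :
    hlMatrix 0 (fun i => (z i : 𝓡)) d = shiftMatrix z fun _ _ => 1 := by
  funext i j
  ext
  have hdij : d i j = ↑(z i)⁻¹ := by rw [← Units.mul_inv_eq_one, inv_inv, hd]
  simp [hlMatrix, shiftMatrix, hdij, Subsingleton.elim _ ((), ())]

end Matrix

variable {R : Type*} [CommRing R]

/-- The elements of `R[Typ]` whose reflections generate the relations of the Hermitian and the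
alternating cases. -/
noncomputable def hlBlock (R : Type*) [CommRing R] (_ : Unit) (a b : ℤ) : TypRing R Unit :=
  pair R a (b + 1) - pair R (a + 1) b

theorem reflectionGens_hlBlock (t : R) : reflectionGens 1 t (hlBlock R) =
    {x | ∃ a : ℤ, x = pair R a (a + 1) - pair R (a + 1) a} ∪
    {x | ∃ (a b : ℤ) (k : ℕ), b = a + k + 1 ∧
      x = pair R a b - pair R (a + 1) (b - 1) - t ^ k • (pair R b a - pair R (b - 1) (a + 1))} := by
  have hrefl (a b : ℤ) (k : ℕ) : hlBlock R () a b + t ^ k • hlBlock R () b a =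
      pair R a (b + 1) - pair R (a + 1) (b + 1 - 1) -
        t ^ k • (pair R (b + 1) a - pair R (b + 1 - 1) (a + 1)) := by
    rw [hlBlock, hlBlock, add_sub_cancel_right, ← neg_sub (pair R (b + 1) a), smul_neg,
      sub_eq_add_neg (_ - _) (t ^ k • _)]
  refine congrArg₂ _ (Set.ext fun x => ⟨?_, ?_⟩) (Set.ext fun x => ⟨?_, ?_⟩)
  · rintro ⟨_, a, rfl⟩
    exact ⟨a, rfl⟩
  · rintro ⟨a, rfl⟩
    exact ⟨(), a, rfl⟩
  · rintro ⟨_, a, k, rfl⟩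
    exact ⟨a, _, k, by simp, hrefl a _ k⟩
  · rintro ⟨a, _, k, rfl, rfl⟩
    exact ⟨(), a, k, by rw [Nat.cast_one, one_mul, hrefl]⟩

theorem relHermitian_eq_reflectionGens (q₀ : ℕ) :
    relHermitian R q₀ = reflectionGens 1 (-(q₀ : R)) (hlBlock R) :=
  (reflectionGens_hlBlock _).symm

theorem relAlternating_eq_reflectionGens (q : ℕ) :
    relAlternating R q = reflectionGens 1 ((q : R) ^ 2) (hlBlock R) := by
  simp_rw [reflectionGens_hlBlock, ← pow_mul]
  rfl

theorem hlBlock_eq_wd (i : Unit) (a b : ℤ) :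
    hlBlock R i a b = wd R [(a, ()), (b + 1, ())] - wd R [(a + 1, ()), (b, ())] :=
  rfl

theorem mapRingHom_hlBlock {R' : Type*} [CommRing R'] (φ : R →+* R') (i : Unit) (a b : ℤ) :
    MonoidAlgebra.mapRingHom _ φ (hlBlock R i a b) = hlBlock R' i a b := by
  simp only [hlBlock_eq_wd, map_sub, mapRingHom_wd]

theorem hlBlock_mem_pairSpan (i : Unit) (a b : ℤ) :
    hlBlock R i a b ∈ pairSpan R Unit (a + b + 1) :=
  sub_mem (wd_mem_pairSpan (by ring)) (wd_mem_pairSpan (by ring))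

/-- The relation between consecutive letters of a word with weakly decreasing exponents. -/
def descends {S : Type} (a b : ℤ × S) : Prop := b.1 ≤ a.1

theorem wd_pair_mem_sup_relIdeal_hlBlock (t : R) (x y : ℤ × Unit) (h : ¬ descends x y) :
    wd R [x, y] ∈
      Submodule.span R (wd R '' straighter x y) ⊔ relIdeal (reflectionGens 1 t (hlBlock R)) := by
  obtain ⟨a, u⟩ := x
  obtain ⟨b, u'⟩ := y
  obtain ⟨k, rfl⟩ : ∃ k : ℕ, b = a + (1 : ℕ) * k + 1 :=
    ⟨(b - a - 1).toNat, by simp only [descends] at h; omega⟩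
  refine mem_sup_relIdeal_reflectionGens () a k ?_ fun hk => sub_mem ?_ ?_
  · rw [hlBlock_eq_wd, sub_sub_cancel]
    exact wd_mem_span_straighter (by omega) (by omega) (by omega)
  all_goals exact wd_mem_span_straighter (by omega) (by omega) (by omega)

theorem wordMap_hlBlock {v : R} {V : Rˣ} (hV : v * V = 1) (z : ℕ → Rˣ) (a b : ℤ)
    (x : ℕ → ℕ × Unit) : wordMap z V (fun _ => ()) 2 (hlBlock R () a b) x =
      ↑(V ^ b * z (x 0).1 ^ a * z (x 1).1 ^ b) * V * (z (x 1).1 - v * z (x 0).1) := by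
  simp only [hlBlock_eq_wd, map_sub, Pi.sub_apply, wordMap_pair, letter, if_true, zpow_add_one,
    Units.val_mul]
  linear_combination
    (↑(V ^ b) * ↑(z (x 0).1 ^ a) * z (x 0).1 * ↑(z (x 1).1 ^ b) : R) * hV

theorem op_hlMatrix_wordMap {v : R} {V : Rˣ} (hV : v * V = 1) {z : ℕ → Rˣ} {d : ℕ → ℕ → R}
    (hd : ∀ i j, d i j * (z i - v * z j : R) = 1) {x : TypRing R Unit}
    (hx : x ∈ reflectionGens 1 ((V : R) ^ 1) (hlBlock R)) :
    (hlMatrix v (fun i => (z i : R)) d).op 0 (wordMap z V (fun _ => ()) 2 x) =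
      wordMap z V (fun _ => ()) 2 x :=
  op_wordMap_eq_self_of_mem_reflectionGens (fun _ _ => ⟨fun _ _ => (V : R),
    fun i j _ => (z j - v * z i : R), isFixed_hlMatrix hd, fun _ _ => rfl,
    fun a b _ _ => wordMap_hlBlock hV z a b⟩) hx

theorem disjoint_normalSpan_hlBlock :
    Disjoint (normalSpan ℤ[X] descends) (relIdeal (reflectionGens 1 X (hlBlock ℤ[X]))) := by
  obtain ⟨d, hd, hd₀⟩ := exists_inverse_laurentVar_pow_sub one_ne_zero
  simp only [pow_one] at hd hd₀
  have hk : (hlMatrix PowerSeries.X (fun i => PowerSeries.C (laurentVar i : LaurentRing)) d).map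
      (HahnSeries.ofPowerSeries ℤ LaurentRing) = hlMatrix (seriesVar LaurentRing).val
        (fun i => (seriesLaurentVar i).val) fun i j => HahnSeries.ofPowerSeries ℤ _ (d i j) := by
    rw [map_hlMatrix, HahnSeries.ofPowerSeries_X]
    rfl
  refine disjoint_normalSpan_of_isBraided (col := fun _ => ()) (κ := fun _ _ => 1)
    (fun a b _ h => Prod.ext h rfl) (fun a b h => Int.lt_add_one_iff.mpr h)
    (hk ▸ isBraided_hlMatrix hd) ?_ (inversePowerHom_injective one_pos) ?_
  · rw [map_hlMatrix, PowerSeries.constantCoeff_X]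
    exact hlMatrix_zero_eq_shiftMatrix hd₀
  · rw [image_reflectionGens _ _ _ (mapRingHom_hlBlock _), RingHom.comp_apply,
      laurentToSeries_inversePowerHom_X, Units.val_pow_eq_pow_val,
      hk]
    refine fun g hg => (exists_mem_pairSpan_of_mem_reflectionGens
      (fun i => ⟨1, hlBlock_mem_pairSpan i⟩) hg).imp fun N hN => ⟨hN, ?_⟩
    exact op_hlMatrix_wordMap (seriesVar LaurentRing).mul_inv hd hg

theorem isCompl_normalSpan_hlBlock (t : R) :
    IsCompl (normalSpan R descends) (relIdeal (reflectionGens 1 t (hlBlock R))) where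
  disjoint := disjoint_normalSpan_map (Polynomial.eval₂RingHom (Int.castRingHom R) t)
    ⟨disjoint_normalSpan_hlBlock, codisjoint_normalSpan (wd_pair_mem_sup_relIdeal_hlBlock X)⟩
    (by rw [image_reflectionGens _ _ _ (mapRingHom_hlBlock _), coe_eval₂RingHom, eval₂_X])
  codisjoint := codisjoint_normalSpan (wd_pair_mem_sup_relIdeal_hlBlock t)

end HallLittlewood

section SixVertex

open Matrix

variable {𝓡 : Type*} [CommRing 𝓡]

namespace RMatrix

theorem lift₁_mul_lift₂_mul_lift₁_apply {C : Type*} [DecidableEq C] [Fintype C]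
    (A B D : Matrix (C × C) (C × C) 𝓡) (c d : C × C × C) :
    (lift₁ A * lift₂ B * lift₁ D) c d = ∑ p, ∑ q, ∑ r,
      A (c.1, c.2.1) (p, q) * B (q, c.2.2) (r, d.2.2) * D (p, r) (d.1, d.2.1) := by
  simp only [mul_apply, lift₁, lift₂, of_apply, Fintype.sum_prod_type, mul_ite, ite_mul, mul_zero,
    zero_mul, Finset.sum_ite_irrel, Finset.sum_const_zero, Finset.sum_ite_eq, Finset.mem_univ,
    if_true, Finset.sum_mul, Finset.sum_ite_eq']
  exact Finset.sum_congr rfl fun _ _ => Finset.sum_comm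

theorem lift₂_mul_lift₁_mul_lift₂_apply {C : Type*} [DecidableEq C] [Fintype C]
    (A B D : Matrix (C × C) (C × C) 𝓡) (c d : C × C × C) :
    (lift₂ A * lift₁ B * lift₂ D) c d = ∑ r, ∑ q, ∑ p,
      A c.2 (p, q) * B (c.1, p) (d.1, r) * D (r, q) d.2 := by
  simp only [mul_apply, lift₁, lift₂, of_apply, Fintype.sum_prod_type, mul_ite, ite_mul, mul_zero,
    zero_mul, Finset.sum_ite_irrel, Finset.sum_const_zero, Finset.sum_ite_eq, Finset.mem_univ,
    if_true, Finset.sum_mul, Finset.sum_ite_eq']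

end RMatrix

/-- The basis vector of the colour `s` of the six-vertex model. -/
def colourVec (s c : ℤˣ) : 𝓡 := if c = s then 1 else 0

/-- The vector `e s ⊗ e s`, where `e = colourVec`. It is fixed by `sixVertex`. -/
def equalVec (s : ℤˣ) : ℕ → ℕ → ℤˣ × ℤˣ → 𝓡 :=
  fun _ _ c => colourVec s c.1 * colourVec s c.2

/-- The combination of `e s ⊗ e (-s)` and `e (-s) ⊗ e s`, where `e = colourVec`, that is fixed by
`sixVertex`. -/
def oppositeVec (v : 𝓡) (u : ℕ → 𝓡) (s : ℤˣ) : ℕ → ℕ → ℤˣ × ℤˣ → 𝓡 := fun i j c =>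
  u j * (colourVec s c.1 * colourVec (-s) c.2) - v * u i * (colourVec (-s) c.1 * colourVec s c.2)

/-- The `R`-matrix of the six-vertex model on two colours with crossing parameter `v`, spectral
parameters `u i ^ 2 / u j ^ 2`, and normalised so that equal colours have weight `1`. The inverse of
the denominator `u i ^ 2 - v ^ 2 * u j ^ 2` is passed as `d i j`. -/
def sixVertex (v : 𝓡) (u : ℕ → 𝓡) (d : ℕ → ℕ → 𝓡) : RMatrix ℤˣ 𝓡 :=
  fun i j => of fun c c' => d i j *
    if c.1 = c.2 then if c = c' then u i ^ 2 - v ^ 2 * u j ^ 2 else 0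
    else if c = c' then (1 - v ^ 2) * (u i * u j)
    else if c = c'.swap then v * (u j ^ 2 - u i ^ 2) else 0

theorem forall_units_int {P : ℤˣ → Prop} (h₁ : P 1) (h₂ : P (-1)) (s : ℤˣ) : P s := by
  obtain rfl | rfl := Int.units_eq_one_or s <;> assumption

theorem sum_units_int {M : Type*} [AddCommMonoid M] (f : ℤˣ → M) : ∑ s, f s = f 1 + f (-1) := by
  simp [UnitsInt.univ]

theorem map_sixVertex {𝓡' : Type*} [CommRing 𝓡'] (f : 𝓡 →+* 𝓡') (v : 𝓡) (u : ℕ → 𝓡)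
    (d : ℕ → ℕ → 𝓡) :
    (sixVertex v u d).map f = sixVertex (f v) (f ∘ u) fun i j => f (d i j) := by
  funext i j
  ext c c'
  simp only [RMatrix.map, sixVertex, map_apply, of_apply, map_mul, apply_ite f, map_sub, map_pow,
    map_one, map_zero, Function.comp_apply]

variable {v : 𝓡} {u : ℕ → 𝓡} {d : ℕ → ℕ → 𝓡}

theorem isBraided_sixVertex (hd : ∀ i j, d i j * (u i ^ 2 - v ^ 2 * u j ^ 2) = 1) :
    (sixVertex v u d).IsBraided where
  unitary i j := by
    have h : (1 : ℤˣ) ≠ -1 := by decide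
    have hprod :
        d i j * (u i ^ 2 - v ^ 2 * u j ^ 2) * (d j i * (u j ^ 2 - v ^ 2 * u i ^ 2)) = 1 := by
      rw [hd, hd, one_mul]
    ext ⟨a, b⟩ ⟨a', b'⟩
    rw [mul_apply, Fintype.sum_prod_type]
    simp only [sum_units_int]
    revert a b a' b'
    iterate 4 all_goals refine forall_units_int ?_ ?_
    all_goals
      simp only [sixVertex, of_apply, one_apply, Prod.mk.injEq, Prod.swap_prod_mk, if_true,
        if_false, h, h.symm, and_self, and_true, and_false, mul_zero, zero_mul, add_zero,
        zero_add] <;>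
      first | ring1 | linear_combination hprod
  yangBaxter i j l := by
    have h : (1 : ℤˣ) ≠ -1 := by decide
    ext ⟨a, b, c⟩ ⟨a', b', c'⟩
    rw [RMatrix.lift₁_mul_lift₂_mul_lift₁_apply, RMatrix.lift₂_mul_lift₁_mul_lift₂_apply]
    simp only [sum_units_int]
    revert a b c a' b' c'
    iterate 6 all_goals refine forall_units_int ?_ ?_
    all_goals
      simp only [sixVertex, of_apply, Prod.mk.injEq, Prod.swap_prod_mk, if_true, if_false, h,
        h.symm, and_self, and_true, and_false, mul_zero, zero_mul, add_zero, zero_add] <;>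
      ring

theorem isFixed_equalVec (hd : ∀ i j, d i j * (u i ^ 2 - v ^ 2 * u j ^ 2) = 1) (s : ℤˣ) :
    (sixVertex v u d).IsFixed (equalVec s) := by
  have h : (1 : ℤˣ) ≠ -1 := by decide
  intro i j
  funext ⟨a, b⟩
  simp only [mulVec, dotProduct, Fintype.sum_prod_type, sum_units_int]
  revert a b s
  iterate 3 all_goals refine forall_units_int ?_ ?_
  all_goals
    simp only [sixVertex, of_apply, equalVec, colourVec, Prod.mk.injEq, Prod.swap_prod_mk,
      if_true, if_false, h, h.symm, and_self, and_true, and_false, mul_zero, mul_one, add_zero,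
      zero_add, hd]

theorem isFixed_oppositeVec (hd : ∀ i j, d i j * (u i ^ 2 - v ^ 2 * u j ^ 2) = 1) (s : ℤˣ) :
    (sixVertex v u d).IsFixed (oppositeVec v u s) := by
  have h : (1 : ℤˣ) ≠ -1 := by decide
  intro i j
  funext ⟨a, b⟩
  simp only [mulVec, dotProduct, Fintype.sum_prod_type, sum_units_int]
  revert a b s
  iterate 3 all_goals refine forall_units_int ?_ ?_
  all_goals
    simp only [sixVertex, of_apply, oppositeVec, colourVec, Prod.mk.injEq, Prod.swap_prod_mk,
      if_true, if_false, h, h.symm, and_self, and_true, and_false, mul_zero, mul_one, add_zero,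
      zero_add, neg_neg, sub_zero, zero_sub]
    first | ring1 | linear_combination u j * hd i j | linear_combination -v * u i * hd i j

theorem sixVertex_zero_eq_shiftMatrix {u : ℕ → 𝓡ˣ} (hd : ∀ i j, d i j * (u i : 𝓡) ^ 2 = 1) :
    sixVertex 0 (fun i => (u i : 𝓡)) d = shiftMatrix u fun a b => if a = b then 0 else 1 := by
  funext i j
  ext ⟨a, b⟩ ⟨a', b'⟩
  have hdij : d i j * (u i : 𝓡) = ↑(u i)⁻¹ := by
    rw [← Units.mul_eq_one_iff_eq_inv, mul_assoc, ← sq, hd]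
  rw [shiftMatrix, diagonal_apply]
  obtain rfl | hab := eq_or_ne a b
  · simp [sixVertex, hd]
  · simp [sixVertex, hab, ← mul_assoc, hdij]

end SixVertex

section GaugedSymmetric

open Polynomial

/-- The families of relations of the symmetric case: the relations between letters whose exponents
have different parities, those between opposite signs, and those of the form `relHalf`. -/
inductive SymFamily
  | odd (s₁ s₂ : ℤˣ)
  | even (s : ℤˣ)
  | half (s : ℤˣ)

/-- The elements of `R[Typ]` whose reflections generate the relations of the symmetric case after
the signs of the letters are changed by `relabel`. -/
noncomputable def gaugedBlock (R : Type*) [CommRing R] : SymFamily → ℤ → ℤ → TypRing R ℤˣ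
  | .odd s₁ s₂, a, b => wd R [(a, s₁), (b + 1, s₂)] - wd R [(a + 1, s₂), (b, s₁)]
  | .even s, a, b => wd R [(a, s), (b, s)]
  | .half s, a, b => wd R [(a - 1, s), (b + 1, -s)] - wd R [(a, s), (b, -s)] -
      wd R [(a, -s), (b, s)] + wd R [(a + 1, -s), (b - 1, s)]

section Blocks

variable {R : Type*} [CommRing R]

theorem mapRingHom_gaugedBlock {R' : Type*} [CommRing R'] (φ : R →+* R') (f : SymFamily)
    (a b : ℤ) : MonoidAlgebra.mapRingHom _ φ (gaugedBlock R f a b) = gaugedBlock R' f a b := by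
  cases f <;> simp only [gaugedBlock, map_add, map_sub, mapRingHom_wd]

theorem exists_gaugedBlock_mem_pairSpan (f : SymFamily) :
    ∃ e, ∀ a b, gaugedBlock R f a b ∈ pairSpan R ℤˣ (a + b + e) := by
  cases f with
  | odd => exact ⟨1, fun a b => sub_mem (wd_mem_pairSpan (by ring)) (wd_mem_pairSpan (by ring))⟩
  | even => exact ⟨0, fun a b => wd_mem_pairSpan (by ring)⟩
  | half => exact ⟨0, fun a b => add_mem (sub_mem (sub_mem (wd_mem_pairSpan (by ring))
      (wd_mem_pairSpan (by ring))) (wd_mem_pairSpan (by ring))) (wd_mem_pairSpan (by ring))⟩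

/-- The colour of a letter in the symmetric case, a pair of signs with one six-vertex matrix for
each of them. It determines the sign of the letter and the parity of its exponent. -/
def signColour (a : ℤ × ℤˣ) : ℤˣ × ℤˣ := (a.1.negOnePow * a.2, a.2)

theorem letter_signColour (z : ℕ → Rˣ) (a : ℤ × ℤˣ) (x : ℕ × ℤˣ × ℤˣ) :
    letter z signColour a x = ↑(z x.1 ^ a.1) * (colourVec (a.1.negOnePow * a.2) x.2.1 *
      colourVec a.2 x.2.2) := by
  simp only [letter, signColour, Prod.ext_iff, colourVec, ite_and, mul_ite, mul_one,
    mul_zero]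
  split_ifs <;> rfl

end Blocks

section WordMap

variable {R : Type*} [CommRing R] {v : R} {V : Rˣ} (hV : v * V = 1) (z : ℕ → Rˣ) {a b : ℤ}
  {p : ℤˣ} (ha : a.negOnePow = p) (hb : b.negOnePow = p) (s : ℤˣ) (x : ℕ → ℕ × ℤˣ × ℤˣ)

include ha hb

theorem wordMap_gaugedBlock_even : wordMap z V signColour 2 (gaugedBlock R (.even s) a b) x =
    ↑(V ^ b * z (x 0).1 ^ a * z (x 1).1 ^ b) * 1 *
      (equalVec (p * s) (x 0).1 (x 1).1 ((x 0).2.1, (x 1).2.1) *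
        equalVec s (x 0).1 (x 1).1 ((x 0).2.2, (x 1).2.2)) := by
  simp only [gaugedBlock, wordMap_pair, letter_signColour, ha, hb, Units.val_mul, equalVec]
  ring

include hV

theorem wordMap_gaugedBlock_odd_self :
    wordMap z V signColour 2 (gaugedBlock R (.odd s s) a b) x =
      ↑(V ^ b * z (x 0).1 ^ a * z (x 1).1 ^ b) * V *
        (oppositeVec v (fun i => z i) (p * s) (x 0).1 (x 1).1 ((x 0).2.1, (x 1).2.1) *
          equalVec s (x 0).1 (x 1).1 ((x 0).2.2, (x 1).2.2)) := by
  simp only [gaugedBlock, map_sub, Pi.sub_apply, wordMap_pair, letter_signColour,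
    Int.negOnePow_succ, ha, hb, Units.val_mul, zpow_add_one, neg_mul, equalVec, oppositeVec]
  linear_combination (↑(V ^ b) * ↑(z (x 0).1 ^ a) * ↑(z (x 1).1 ^ b) * z (x 0).1 *
    (colourVec (-(p * s)) (x 0).2.1 * colourVec (p * s) (x 1).2.1) *
    (colourVec s (x 0).2.2 * colourVec s (x 1).2.2)) * hV

theorem wordMap_gaugedBlock_odd_neg :
    wordMap z V signColour 2 (gaugedBlock R (.odd s (-s)) a b) x =
      ↑(V ^ b * z (x 0).1 ^ a * z (x 1).1 ^ b) * V *
        (equalVec (p * s) (x 0).1 (x 1).1 ((x 0).2.1, (x 1).2.1) *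
          oppositeVec v (fun i => z i) s (x 0).1 (x 1).1 ((x 0).2.2, (x 1).2.2)) := by
  simp only [gaugedBlock, map_sub, Pi.sub_apply, wordMap_pair, letter_signColour,
    Int.negOnePow_succ, ha, hb, Units.val_mul, zpow_add_one, neg_mul, mul_neg, neg_neg, equalVec,
    oppositeVec]
  linear_combination (↑(V ^ b) * ↑(z (x 0).1 ^ a) * ↑(z (x 1).1 ^ b) * z (x 0).1 *
    (colourVec (p * s) (x 0).2.1 * colourVec (p * s) (x 1).2.1) *
    (colourVec (-s) (x 0).2.2 * colourVec s (x 1).2.2)) * hV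

theorem wordMap_gaugedBlock_half :
    wordMap z V signColour 2 (gaugedBlock R (.half s) a b) x =
      ↑(V ^ b * z (x 0).1 ^ a * z (x 1).1 ^ b) * ↑(V * ((z (x 0).1)⁻¹ * (z (x 1).1)⁻¹)) *
        (oppositeVec v (fun i => z i) (-(p * s)) (x 0).1 (x 1).1 ((x 0).2.1, (x 1).2.1) *
          oppositeVec v (fun i => z i) s (x 0).1 (x 1).1 ((x 0).2.2, (x 1).2.2)) := by
  obtain ⟨a, rfl⟩ : ∃ a', a = a' + 1 := ⟨a - 1, (sub_add_cancel _ _).symm⟩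
  obtain ⟨b, rfl⟩ : ∃ b', b = b' + 1 := ⟨b - 1, (sub_add_cancel _ _).symm⟩
  have ha' : a.negOnePow = -p := by rw [← ha, Int.negOnePow_succ, neg_neg]
  have hb' : b.negOnePow = -p := by rw [← hb, Int.negOnePow_succ, neg_neg]
  have hinv (i : ℕ) : (z i : R) * ↑(z i)⁻¹ = 1 := (z i).mul_inv
  simp only [gaugedBlock, map_sub, map_add, Pi.sub_apply, Pi.add_apply, wordMap_pair,
    letter_signColour, add_sub_cancel_right, Int.negOnePow_succ, ha', hb', Units.val_mul,
    zpow_add_one, neg_mul, mul_neg, neg_neg, oppositeVec]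
  generalize (colourVec (p * s) (x 0).2.1 : R) = e₀, (colourVec (p * s) (x 1).2.1 : R) = e₁,
    (colourVec (-(p * s)) (x 0).2.1 : R) = e₀', (colourVec (-(p * s)) (x 1).2.1 : R) = e₁',
    (colourVec s (x 0).2.2 : R) = f₀, (colourVec s (x 1).2.2 : R) = f₁,
    (colourVec (-s) (x 0).2.2 : R) = f₀', (colourVec (-s) (x 1).2.2 : R) = f₁',
    (x 0).1 = i, (x 1).1 = j
  linear_combination ↑(V ^ b) * ↑(z i ^ a) * ↑(z j ^ b) *
    ((V * z i * z j * (e₀ * e₁' * (f₀ * f₁') + e₀' * e₁ * (f₀' * f₁)) -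
      z i ^ 2 * (e₀ * e₁' * (f₀' * f₁)) * (1 + v * V)) * hV -
    V ^ 2 * ((z j * (e₀' * e₁) - v * z i * (e₀ * e₁')) *
      (z j * (f₀ * f₁') - v * z i * (f₀' * f₁))) * (z j * ↑(z j)⁻¹ * hinv i + hinv j))

end WordMap

section Disjoint

theorem negOnePow_eq_of_modEq {a b : ℤ} (h : a ≡ b [ZMOD (2 : ℕ)]) :
    a.negOnePow = b.negOnePow :=
  (Int.negOnePow_eq_iff _ _).mpr (even_iff_two_dvd.mpr h.symm.dvd)

theorem op_sixVertex_wordMap {R : Type*} [CommRing R] {v : R} {V : Rˣ} (hV : v * V = 1)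
    {z : ℕ → Rˣ} {d : ℕ → ℕ → R} (hd : ∀ i j, d i j * (z i ^ 2 - v ^ 2 * z j ^ 2 : R) = 1)
    {x : TypRing R ℤˣ} (hx : x ∈ reflectionGens 2 ((V : R) ^ 2) (gaugedBlock R)) :
    ((sixVertex v (fun i => z i) d).tensor (sixVertex v (fun i => z i) d)).op 0
      (wordMap z V signColour 2 x) = wordMap z V signColour 2 x := by
  have heq := isFixed_equalVec hd
  have hne := isFixed_oppositeVec hd
  refine op_wordMap_eq_self_of_mem_reflectionGens (fun f c => ?_) hx
  have hp {a : ℤ} : a ≡ c [ZMOD (2 : ℕ)] → a.negOnePow = c.negOnePow := negOnePow_eq_of_modEq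
  cases f with
  | odd s₁ s₂ =>
    obtain rfl | hs := eq_or_ne s₂ s₁
    · exact ⟨fun _ _ => V, _, (hne _).tensor (heq _), fun _ _ => rfl, fun a b ha hb =>
        wordMap_gaugedBlock_odd_self hV z (hp ha) (hp hb) _⟩
    · obtain rfl := Int.units_ne_iff_eq_neg.mp hs
      exact ⟨fun _ _ => V, _, (heq _).tensor (hne _), fun _ _ => rfl, fun a b ha hb =>
        wordMap_gaugedBlock_odd_neg hV z (hp ha) (hp hb) _⟩
  | even s => exact ⟨fun _ _ => 1, _, (heq _).tensor (heq _), fun _ _ => rfl, fun a b ha hb =>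
        wordMap_gaugedBlock_even z (hp ha) (hp hb) _⟩
  | half s => exact ⟨fun i j => ↑(V * ((z i)⁻¹ * (z j)⁻¹)), _, (hne _).tensor (hne _),
        fun i j => by simp only [mul_comm (z i)⁻¹], fun a b ha hb =>
        wordMap_gaugedBlock_half hV z (hp ha) (hp hb) _⟩

/-- The relation between consecutive letters of a normal word for the relations `gaugedBlock`. -/
def descendsGauged (a b : ℤ × ℤˣ) : Prop := b.1 < a.1 ∨ b.1 = a.1 ∧ a.2 ≠ b.2

theorem lt_add_of_descendsGauged {a b : ℤ × ℤˣ} (h : descendsGauged a b) :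
    b.1 < a.1 + ((if (signColour a).1 = (signColour b).1 then 0 else 1) +
      if (signColour a).2 = (signColour b).2 then 0 else 1) := by
  obtain h | ⟨h, hne⟩ := h
  · split_ifs <;> omega
  · simp [signColour, h, hne]

theorem disjoint_normalSpan_gaugedBlock : Disjoint (normalSpan ℤ[X] descendsGauged)
    (relIdeal (reflectionGens 2 X (gaugedBlock ℤ[X]))) := by
  obtain ⟨d, hd, hd₀⟩ := exists_inverse_laurentVar_pow_sub two_ne_zero
  let k := sixVertex PowerSeries.X (fun i => PowerSeries.C (laurentVar i : LaurentRing)) d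
  have hk : k.map (HahnSeries.ofPowerSeries ℤ LaurentRing) = sixVertex (seriesVar LaurentRing).val
      (fun i => (seriesLaurentVar i).val) fun i j => HahnSeries.ofPowerSeries ℤ _ (d i j) := by
    rw [map_sixVertex, HahnSeries.ofPowerSeries_X]
    rfl
  have hbraided : (k.map (HahnSeries.ofPowerSeries ℤ LaurentRing)).IsBraided := by
    rw [hk]
    exact isBraided_sixVertex hd
  refine disjoint_normalSpan_of_isBraided (col := signColour) (k := k.tensor k)
    (κ := fun c d => (if c.1 = d.1 then 0 else 1) + if c.2 = d.2 then 0 else 1)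
    (fun a b hc he => Prod.ext he (congrArg Prod.snd hc :)) (fun _ _ => lt_add_of_descendsGauged)
    (by rw [RMatrix.map_tensor]; exact hbraided.tensor hbraided) ?_
    (inversePowerHom_injective two_pos) ?_
  · rw [RMatrix.map_tensor, map_sixVertex, PowerSeries.constantCoeff_X]
    have h := sixVertex_zero_eq_shiftMatrix hd₀
    exact (congrArg₂ RMatrix.tensor h h).trans (shiftMatrix_tensor _ _ _)
  · rw [image_reflectionGens _ _ _ (mapRingHom_gaugedBlock _), RingHom.comp_apply,
      laurentToSeries_inversePowerHom_X, Units.val_pow_eq_pow_val, RMatrix.map_tensor, hk]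
    exact fun g hg => (exists_mem_pairSpan_of_mem_reflectionGens
      exists_gaugedBlock_mem_pairSpan hg).imp fun N hN =>
        ⟨hN, op_sixVertex_wordMap (seriesVar LaurentRing).mul_inv hd hg⟩

end Disjoint

end GaugedSymmetric

section Symmetric

open Polynomial

/-- The elements of `R[Typ]` whose reflections generate an ideal that `fourier` maps onto the
relations of the symmetric case. -/
noncomputable def symBlock (R : Type*) [CommRing R] (ε : ℤˣ) : SymFamily → ℤ → ℤ → TypRing R ℤˣ
  | .odd s₁ s₂, a, b => wd R [(a, s₁), (b + 1, s₂)] - wd R [(a + 1, s₂), (b, s₁)]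
  | .even s, a, b => wd R [(a, s), (b, -s)]
  | .half s, a, b => wd R [(a - 1, s), (b + 1, s)] - wd R [(a, s), (b, s)] -
      ε • (wd R [(a, -s), (b, -s)] - wd R [(a + 1, -s), (b - 1, -s)])

/-- The relation between consecutive letters of a normal word for the relations `symBlock`. -/
def descendsSym (a b : ℤ × ℤˣ) : Prop := b.1 < a.1 ∨ b.1 = a.1 ∧ a.2 = b.2

section Relabel

/-- The update of the signs of the two parities, indexed by `(-1) ^ a`, when `relabel` has read a
letter: the sign of the parity of its exponent is reversed. -/
def flip (h : ℤˣ → ℤˣ) (a : ℤ × ℤˣ) : ℤˣ → ℤˣ :=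
  Function.update h a.1.negOnePow (-h a.1.negOnePow)

/-- The word with the sign of each letter multiplied by `-1` for each earlier letter whose exponent
has the same parity, for `h = 1`. In general `h` gives the initial signs of the two parities. -/
def relabel : (ℤˣ → ℤˣ) → List (ℤ × ℤˣ) → List (ℤ × ℤˣ)
  | _, [] => []
  | h, a :: l => (a.1, h a.1.negOnePow * a.2) :: relabel (flip h a) l

theorem relabel_append (h : ℤˣ → ℤˣ) (u w : List (ℤ × ℤˣ)) :
    relabel h (u ++ w) = relabel h u ++ relabel (u.foldl flip h) w := by
  induction u generalizing h with
  | nil => rfl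
  | cons a u ih => simp only [List.cons_append, relabel, List.foldl_cons, ih]

theorem relabel_relabel (h : ℤˣ → ℤˣ) (l : List (ℤ × ℤˣ)) : relabel h (relabel h l) = l := by
  induction l generalizing h with
  | nil => rfl
  | cons a l ih =>
    simp only [relabel, ← mul_assoc, Int.units_mul_self, one_mul]
    exact congrArg _ (ih _)

theorem isChain_relabel {l : List (ℤ × ℤˣ)} (hl : l.IsChain descendsSym) (h : ℤˣ → ℤˣ) :
    (relabel h l).IsChain descendsGauged := by
  induction l generalizing h with
  | nil => exact .nil
  | cons a l ih =>
    rcases l with _ | ⟨b, l⟩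
    · exact .singleton _
    · obtain ⟨hab, hl⟩ := List.isChain_cons_cons.mp hl
      refine List.isChain_cons_cons.mpr ⟨hab.imp_right ?_, ih hl (flip h a)⟩
      rintro ⟨he, hs⟩
      simp [he, hs, flip, units_ne_neg_self]

variable {p : ℤˣ} {a b : ℤ}

theorem relabel_pair_of_eq (ha : a.negOnePow = p) (hb : b.negOnePow = p) (h : ℤˣ → ℤˣ)
    (s₁ s₂ : ℤˣ) (w : List (ℤ × ℤˣ)) : relabel h ([(a, s₁), (b, s₂)] ++ w) =
      [(a, h p * s₁), (b, h p * -s₂)] ++ relabel h w := by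
  simp [relabel, flip, ha, hb]

theorem relabel_pair_of_neg (ha : a.negOnePow = p) (hb : b.negOnePow = -p) (h : ℤˣ → ℤˣ)
    (s₁ s₂ : ℤˣ) (w : List (ℤ × ℤˣ)) : relabel h ([(a, s₁), (b, s₂)] ++ w) =
      [(a, h p * s₁), (b, h (-p) * s₂)] ++ relabel (-h) w := by
  have hflip : Function.update (Function.update h p (-h p)) (-p) (-h (-p)) = -h := by
    funext x
    obtain rfl | hx := eq_or_ne x p
    · simp [units_ne_neg_self]
    · obtain rfl := Int.units_ne_iff_eq_neg.mp hx
      simp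
  simp [relabel, flip, hflip, ha, hb, neg_units_ne_self]

/-- The sign `ε ^ (n choose 2)` of a list with `n` entries `1`. It makes the two pairs of terms of a
block of the family `SymFamily.half` differ by a factor `ε`. -/
def chooseSign (ε : ℤˣ) (l : List ℤˣ) : ℤˣ := ε ^ (l.count 1).choose 2

theorem chooseSign_swap (ε s₁ s₂ : ℤˣ) (u w : List ℤˣ) :
    chooseSign ε (u ++ [s₂, s₁] ++ w) = chooseSign ε (u ++ [s₁, s₂] ++ w) :=
  congrArg (ε ^ Nat.choose · 2)
    ((((List.Perm.swap s₁ s₂ []).append_left u).append_right w).count_eq 1)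

theorem chooseSign_neg_neg (ε s : ℤˣ) (u w : List ℤˣ) :
    chooseSign ε (u ++ [-s, -s] ++ w) = ε * chooseSign ε (u ++ [s, s] ++ w) := by
  have hchoose (n : ℕ) : ε ^ (n + 1 + 1).choose 2 = ε * ε ^ n.choose 2 := by
    rw [Nat.choose_succ_succ' (n + 1) 1, Nat.choose_succ_succ' n 1, Nat.choose_one_right,
      Nat.choose_one_right, show n + 1 + (n + n.choose 2) = 2 * n + (n.choose 2 + 1) by ring,
      pow_add, pow_mul, Int.units_sq, one_pow, one_mul, pow_succ']
  revert s
  refine forall_units_int ?_ ?_ <;>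
    simp [chooseSign, ← add_assoc, add_right_comm _ 1, hchoose, ← mul_assoc, Int.units_mul_self]

end Relabel

section Gauge

variable {R : Type*} [CommRing R]

/-- The linear automorphism of `R[Typ]` relating `symBlock` to `gaugedBlock`. -/
noncomputable def gaugeMap (R : Type*) [CommRing R] (ε : ℤˣ) : TypRing R ℤˣ →ₗ[R] TypRing R ℤˣ :=
  wdLift fun l => chooseSign ε (l.map Prod.snd) • wd R (relabel 1 l)

theorem gaugeMap_injective (ε : ℤˣ) : Function.Injective (gaugeMap R ε) := by
  let g : TypRing R ℤˣ →ₗ[R] TypRing R ℤˣ :=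
    wdLift fun l => chooseSign ε ((relabel 1 l).map Prod.snd) • wd R (relabel 1 l)
  have hg : g ∘ₗ gaugeMap R ε = LinearMap.id := linearMap_ext_wd fun l => by
    simp only [LinearMap.comp_apply, gaugeMap, g, wdLift_wd, Units.smul_def, map_zsmul,
      relabel_relabel, LinearMap.id_apply, smul_smul, ← Units.val_mul, Int.units_mul_self,
      Units.val_one, one_smul]
  exact Function.LeftInverse.injective (g := g) (LinearMap.congr_fun hg)

variable {p : ℤˣ} {a b : ℤ}

theorem gaugeMap_pair_of_eq (ha : a.negOnePow = p) (hb : b.negOnePow = p) (ε s₁ s₂ : ℤˣ)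
    (u w : List (ℤ × ℤˣ)) : gaugeMap R ε (wd R u * wd R [(a, s₁), (b, s₂)] * wd R w) =
      chooseSign ε (u.map Prod.snd ++ [s₁, s₂] ++ w.map Prod.snd) • (wd R (relabel 1 u) *
        wd R [(a, u.foldl flip 1 p * s₁), (b, u.foldl flip 1 p * -s₂)] *
        wd R (relabel (u.foldl flip 1) w)) := by
  simp only [← wd_append, gaugeMap, wdLift_wd, List.map_append, List.map_cons, List.map_nil]
  rw [List.append_assoc u, relabel_append, relabel_pair_of_eq ha hb]
  simp only [List.append_assoc]

theorem gaugeMap_pair_of_neg (ha : a.negOnePow = p) (hb : b.negOnePow = -p) (ε s₁ s₂ : ℤˣ)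
    (u w : List (ℤ × ℤˣ)) : gaugeMap R ε (wd R u * wd R [(a, s₁), (b, s₂)] * wd R w) =
      chooseSign ε (u.map Prod.snd ++ [s₁, s₂] ++ w.map Prod.snd) • (wd R (relabel 1 u) *
        wd R [(a, u.foldl flip 1 p * s₁), (b, u.foldl flip 1 (-p) * s₂)] *
        wd R (relabel (-u.foldl flip 1) w)) := by
  simp only [← wd_append, gaugeMap, wdLift_wd, List.map_append, List.map_cons, List.map_nil]
  rw [List.append_assoc u, relabel_append, relabel_pair_of_neg ha hb]
  simp only [List.append_assoc]

theorem gaugeMap_odd (ha : a.negOnePow = p) (hb : b.negOnePow = p) (ε s₁ s₂ : ℤˣ)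
    (u w : List (ℤ × ℤˣ)) : gaugeMap R ε (wd R u * symBlock R ε (.odd s₁ s₂) a b * wd R w) =
      chooseSign ε (u.map Prod.snd ++ [s₁, s₂] ++ w.map Prod.snd) • (wd R (relabel 1 u) *
        gaugedBlock R (.odd (u.foldl flip 1 p * s₁) (u.foldl flip 1 (-p) * s₂)) a b *
        wd R (relabel (-u.foldl flip 1) w)) := by
  have ha' : (a + 1).negOnePow = -p := by rw [Int.negOnePow_succ, ha]
  have hb' : (b + 1).negOnePow = -p := by rw [Int.negOnePow_succ, hb]
  simp only [symBlock, gaugedBlock, mul_sub, sub_mul, map_sub, gaugeMap_pair_of_neg ha hb',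
    smul_sub,
    gaugeMap_pair_of_neg ha' (hb.trans (neg_neg p).symm), chooseSign_swap ε s₁ s₂, neg_neg]

theorem gaugeMap_even (ha : a.negOnePow = p) (hb : b.negOnePow = p) (ε s : ℤˣ)
    (u w : List (ℤ × ℤˣ)) : gaugeMap R ε (wd R u * symBlock R ε (.even s) a b * wd R w) =
      chooseSign ε (u.map Prod.snd ++ [s, -s] ++ w.map Prod.snd) • (wd R (relabel 1 u) *
        gaugedBlock R (.even (u.foldl flip 1 p * s)) a b *
        wd R (relabel (u.foldl flip 1) w)) := by
  rw [symBlock, gaugeMap_pair_of_eq ha hb, neg_neg, gaugedBlock]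

theorem gaugeMap_half (ha : a.negOnePow = p) (hb : b.negOnePow = p) (ε s : ℤˣ)
    (u w : List (ℤ × ℤˣ)) : gaugeMap R ε (wd R u * symBlock R ε (.half s) a b * wd R w) =
      chooseSign ε (u.map Prod.snd ++ [s, s] ++ w.map Prod.snd) • (wd R (relabel 1 u) *
        gaugedBlock R (.half (u.foldl flip 1 (-p) * s)) a b *
        wd R (relabel (u.foldl flip 1) w)) := by
  have hsucc {c : ℤ} (hc : c.negOnePow = p) : (c + 1).negOnePow = -p := by
    rw [Int.negOnePow_succ, hc]
  have hpred {c : ℤ} (hc : c.negOnePow = p) : (c - 1).negOnePow = -p := by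
    rw [Int.negOnePow_sub, hc, Int.negOnePow_one, mul_neg_one]
  simp only [symBlock, gaugedBlock, mul_sub, sub_mul, mul_add, add_mul, map_sub, smul_sub, smul_add,
    Units.smul_def, mul_smul_comm, smul_mul_assoc, map_zsmul]
  simp only [← Units.smul_def, gaugeMap_pair_of_eq ha hb, gaugeMap_pair_of_eq (hpred ha) (hsucc hb),
    gaugeMap_pair_of_eq (hsucc ha) (hpred hb), chooseSign_neg_neg, neg_neg, mul_neg, smul_smul,
    ← mul_assoc, Int.units_mul_self, one_mul]
  obtain h | h := eq_or_ne (u.foldl flip 1 p) (u.foldl flip 1 (-p))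
  · rw [h]
    abel
  · simp only [Int.units_ne_iff_eq_neg.mp h, neg_mul, neg_neg]
    abel

theorem exists_gaugeMap_symBlock (ε : ℤˣ) (f : SymFamily) (c : ℤ) (u w : List (ℤ × ℤˣ)) :
    ∃ (x : ℤˣ) (f' : SymFamily) (u' w' : List (ℤ × ℤˣ)), ∀ a b : ℤ,
      a ≡ c [ZMOD (2 : ℕ)] → b ≡ c [ZMOD (2 : ℕ)] →
        gaugeMap R ε (wd R u * symBlock R ε f a b * wd R w) =
          x • (wd R u' * gaugedBlock R f' a b * wd R w') := by
  have hp {a : ℤ} : a ≡ c [ZMOD (2 : ℕ)] → a.negOnePow = c.negOnePow := negOnePow_eq_of_modEq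
  cases f with
  | odd => exact ⟨_, _, _, _, fun a b ha hb => gaugeMap_odd (hp ha) (hp hb) ε _ _ u w⟩
  | even => exact ⟨_, _, _, _, fun a b ha hb => gaugeMap_even (hp ha) (hp hb) ε _ u w⟩
  | half => exact ⟨_, _, _, _, fun a b ha hb => gaugeMap_half (hp ha) (hp hb) ε _ u w⟩

theorem relIdeal_symBlock_le_comap (ε : ℤˣ) (t : R) :
    relIdeal (reflectionGens 2 t (symBlock R ε)) ≤
      (relIdeal (reflectionGens 2 t (gaugedBlock R))).comap (gaugeMap R ε) := by
  refine relIdeal_le ?_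
  rintro _ (⟨f, a, rfl⟩ | ⟨f, a, k, rfl⟩) u w <;>
    obtain ⟨x, f', u', w', h⟩ := exists_gaugeMap_symBlock (R := R) ε f a u w
  · rw [Submodule.mem_comap, h a a rfl rfl]
    exact zsmul_mem (mul_mem_relIdeal (subset_relIdeal (.inl ⟨f', a, rfl⟩)) _ _) _
  · have hb : a + (2 : ℕ) * k ≡ a [ZMOD (2 : ℕ)] := Int.ModEq.symm (Int.modEq_iff_dvd.mpr (by simp))
    rw [Submodule.mem_comap, mul_add, add_mul, mul_smul_comm, smul_mul_assoc, map_add, map_smul,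
      h _ _ rfl hb, h _ _ hb rfl, smul_comm, ← smul_add, ← smul_mul_assoc, ← mul_smul_comm,
      ← add_mul, ← mul_add]
    have := subset_relIdeal (gens := reflectionGens 2 t (gaugedBlock R))
      (Or.inr ⟨f', a, k, rfl⟩)
    exact zsmul_mem (mul_mem_relIdeal this _ _) _

theorem normalSpan_descendsSym_le_comap (ε : ℤˣ) :
    normalSpan R descendsSym ≤ (normalSpan R descendsGauged).comap (gaugeMap R ε) := by
  refine Submodule.span_le.mpr ?_
  rintro _ ⟨n, hn, rfl⟩
  rw [SetLike.mem_coe, Submodule.mem_comap, gaugeMap, wdLift_wd]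
  exact zsmul_mem (Submodule.subset_span (Set.mem_image_of_mem _ (isChain_relabel hn 1))) _

theorem disjoint_normalSpan_symBlock (ε : ℤˣ) : Disjoint (normalSpan ℤ[X] descendsSym)
    (relIdeal (reflectionGens 2 X (symBlock ℤ[X] ε))) :=
  Submodule.disjoint_def.mpr fun _ hx hrel => (map_eq_zero_iff _ (gaugeMap_injective ε)).mp <|
    Submodule.disjoint_def.mp disjoint_normalSpan_gaugedBlock _
      (normalSpan_descendsSym_le_comap ε hx) (relIdeal_symBlock_le_comap ε X hrel)

end Gauge

section Normal

variable {R : Type*} [CommRing R]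

theorem mapRingHom_symBlock {R' : Type*} [CommRing R'] (φ : R →+* R') (ε : ℤˣ) (f : SymFamily)
    (a b : ℤ) : MonoidAlgebra.mapRingHom _ φ (symBlock R ε f a b) = symBlock R' ε f a b := by
  cases f <;> simp only [symBlock, Units.smul_def, map_sub, map_zsmul, mapRingHom_wd]

variable (ε : ℤˣ) (t : R)

theorem wd_pair_mem_sup_relIdeal_of_odd (a : ℤ) (k : ℕ) (s₁ s₂ : ℤˣ) :
    wd R [(a, s₁), (a + (2 : ℕ) * k + 1, s₂)] ∈ Submodule.span R
      (wd R '' straighter (a, s₁) (a + (2 : ℕ) * k + 1, s₂)) ⊔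
        relIdeal (reflectionGens 2 t (symBlock R ε)) := by
  refine mem_sup_relIdeal_reflectionGens (.odd s₁ s₂) a k ?_ fun hk => sub_mem ?_ ?_
  · rw [symBlock, sub_sub_cancel]
    exact wd_mem_span_straighter (by omega) (by omega) (by omega)
  all_goals exact wd_mem_span_straighter (by omega) (by omega) (by omega)

theorem wd_pair_mem_sup_relIdeal_of_even (a : ℤ) (k : ℕ) (s : ℤˣ) :
    wd R [(a, s), (a + (2 : ℕ) * k, -s)] ∈ Submodule.span R
      (wd R '' straighter (a, s) (a + (2 : ℕ) * k, -s)) ⊔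
        relIdeal (reflectionGens 2 t (symBlock R ε)) := by
  refine mem_sup_relIdeal_reflectionGens (.even s) a k ?_ fun hk => ?_
  · rw [symBlock, sub_self]
    exact zero_mem _
  · exact wd_mem_span_straighter (by omega) (by omega) (by omega)

theorem wd_pair_mem_sup_relIdeal_of_half (a : ℤ) (k : ℕ) (s : ℤˣ) :
    wd R [(a - 1, s), (a + (2 : ℕ) * k + 1, s)] ∈ Submodule.span R
      (wd R '' straighter (a - 1, s) (a + (2 : ℕ) * k + 1, s)) ⊔
        relIdeal (reflectionGens 2 t (symBlock R ε)) := by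
  refine mem_sup_relIdeal_reflectionGens (.half s) a k ?_ fun hk =>
    sub_mem (sub_mem ?_ ?_) (zsmul_mem (sub_mem ?_ ?_) _)
  · rw [symBlock, sub_sub, sub_sub_cancel]
    refine add_mem ?_ (zsmul_mem (sub_mem ?_ ?_) _) <;>
    exact wd_mem_span_straighter (by omega) (by omega) (by omega)
  all_goals exact wd_mem_span_straighter (by omega) (by omega) (by omega)

theorem wd_pair_mem_sup_relIdeal_symBlock (x y : ℤ × ℤˣ) (h : ¬ descendsSym x y) :
    wd R [x, y] ∈ Submodule.span R (wd R '' straighter x y) ⊔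
      relIdeal (reflectionGens 2 t (symBlock R ε)) := by
  obtain ⟨a, s⟩ := x
  obtain ⟨b, s'⟩ := y
  obtain ⟨hab, hs⟩ : a ≤ b ∧ (b = a → s ≠ s') := by simpa [descendsSym] using h
  obtain ⟨n, rfl⟩ := Int.le.dest hab
  obtain ⟨k, rfl | rfl⟩ := Nat.even_or_odd' n
  · obtain rfl | hne := eq_or_ne s s'
    · obtain ⟨k, rfl⟩ : ∃ l, k = l + 1 :=
        Nat.exists_eq_succ_of_ne_zero fun hk => hs (by simp [hk]) rfl
      have := wd_pair_mem_sup_relIdeal_of_half ε t (a + 1) k s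
      have hb : a + 1 + (2 : ℕ) * k + 1 = a + (2 * (k + 1) : ℕ) := by push_cast; ring
      rwa [add_sub_cancel_right, hb] at this
    · obtain rfl := Int.units_ne_iff_eq_neg.mp hne.symm
      exact_mod_cast wd_pair_mem_sup_relIdeal_of_even ε t a k s
  · have := wd_pair_mem_sup_relIdeal_of_odd ε t a k s s'
    push_cast at this ⊢
    rwa [← add_assoc]

theorem isCompl_normalSpan_symBlock :
    IsCompl (normalSpan R descendsSym) (relIdeal (reflectionGens 2 t (symBlock R ε))) where
  disjoint := disjoint_normalSpan_map (Polynomial.eval₂RingHom (Int.castRingHom R) t)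
    ⟨disjoint_normalSpan_symBlock ε, codisjoint_normalSpan (wd_pair_mem_sup_relIdeal_symBlock ε X)⟩
    (by rw [image_reflectionGens _ _ _ (mapRingHom_symBlock _ ε), coe_eval₂RingHom, eval₂_X])
  codisjoint := codisjoint_normalSpan (wd_pair_mem_sup_relIdeal_symBlock ε t)

end Normal

end Symmetric

section Words

variable {R : Type*} [CommRing R] {S : Type}

theorem isChain_descends_iff {l : List (ℤ × S)} :
    l.IsChain descends ↔ (l.map Prod.fst).IsChain (· ≥ ·) := by
  rw [List.isChain_map]
  rfl

theorem cons_sub_mem_relIdeal {gens : Set (TypRing R S)} {l l' : List (ℤ × S)}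
    (h : wd R l - wd R l' ∈ relIdeal gens) (x : ℤ × S) :
    wd R (x :: l) - wd R (x :: l') ∈ relIdeal gens := by
  have := mul_mem_relIdeal h (wd R [x]) 1
  rwa [mul_one, mul_sub, ← wd_append, ← wd_append] at this

end Words

section Data

variable {S : Type} [CommGroup S]

/-- The product of the signs of the letters of exponent `i`. -/
def signAt (l : List (ℤ × S)) (i : ℤ) : S :=
  (l.map fun x => if x.1 = i then x.2 else 1).prod

theorem signAt_nil (i : ℤ) : signAt ([] : List (ℤ × S)) i = 1 := rfl

theorem signAt_cons (x : ℤ × S) (l : List (ℤ × S)) (i : ℤ) :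
    signAt (x :: l) i = (if x.1 = i then x.2 else 1) * signAt l i := by
  rw [signAt, List.map_cons, List.prod_cons, signAt]

theorem signAt_append (l l' : List (ℤ × S)) (i : ℤ) :
    signAt (l ++ l') i = signAt l i * signAt l' i := by
  simp only [signAt, List.map_append, List.prod_append]

theorem signAt_eq_one {l : List (ℤ × S)} {i : ℤ} (h : i ∉ l.map Prod.fst) : signAt l i = 1 :=
  List.prod_eq_one fun _ hy => by
    obtain ⟨x, hx, rfl⟩ := List.mem_map.mp hy
    exact if_neg (ne_of_mem_of_not_mem (List.mem_map_of_mem hx) h)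

theorem typData_e {r : ℕ} (v : Typ S r) (i : ℤ) :
    (typData v).1.e i = ((List.ofFn v).map Prod.fst).count i := by
  change (Finset.univ.filter fun k => (v k).1 = i).card = _
  rw [List.map_ofFn, ← Multiset.coe_count, ← Fin.univ_val_map, Multiset.count,
    Multiset.countP_map]
  simp only [Function.comp_apply, eq_comm (a := i)]
  rfl

theorem typData_χ {r : ℕ} (v : Typ S r) (i : ℤ) :
    (typData v).1.χ i = signAt (List.ofFn v) i := by
  change ∏ k ∈ Finset.univ.filter (fun k => (v k).1 = i), (v k).2 = _
  rw [signAt, List.map_ofFn, List.prod_ofFn, Finset.prod_filter]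
  rfl

/-- The multiplicity / sign data of a word of arbitrary length. -/
noncomputable def wordData (l : List (ℤ × S)) : TypZero S := (typData l.get).1

theorem wordData_e (l : List (ℤ × S)) (i : ℤ) : (wordData l).e i = (l.map Prod.fst).count i := by
  rw [wordData, typData_e, List.ofFn_get]

theorem wordData_χ (l : List (ℤ × S)) (i : ℤ) : (wordData l).χ i = signAt l i := by
  rw [wordData, typData_χ, List.ofFn_get]

theorem wordData_eq {l : List (ℤ × S)} {t : TypZero S} (he : ∀ i, (l.map Prod.fst).count i = t.e i)
    (hχ : ∀ i, signAt l i = t.χ i) : wordData l = t :=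
  TypZero.ext (Finsupp.ext fun i => (wordData_e l i).trans (he i))
    (funext fun i => (wordData_χ l i).trans (hχ i))

theorem wordData_ofFn {r : ℕ} (v : Typ S r) : wordData (List.ofFn v) = (typData v).1 :=
  wordData_eq (fun i => (typData_e v i).symm) fun i => (typData_χ v i).symm

end Data

section NormalWord

variable {S : Type} [CommGroup S]

/-- The word with given exponents in which the last letter of exponent `a` has sign `χ a` and all
the other letters have sign `1`. -/
def decorate (χ : ℤ → S) : List ℤ → List (ℤ × S)
  | [] => []
  | a :: e => (a, if a ∈ e then 1 else χ a) :: decorate χ e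

theorem map_fst_decorate (χ : ℤ → S) (e : List ℤ) : (decorate χ e).map Prod.fst = e := by
  induction e with
  | nil => rfl
  | cons a e ih => rw [decorate, List.map_cons, ih]

theorem signAt_decorate (χ : ℤ → S) (e : List ℤ) (i : ℤ) :
    signAt (decorate χ e) i = if i ∈ e then χ i else 1 := by
  induction e with
  | nil => rfl
  | cons a e ih =>
    rw [decorate, signAt_cons, ih]
    obtain rfl | ha := eq_or_ne i a
    · by_cases hi : i ∈ e <;> simp [hi]
    · simp [ha, ha.symm]

theorem decorate_update {χ : ℤ → S} {a : ℤ} {e : List ℤ} (ha : a ∉ e) (x : S) :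
    decorate (Function.update χ a x) e = decorate χ e := by
  induction e with
  | nil => rfl
  | cons b e ih =>
    rw [List.mem_cons, not_or] at ha
    rw [decorate, decorate, Function.update_of_ne (Ne.symm ha.1), ih ha.2]

/-- The word with weakly decreasing exponents chosen to represent the given data. -/
noncomputable def normalWord (t : TypZero S) : List (ℤ × S) :=
  decorate t.χ (t.e.toMultiset.sort (· ≥ ·))

theorem count_normalWord (t : TypZero S) (i : ℤ) :
    ((normalWord t).map Prod.fst).count i = t.e i := by
  rw [normalWord, map_fst_decorate, ← Multiset.coe_count, Multiset.sort_eq,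
    Finsupp.count_toMultiset]

theorem wordData_normalWord (t : TypZero S) : wordData (normalWord t) = t := by
  refine wordData_eq (count_normalWord t) fun i => ?_
  simp only [normalWord, signAt_decorate, Multiset.mem_sort, Finsupp.mem_toMultiset,
    Finsupp.mem_support_iff]
  split_ifs with hi
  · rfl
  · exact (t.χ_eq_one i (not_not.mp hi)).symm

theorem isChain_normalWord (t : TypZero S) : (normalWord t).IsChain descends := by
  rw [isChain_descends_iff, normalWord, map_fst_decorate]
  exact (Multiset.pairwise_sort _ _).isChain

theorem normalWord_wordData {l : List (ℤ × S)} (hl : l.IsChain descends) :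
    normalWord (wordData l) = decorate (signAt l) (l.map Prod.fst) := by
  have hexp : (wordData l).e.toMultiset.sort (· ≥ ·) = l.map Prod.fst := by
    refine List.Perm.eq_of_pairwise (fun a b _ _ hab hba => le_antisymm hba hab)
      (Multiset.pairwise_sort _ _) (isChain_descends_iff.mp hl).pairwise ?_
    rw [List.perm_iff_count]
    intro i
    rw [← Multiset.coe_count, Multiset.sort_eq, Finsupp.count_toMultiset, wordData_e]
  rw [normalWord, hexp, funext (wordData_χ l)]

end NormalWord

section Merging

variable {R : Type*} [CommRing R] {S : Type} [CommGroup S]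

variable (R S) in
/-- The relations moving the sign of a letter to the next letter, if that has the same exponent. -/
def mergeGens : Set (TypRing R S) :=
  {x | ∃ a χ χ', x = wd R [(a, χ), (a, χ')] - wd R [(a, 1), (a, χ * χ')]}

variable (R S) in
/-- The linear map sending a word to its multiplicity / sign data. -/
noncomputable def dataMap : TypRing R S →ₗ[R] TypZero S →₀ R :=
  wdLift fun l => Finsupp.single (wordData l) 1

theorem dataMap_wd (l : List (ℤ × S)) :
    dataMap R S (wd R l) = Finsupp.single (wordData l) 1 :=
  wdLift_wd _ l

theorem relIdeal_mergeGens_le_ker_dataMap :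
    relIdeal (mergeGens R S) ≤ LinearMap.ker (dataMap R S) := by
  refine relIdeal_le ?_
  rintro _ ⟨a, χ, χ', rfl⟩ u w
  have hdata : wordData (u ++ [(a, χ), (a, χ')] ++ w) =
      wordData (u ++ [(a, 1), (a, χ * χ')] ++ w) := by
    refine wordData_eq (fun i => ?_) fun i => ?_
    · simp [wordData_e]
    · simp only [wordData_χ, signAt_append, signAt_cons, signAt_nil]
      split_ifs <;> simp
  rw [LinearMap.mem_ker, mul_sub, sub_mul, map_sub, sub_eq_zero]
  simp only [← wd_append, dataMap_wd, hdata]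

theorem merge_sub_mem_relIdeal (a : ℤ) (χ χ' : S) (l : List (ℤ × S)) :
    wd R ((a, χ) :: (a, χ') :: l) - wd R ((a, 1) :: (a, χ * χ') :: l) ∈
      relIdeal (mergeGens R S) := by
  have hgen : wd R [(a, χ), (a, χ')] - wd R [(a, 1), (a, χ * χ')] ∈ mergeGens R S :=
    ⟨a, χ, χ', rfl⟩
  have := mul_mem_relIdeal (subset_relIdeal hgen) 1 (wd R l)
  rwa [one_mul, sub_mul, ← wd_append, ← wd_append] at this

theorem cons_decorate_sub_mem_relIdeal (a : ℤ) (χ : S) (ψ : ℤ → S) {e : List ℤ}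
    (he : (a :: e).IsChain (· ≥ ·)) (ha : a ∈ e) :
    wd R ((a, χ) :: decorate ψ e) - wd R ((a, 1) :: decorate (Function.update ψ a (χ * ψ a)) e) ∈
      relIdeal (mergeGens R S) := by
  induction e with
  | nil => exact absurd ha List.not_mem_nil
  | cons b e ih =>
    obtain ⟨hab, hbe⟩ := List.isChain_cons_cons.mp he
    obtain rfl : b = a := by
      obtain rfl | hae := List.mem_cons.mp ha
      · rfl
      · exact le_antisymm hab ((List.pairwise_cons.mp hbe.pairwise).1 a hae)
    have hmerge := merge_sub_mem_relIdeal (R := R) b χ (if b ∈ e then 1 else ψ b) (decorate ψ e)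
    rw [decorate, decorate, Function.update_self]
    by_cases hb : b ∈ e
    · simp only [if_pos hb, mul_one] at hmerge ⊢
      rw [← sub_add_sub_cancel]
      exact add_mem hmerge (cons_sub_mem_relIdeal (ih hbe hb) (b, 1))
    · simp only [if_neg hb] at hmerge ⊢
      rwa [decorate_update hb]

theorem wd_sub_normalWord_mem_relIdeal {l : List (ℤ × S)} (hl : l.IsChain descends) :
    wd R l - wd R (normalWord (wordData l)) ∈ relIdeal (mergeGens R S) := by
  rw [normalWord_wordData hl]
  induction l with
  | nil => exact sub_self (wd R []) ▸ zero_mem _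
  | cons x l ih =>
    obtain ⟨a, χ⟩ := x
    have hsign : Function.update (signAt l) a (χ * signAt l a) = signAt ((a, χ) :: l) := by
      funext i
      rw [signAt_cons]
      obtain rfl | hi := eq_or_ne i a
      · rw [Function.update_self, if_pos rfl]
      · rw [Function.update_of_ne hi, if_neg hi.symm, one_mul]
    rw [← sub_add_sub_cancel]
    refine add_mem (cons_sub_mem_relIdeal (ih hl.tail) (a, χ)) ?_
    rw [List.map_cons, decorate, ← hsign]
    by_cases ha : a ∈ l.map Prod.fst
    · rw [if_pos ha]
      exact cons_decorate_sub_mem_relIdeal a χ _ (isChain_descends_iff.mp hl) ha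
    · rw [if_neg ha, Function.update_self, signAt_eq_one ha, mul_one,
        decorate_update ha, sub_self]
      exact zero_mem _

end Merging

section Criterion

variable {R : Type*} [CommRing R] {S : Type} {r : ℕ}

theorem inclusion_single (v : Typ S r) :
    inclusion R S r (Finsupp.single v 1) = wd R (List.ofFn v) := by
  rw [inclusion, Finsupp.linearCombination_single, one_smul, wd]

theorem mem_relPart {gens : Set (TypRing R S)} {x : Typ S r →₀ R} :
    x ∈ relPart R gens r ↔ inclusion R S r x ∈ relIdeal gens :=
  mem_relIdeal.symm

theorem isChain_ofFn_iff {v : Typ S r} :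
    (List.ofFn v).IsChain descends ↔ Antitone fun k => (v k).1 := by
  rw [isChain_descends_iff, List.map_ofFn, List.isChain_iff_pairwise, List.pairwise_ofFn]
  exact ⟨fun h => antitone_iff_forall_lt.mpr fun _ _ hij => h hij, fun h _ _ hij => h hij.le⟩

variable [CommGroup S]

theorem length_normalWord (t : TypZeroOfRank S r) : (normalWord t.1).length = r := by
  rw [← List.length_map Prod.fst, normalWord, map_fst_decorate, Multiset.length_sort,
    Finsupp.card_toMultiset]
  exact t.2

/-- The word `normalWord t` as an element of `Typ_r`. -/
noncomputable def normalTyp (t : TypZeroOfRank S r) : Typ S r :=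
  fun k => (normalWord t.1).get (k.cast (length_normalWord t).symm)

theorem ofFn_normalTyp (t : TypZeroOfRank S r) : List.ofFn (normalTyp t) = normalWord t.1 :=
  List.ext_get (by rw [List.length_ofFn, length_normalWord]) fun i _ _ => by
    rw [List.get_ofFn]
    rfl

theorem antitone_normalTyp (t : TypZeroOfRank S r) : Antitone fun k => (normalTyp t k).1 :=
  isChain_ofFn_iff.mp (ofFn_normalTyp t ▸ isChain_normalWord t.1)

theorem typData_normalTyp (t : TypZeroOfRank S r) : typData (normalTyp t) = t :=
  Subtype.ext (by rw [← wordData_ofFn, ofFn_normalTyp, wordData_normalWord])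

variable (gens : Set (TypRing R S))

/-- The candidate for the inverse of the straightening map. -/
noncomputable def normalClass :
    (TypZeroOfRank S r →₀ R) →ₗ[R] (Typ S r →₀ R) ⧸ relPart R gens r :=
  (relPart R gens r).mkQ ∘ₗ Finsupp.lmapDomain R R normalTyp

variable {gens}

theorem normalClass_single (t : TypZeroOfRank S r) : normalClass gens (Finsupp.single t 1) =
    Submodule.Quotient.mk (Finsupp.single (normalTyp t) 1) := by
  rw [normalClass, LinearMap.comp_apply, Finsupp.lmapDomain_apply, Finsupp.mapDomain_single,
    Submodule.mkQ_apply]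

theorem normalClass_typData (hmerge : relIdeal (mergeGens R S) ≤ relIdeal gens) {v : Typ S r}
    (hv : Antitone fun k => (v k).1) : normalClass gens (Finsupp.single (typData v) 1) =
      Submodule.Quotient.mk (Finsupp.single v 1) := by
  rw [normalClass_single, eq_comm, Submodule.Quotient.eq, mem_relPart, map_sub, inclusion_single,
    inclusion_single, ofFn_normalTyp, ← wordData_ofFn]
  exact hmerge (wd_sub_normalWord_mem_relIdeal (isChain_ofFn_iff.mpr hv))

theorem normalClass_surjective (hmerge : relIdeal (mergeGens R S) ≤ relIdeal gens)
    (hspan : ∀ l, wd R l ∈ Submodule.span R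
      (wd R '' {n | n.IsChain descends ∧ n.length = l.length}) ⊔ relIdeal gens) :
    Function.Surjective (normalClass gens (r := r)) := by
  set Q := (LinearMap.range (normalClass gens (r := r))).comap (relPart R gens r).mkQ
  have hdesc : Submodule.span R (wd R '' {n | n.IsChain descends ∧ n.length = r}) ≤
      Q.map (inclusion R S r) := by
    refine Submodule.span_le.mpr ?_
    rintro _ ⟨n, ⟨hn, rfl⟩, rfl⟩
    refine ⟨Finsupp.single n.get 1, ⟨_, normalClass_typData hmerge ?_⟩, ?_⟩
    · rwa [← isChain_ofFn_iff, List.ofFn_get]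
    · rw [inclusion_single, List.ofFn_get]
  have hword (v : Typ S r) : Finsupp.single v 1 ∈ Q := by
    have hv := hspan (List.ofFn v)
    rw [List.length_ofFn] at hv
    obtain ⟨_, hy, z, hz, hyz⟩ := Submodule.mem_sup.mp hv
    obtain ⟨y, hyQ, rfl⟩ := hdesc hy
    rw [← sub_add_cancel (Finsupp.single v 1) y]
    refine add_mem ⟨0, ?_⟩ hyQ
    rw [map_zero, eq_comm, Submodule.mkQ_apply, Submodule.Quotient.mk_eq_zero, mem_relPart,
      map_sub, inclusion_single, ← hyz, add_sub_cancel_left]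
    exact hz
  refine LinearMap.range_eq_top.mp (eq_top_iff.mpr fun x _ => ?_)
  obtain ⟨x, rfl⟩ := Submodule.mkQ_surjective _ x
  have hbasis := (Finsupp.basisSingleOne (R := R) (ι := Typ S r)).span_eq
  rw [Finsupp.coe_basisSingleOne] at hbasis
  have hQ : ⊤ ≤ Q := hbasis.symm.trans_le (Submodule.span_le.mpr (Set.range_subset_iff.mpr hword))
  exact hQ Submodule.mem_top

theorem normalClass_injective
    (hinf : normalSpan R descends ⊓ relIdeal gens ≤ relIdeal (mergeGens R S)) :
    Function.Injective (normalClass gens (r := r)) := by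
  refine (injective_iff_map_eq_zero _).mpr fun x hx => ?_
  set y := inclusion R S r (Finsupp.lmapDomain R R normalTyp x)
  have hrel : y ∈ relIdeal gens :=
    mem_relPart.mp ((Submodule.Quotient.mk_eq_zero _).mp hx)
  have hdesc : y ∈ normalSpan R descends := by
    have hy : y =
        Finsupp.linearCombination R (fun t : TypZeroOfRank S r => wd R (normalWord t.1)) x :=
      LinearMap.congr_fun (f := inclusion R S r ∘ₗ Finsupp.lmapDomain R R normalTyp)
        (by ext t : 2; simp [inclusion_single, ofFn_normalTyp]) x
    rw [hy]
    exact Submodule.sum_mem _ fun t _ => Submodule.smul_mem _ _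
      (Submodule.subset_span ⟨_, isChain_normalWord t.1, rfl⟩)
  have hdata : dataMap R S y = Finsupp.mapDomain Subtype.val x :=
    LinearMap.congr_fun (f := dataMap R S ∘ₗ inclusion R S r ∘ₗ Finsupp.lmapDomain R R normalTyp)
      (g := Finsupp.lmapDomain R R Subtype.val)
      (by ext t : 2; simp [inclusion_single, ofFn_normalTyp, dataMap_wd, wordData_normalWord]) x
  refine Finsupp.mapDomain_injective Subtype.val_injective ?_
  rw [← hdata, Finsupp.mapDomain_zero]
  exact relIdeal_mergeGens_le_ker_dataMap (hinf ⟨hdesc, hrel⟩)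

theorem exists_straightening (hmerge : relIdeal (mergeGens R S) ≤ relIdeal gens)
    (hspan : ∀ l, wd R l ∈ Submodule.span R
      (wd R '' {n | n.IsChain descends ∧ n.length = l.length}) ⊔ relIdeal gens)
    (hinf : normalSpan R descends ⊓ relIdeal gens ≤ relIdeal (mergeGens R S)) :
    ∃ str : ((Typ S r →₀ R) ⧸ relPart R gens r) ≃ₗ[R] (TypZeroOfRank S r →₀ R),
      IsStraightening str.toLinearMap ∧ ∀ f, IsStraightening f → f = str.toLinearMap := by
  let str := (LinearEquiv.ofBijective (normalClass gens)
    ⟨normalClass_injective (r := r) hinf, normalClass_surjective hmerge hspan⟩).symm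
  refine ⟨str, fun v hv => ?_, fun f hf => ?_⟩
  · rw [← normalClass_typData hmerge hv]
    exact str.apply_symm_apply _
  · have hcomp : f ∘ₗ normalClass gens = LinearMap.id := by
      ext t : 2
      simpa [normalClass_single, typData_normalTyp] using hf _ (antitone_normalTyp t)
    refine LinearMap.ext fun x => ?_
    obtain ⟨y, rfl⟩ := str.symm.surjective x
    exact (LinearMap.congr_fun hcomp y).trans (str.apply_symm_apply y).symm

end Criterion

section HallLittlewood

variable {R : Type*} [CommRing R] (t : R) (r : ℕ)

theorem exists_straightening_hlBlock :
    ∃ str : ((Typ Unit r →₀ R) ⧸ relPart R (reflectionGens 1 t (hlBlock R)) r) ≃ₗ[R]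
        (TypZeroOfRank Unit r →₀ R),
      IsStraightening str.toLinearMap ∧ ∀ f, IsStraightening f → f = str.toLinearMap := by
  refine exists_straightening (relIdeal_le ?_)
    (wd_mem_span_sup_relIdeal (wd_pair_mem_sup_relIdeal_hlBlock t))
    ((isCompl_normalSpan_hlBlock t).inf_eq_bot.trans_le bot_le)
  rintro _ ⟨a, χ, χ', rfl⟩ u w
  rw [sub_self, mul_zero, zero_mul]
  exact zero_mem _

end HallLittlewood

section Ideals

variable {R : Type*} [CommRing R] {S : Type} {gens gens' : Set (TypRing R S)}

theorem relIdeal_le_relIdeal (h : ∀ g ∈ gens, g ∈ relIdeal gens') :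
    relIdeal gens ≤ relIdeal gens' :=
  relIdeal_le fun g hg _ _ => mul_mem_relIdeal (h g hg) _ _

variable {S' : Type}

theorem map_relIdeal_le (f : TypRing R S →ₐ[R] TypRing R S') :
    (relIdeal gens).map f.toLinearMap ≤ relIdeal (f '' gens) :=
  Submodule.map_le_iff_le_comap.mpr <| relIdeal_le fun g hg u w => by
    rw [Submodule.mem_comap, AlgHom.toLinearMap_apply, map_mul, map_mul]
    exact mul_mem_relIdeal (subset_relIdeal (Set.mem_image_of_mem f hg)) _ _

theorem map_relIdeal (f : TypRing R S ≃ₐ[R] TypRing R S') :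
    (relIdeal gens).map f.toLinearMap = relIdeal (f '' gens) := by
  refine le_antisymm (map_relIdeal_le f.toAlgHom) fun x hx => ?_
  have := map_relIdeal_le f.symm.toAlgHom ⟨x, hx, rfl⟩
  refine ⟨f.symm x, ?_, f.apply_symm_apply x⟩
  simpa [Set.image_image] using this

theorem relIdeal_reflectionGens_eq [Invertible (2 : R)] {ι : Type*} (m : ℕ) (t : R)
    (B : ι → ℤ → ℤ → TypRing R S) : relIdeal (reflectionGens m t B) =
      relIdeal {x | ∃ i a, ∃ k : ℕ, x = B i a (a + m * k) + t ^ k • B i (a + m * k) a} := by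
  refine le_antisymm (relIdeal_le_relIdeal ?_)
    (relIdeal_le_relIdeal fun g hg => subset_relIdeal (Or.inr hg))
  rintro _ (⟨i, a, rfl⟩ | hg)
  · rw [← invOf_two_smul_add_invOf_two_smul R (B i a a), ← smul_add]
    refine Submodule.smul_mem _ _ (subset_relIdeal ⟨i, a, 0, ?_⟩)
    simp
  · exact subset_relIdeal hg

end Ideals

section Fourier

variable {R : Type*} [CommRing R]

/-- The Fourier transform on the sign of each letter, scaled by `c` for each letter. -/
noncomputable def fourierHom (c : R) : TypRing R ℤˣ →ₐ[R] TypRing R ℤˣ :=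
  MonoidAlgebra.lift R _ _ (FreeMonoid.lift fun x =>
    c • ∑ χ : ℤˣ, ((signChar x.2 χ : ℤ) : R) • wd R [(x.1, χ)])

theorem fourierHom_wd_singleton (c : R) (a : ℤ) (s : ℤˣ) : fourierHom c (wd R [(a, s)]) =
    c • ∑ χ : ℤˣ, ((signChar s χ : ℤ) : R) • wd R [(a, χ)] := by
  rw [fourierHom, wd, MonoidAlgebra.lift_single, one_smul]
  rfl

theorem fourierHom_wd_cons (c : R) (x : ℤ × ℤˣ) (l : List (ℤ × ℤˣ)) :
    fourierHom c (wd R (x :: l)) = fourierHom c (wd R [x]) * fourierHom c (wd R l) := by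
  rw [← map_mul, ← wd_append, List.singleton_append]

theorem fourierHom_fourierHom_singleton {c c' : R} (h : c' * c * 2 = 1) (a : ℤ) (s : ℤˣ) :
    fourierHom c (fourierHom c' (wd R [(a, s)])) = wd R [(a, s)] := by
  conv_rhs => rw [← one_smul R (wd R [(a, s)]), ← h]
  simp only [fourierHom_wd_singleton, map_smul, map_add, sum_units_int]
  obtain rfl | rfl := Int.units_eq_one_or s <;>
  · simp only [signChar, ↓reduceIte, neg_units_ne_self, Units.val_one, Units.val_neg,
      Int.cast_one, Int.cast_neg, one_smul, neg_smul, smul_add, smul_neg, neg_neg]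
    module

theorem fourierHom_comp_fourierHom {c c' : R} (h : c' * c * 2 = 1) :
    (fourierHom c).comp (fourierHom c') = AlgHom.id R (TypRing R ℤˣ) := by
  refine AlgHom.toLinearMap_injective (linearMap_ext_wd fun l => ?_)
  change fourierHom c (fourierHom c' (wd R l)) = wd R l
  induction l with
  | nil => rw [show wd R [] = (1 : TypRing R ℤˣ) from rfl, map_one, map_one]
  | cons x l ih =>
    rw [fourierHom_wd_cons, map_mul, ih, fourierHom_fourierHom_singleton h, ← wd_append,
      List.singleton_append]

theorem fourierHom_wd_mem_span (c : R) (l : List (ℤ × ℤˣ)) : fourierHom c (wd R l) ∈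
    Submodule.span R (wd R '' {l' | l'.map Prod.fst = l.map Prod.fst}) := by
  induction l with
  | nil =>
    rw [show wd R [] = (1 : TypRing R ℤˣ) from rfl, map_one]
    exact Submodule.subset_span ⟨[], rfl, rfl⟩
  | cons x l ih =>
    rw [fourierHom_wd_cons, fourierHom_wd_singleton, smul_mul_assoc, Finset.sum_mul]
    refine Submodule.smul_mem _ _ (Submodule.sum_mem _ fun χ _ => ?_)
    rw [smul_mul_assoc]
    refine Submodule.smul_mem _ _ ?_
    have hcons := Submodule.mem_map_of_mem (f := LinearMap.mulLeft R (wd R [(x.1, χ)])) ih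
    rw [Submodule.map_span, Set.image_image] at hcons
    refine Submodule.span_mono ?_ hcons
    rintro _ ⟨l', hl', rfl⟩
    exact ⟨(x.1, χ) :: l', congrArg (x.1 :: ·) hl', wd_append [(x.1, χ)] l'⟩

theorem map_fourierHom_span_le (c : R) (A : Set (List ℤ)) :
    (Submodule.span R (wd R '' {l | l.map Prod.fst ∈ A})).map (fourierHom c).toLinearMap ≤
      Submodule.span R (wd R '' {l | l.map Prod.fst ∈ A}) := by
  refine Submodule.map_span_le _ _ _ |>.mpr ?_
  rintro _ ⟨l, hl, rfl⟩
  refine Submodule.span_mono (Set.image_mono fun l' hl' => ?_) (fourierHom_wd_mem_span c l)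
  exact (congrArg (· ∈ A) hl').mpr hl

theorem pairSigma_eq (a : ℤ) (s : ℤˣ) (b : ℤ) (s' : ℤˣ) : pairSigma R a s b s' =
    ∑ χ : ℤˣ, ∑ χ' : ℤˣ, (((signChar s χ * signChar s' χ' : ℤˣ) : ℤ) : R) •
      wd R [(a, χ), (b, χ')] := by
  refine Finset.sum_congr rfl fun χ _ => Finset.sum_congr rfl fun χ' _ => ?_
  rw [wd, MonoidAlgebra.smul_single, smul_eq_mul, mul_one]
  rfl

variable [Invertible (2 : R)]

variable (R) in
/-- The Fourier transform on the sign of each letter, as an automorphism of `R[Typ]`. -/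
noncomputable def fourier : TypRing R ℤˣ ≃ₐ[R] TypRing R ℤˣ :=
  AlgEquiv.ofAlgHom (fourierHom 1) (fourierHom ⅟2)
    (fourierHom_comp_fourierHom (by rw [mul_one, invOf_mul_self]))
    (fourierHom_comp_fourierHom (by rw [one_mul, invOf_mul_self]))

theorem map_fourier_span (A : Set (List ℤ)) :
    (Submodule.span R (wd R '' {l | l.map Prod.fst ∈ A})).map (fourier R).toLinearMap =
      Submodule.span R (wd R '' {l | l.map Prod.fst ∈ A}) :=
  le_antisymm (map_fourierHom_span_le 1 A) fun x hx =>
    ⟨(fourier R).symm x, map_fourierHom_span_le ⅟2 A ⟨x, hx, rfl⟩, (fourier R).apply_symm_apply x⟩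

theorem fourier_wd_pair (a : ℤ) (s : ℤˣ) (b : ℤ) (s' : ℤˣ) :
    fourier R (wd R [(a, s), (b, s')]) = pairSigma R a s b s' := by
  change fourierHom 1 _ = _
  rw [fourierHom_wd_cons, fourierHom_wd_singleton, fourierHom_wd_singleton, one_smul, one_smul,
    Finset.sum_mul_sum, pairSigma_eq]
  simp only [smul_mul_smul_comm, ← wd_append, List.singleton_append, Units.val_mul, Int.cast_mul]

variable (q : ℕ) (ε : ℤˣ)

theorem fourier_symBlock_half (s : ℤˣ) (a b : ℤ) :
    fourier R (symBlock R ε (.half s) a b) = relHalf R ε a b s := by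
  simp only [symBlock, map_sub, Units.smul_def, ← Int.cast_smul_eq_zsmul R, map_smul,
    fourier_wd_pair, relHalf]
  abel

theorem fourier_symBlock_odd (s₁ s₂ : ℤˣ) (a b : ℤ) :
    fourier R (symBlock R ε (.odd s₁ s₂) a b) =
      pairSigma R a s₁ (b + 1) s₂ - pairSigma R (a + 1) s₂ b s₁ := by
  simp only [symBlock, map_sub, fourier_wd_pair]

theorem fourier_symBlock_even (s : ℤˣ) (a b : ℤ) :
    fourier R (symBlock R ε (.even s) a b) = pairSigma R a s b (-s) :=
  fourier_wd_pair a s b (-s)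

theorem relSymmetric_eq_image_fourier : relSymmetric R q ε = fourier R ''
    {x | ∃ i a, ∃ k : ℕ, x = symBlock R ε i a (a + 2 * k) +
      (q : R) ^ k • symBlock R ε i (a + 2 * k) a} := by
  ext x
  constructor
  · rintro ((⟨a, b, s₁, s₂, k, rfl, rfl⟩ | ⟨a, b, s, k, rfl, rfl⟩) | ⟨a, b, s, k, rfl, rfl⟩)
    · refine ⟨_, ⟨.odd s₁ s₂, a, k, rfl⟩, ?_⟩
      simp only [map_add, map_smul, fourier_symBlock_odd, add_sub_cancel_right]
      module
    · refine ⟨_, ⟨.even s, a, k, rfl⟩, ?_⟩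
      simp only [map_add, map_smul, fourier_symBlock_even]
    · refine ⟨_, ⟨.half s, a + 1, k, rfl⟩, ?_⟩
      simp only [map_add, map_smul, fourier_symBlock_half]
      rw [show a + 2 * k + 2 - 1 = a + 1 + 2 * (k : ℤ) by ring]
  · rintro ⟨_, ⟨i, a, k, rfl⟩, rfl⟩
    rw [map_add, map_smul]
    obtain ⟨s₁, s₂⟩ | s | s := i
    · refine Or.inl (Or.inl ⟨a, a + 2 * k + 1, s₁, s₂, k, rfl, ?_⟩)
      simp only [fourier_symBlock_odd, add_sub_cancel_right]
      module
    · refine Or.inl (Or.inr ⟨a, a + 2 * k, s, k, rfl, ?_⟩)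
      simp only [fourier_symBlock_even]
    · refine Or.inr ⟨a - 1, a - 1 + 2 * k + 2, s, k, rfl, ?_⟩
      rw [fourier_symBlock_half, fourier_symBlock_half, sub_add_cancel,
        show a - 1 + 2 * k + 2 - 1 = a + 2 * (k : ℤ) by ring]

theorem relIdeal_relSymmetric : relIdeal (relSymmetric R q ε) =
    (relIdeal (reflectionGens 2 (q : R) (symBlock R ε))).map (fourier R).toLinearMap := by
  rw [relSymmetric_eq_image_fourier, ← map_relIdeal, relIdeal_reflectionGens_eq]
  rfl

end Fourier

section Opposite

variable {R : Type*} [CommRing R]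

variable (R) in
/-- The words of length two with equal exponents and opposite signs. The Fourier transform maps the
ideal they generate onto the one generated by `mergeGens`. -/
def oppositeGens : Set (TypRing R ℤˣ) :=
  {x | ∃ a s, x = wd R [(a, s), (a, -s)]}

theorem relIdeal_oppositeGens_le (ε : ℤˣ) (t : R) : relIdeal (oppositeGens R) ≤
    relIdeal (reflectionGens 2 t (symBlock R ε)) := by
  refine relIdeal_le_relIdeal ?_
  rintro _ ⟨a, s, rfl⟩
  exact subset_relIdeal (Or.inl ⟨.even s, a, rfl⟩)

theorem normalSpan_descends_le :
    normalSpan R descends ≤ normalSpan R descendsSym ⊔ relIdeal (oppositeGens R) := by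
  refine Submodule.span_le.mpr ?_
  rintro _ ⟨l, hl, rfl⟩
  by_cases hsym : l.IsChain descendsSym
  · exact Submodule.mem_sup_left (Submodule.subset_span ⟨l, hsym, rfl⟩)
  · obtain ⟨u, ⟨a, s⟩, ⟨b, s'⟩, w, rfl, hxy⟩ := exists_of_not_isChain hsym
    have hle : descends (a, s) (b, s') :=
      List.isChain_pair.mp hl.left_of_append.right_of_append
    obtain ⟨hab, hs⟩ := not_or.mp hxy
    obtain rfl : b = a := le_antisymm hle (not_lt.mp hab)
    obtain rfl : s' = -s := Int.units_ne_iff_eq_neg.mp fun h => hs ⟨rfl, h.symm⟩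
    have hgen : wd R [(b, s), (b, -s)] ∈ oppositeGens R := ⟨b, s, rfl⟩
    rw [wd_append, wd_append]
    exact Submodule.mem_sup_right (mul_mem_relIdeal (subset_relIdeal hgen) _ _)

theorem normalSpan_descends_inf_relIdeal_le (ε : ℤˣ) (t : R) :
    normalSpan R descends ⊓ relIdeal (reflectionGens 2 t (symBlock R ε)) ≤
      relIdeal (oppositeGens R) := by
  rintro x ⟨hx, hrel⟩
  obtain ⟨y, hy, z, hz, rfl⟩ := Submodule.mem_sup.mp (normalSpan_descends_le hx)
  have hy' := (Submodule.add_mem_iff_left _ (relIdeal_oppositeGens_le ε t hz)).mp hrel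
  rw [Submodule.disjoint_def.mp (isCompl_normalSpan_symBlock ε t).disjoint y hy hy', zero_add]
  exact hz

variable [Invertible (2 : R)]

theorem fourier_wd_one_neg_one (a : ℤ) : fourier R (wd R [(a, 1), (a, -1)]) =
    wd R [(a, -1), (a, 1)] - wd R [(a, 1), (a, -1)] -
      (wd R [(a, -1), (a, -1)] - wd R [(a, 1), (a, 1)]) := by
  simp only [fourier_wd_pair, pairSigma_eq, sum_units_int, signChar, ↓reduceIte,
    neg_units_ne_self, one_mul, Units.val_one, Units.val_neg, Int.cast_one, Int.cast_neg,
    one_smul, neg_smul]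
  abel

theorem fourier_wd_neg_one_one (a : ℤ) : fourier R (wd R [(a, -1), (a, 1)]) =
    -(wd R [(a, -1), (a, 1)] - wd R [(a, 1), (a, -1)]) -
      (wd R [(a, -1), (a, -1)] - wd R [(a, 1), (a, 1)]) := by
  simp only [fourier_wd_pair, pairSigma_eq, sum_units_int, signChar, ↓reduceIte,
    neg_units_ne_self, mul_one, Units.val_one, Units.val_neg, Int.cast_one, Int.cast_neg,
    one_smul, neg_smul]
  abel

theorem relIdeal_image_fourier_oppositeGens_le :
    relIdeal (fourier R '' oppositeGens R) ≤ relIdeal (mergeGens R ℤˣ) := by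
  refine relIdeal_le_relIdeal ?_
  rintro _ ⟨_, ⟨a, s, rfl⟩, rfl⟩
  have hone : wd R [(a, -1), (a, 1)] - wd R [(a, 1), (a, -1)] ∈ relIdeal (mergeGens R ℤˣ) :=
    subset_relIdeal ⟨a, -1, 1, rfl⟩
  have hneg : wd R [(a, -1), (a, -1)] - wd R [(a, 1), (a, 1)] ∈ relIdeal (mergeGens R ℤˣ) :=
    subset_relIdeal ⟨a, -1, -1, rfl⟩
  obtain rfl | rfl := Int.units_eq_one_or s
  · rw [fourier_wd_one_neg_one]
    exact sub_mem hone hneg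
  · rw [neg_neg, fourier_wd_neg_one_one]
    exact sub_mem (neg_mem hone) hneg

theorem relIdeal_mergeGens_le :
    relIdeal (mergeGens R ℤˣ) ≤ relIdeal (fourier R '' oppositeGens R) := by
  refine relIdeal_le_relIdeal ?_
  rintro _ ⟨a, χ, χ', rfl⟩
  have hmem (s : ℤˣ) : fourier R (wd R [(a, s), (a, -s)]) ∈
      relIdeal (fourier R '' oppositeGens R) :=
    subset_relIdeal ⟨_, ⟨a, s, rfl⟩, rfl⟩
  have hone := fourier_wd_one_neg_one (R := R) a ▸ hmem 1
  have hneg := fourier_wd_neg_one_one (R := R) a ▸ neg_neg (1 : ℤˣ) ▸ hmem (-1)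
  obtain rfl | rfl := Int.units_eq_one_or χ
  · rw [one_mul, sub_self]
    exact zero_mem _
  · obtain rfl | rfl := Int.units_eq_one_or χ'
    · convert Submodule.smul_mem _ (⅟2 : R) (sub_mem hone hneg) using 1
      rw [← smul_eq_iff_eq_invOf_smul, mul_one]
      module
    · convert Submodule.smul_mem _ (⅟2 : R) (neg_mem (add_mem hone hneg)) using 1
      rw [← smul_eq_iff_eq_invOf_smul, neg_one_mul, neg_neg]
      module

theorem map_fourier_relIdeal_oppositeGens :
    (relIdeal (oppositeGens R)).map (fourier R).toLinearMap = relIdeal (mergeGens R ℤˣ) :=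
  (map_relIdeal _).trans (relIdeal_image_fourier_oppositeGens_le.antisymm relIdeal_mergeGens_le)

end Opposite

section Symmetric

variable {R : Type*} [CommRing R] [Invertible (2 : R)] (q : ℕ) (ε : ℤˣ)

theorem wd_mem_span_sup_relIdeal_relSymmetric (l : List (ℤ × ℤˣ)) :
    wd R l ∈ Submodule.span R (wd R '' {n | n.IsChain descends ∧ n.length = l.length}) ⊔
      relIdeal (relSymmetric R q ε) := by
  have hset : {n : List (ℤ × ℤˣ) | n.IsChain descends ∧ n.length = l.length} =
      {n | n.map Prod.fst ∈ {e : List ℤ | e.IsChain (· ≥ ·) ∧ e.length = l.length}} :=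
    Set.ext fun n => by simp only [Set.mem_ofPred_eq, isChain_descends_iff, List.length_map]
  have hl : wd R l ∈ Submodule.span R (wd R '' {n | n.map Prod.fst ∈ ({l.map Prod.fst} : Set _)}) :=
    Submodule.subset_span ⟨l, rfl, rfl⟩
  rw [← map_fourier_span] at hl
  rw [relIdeal_relSymmetric, hset, ← map_fourier_span, ← Submodule.map_sup, ← hset]
  refine Submodule.map_mono (Submodule.span_le.mpr ?_) hl
  rintro _ ⟨l', hl', rfl⟩
  have hlength : l'.length = l.length := by simpa using congrArg List.length hl'
  rw [← hlength]
  exact wd_mem_span_sup_relIdeal (fun x y hxy => wd_pair_mem_sup_relIdeal_symBlock ε _ x y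
    fun hsym => hxy (hsym.elim le_of_lt fun h => h.1.le)) l'

theorem normalSpan_descends_inf_relIdeal_relSymmetric_le :
    normalSpan R descends ⊓ relIdeal (relSymmetric R q ε) ≤ relIdeal (mergeGens R ℤˣ) := by
  have hset : {n : List (ℤ × ℤˣ) | n.IsChain descends} =
      {n | n.map Prod.fst ∈ {e : List ℤ | e.IsChain (· ≥ ·)}} :=
    Set.ext fun _ => isChain_descends_iff
  have hdesc : normalSpan R descends = (normalSpan R descends).map (fourier R).toLinearMap := by
    rw [normalSpan, hset, map_fourier_span]
  rw [relIdeal_relSymmetric, hdesc, ← Submodule.map_inf _ (fourier R).injective,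
    ← map_fourier_relIdeal_oppositeGens]
  exact Submodule.map_mono (normalSpan_descends_inf_relIdeal_le ε _)

theorem exists_straightening_relSymmetric (r : ℕ) :
    ∃ str : ((Typ ℤˣ r →₀ R) ⧸ relPart R (relSymmetric R q ε) r) ≃ₗ[R]
        (TypZeroOfRank ℤˣ r →₀ R),
      IsStraightening str.toLinearMap ∧ ∀ f, IsStraightening f → f = str.toLinearMap := by
  refine exists_straightening ?_ (wd_mem_span_sup_relIdeal_relSymmetric q ε)
    (normalSpan_descends_inf_relIdeal_relSymmetric_le q ε)
  rw [relIdeal_relSymmetric, ← map_fourier_relIdeal_oppositeGens]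
  exact Submodule.map_mono (relIdeal_oppositeGens_le ε (q : R))

end Symmetric

end Straightening

theorem mainTheorem3_general (R : Type*) [CommRing R] (q : ℕ) (ε : ℤˣ) (r : ℕ) :
    (∃ str : ((Typ Unit r →₀ R) ⧸ relPart R (relHermitian R q) r) ≃ₗ[R]
          (TypZeroOfRank Unit r →₀ R),
        IsStraightening str.toLinearMap ∧ ∀ f, IsStraightening f → f = str.toLinearMap) ∧
    (IsUnit (2 : R) →
      ∃ str : ((Typ ℤˣ r →₀ R) ⧸ relPart R (relSymmetric R q ε) r) ≃ₗ[R]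
          (TypZeroOfRank ℤˣ r →₀ R),
        IsStraightening str.toLinearMap ∧ ∀ f, IsStraightening f → f = str.toLinearMap) ∧
    (∃ str : ((Typ Unit r →₀ R) ⧸ relPart R (relAlternating R q) r) ≃ₗ[R]
          (TypZeroOfRank Unit r →₀ R),
        IsStraightening str.toLinearMap ∧ ∀ f, IsStraightening f → f = str.toLinearMap) := by
  refine ⟨?_, fun h2 => ?_, ?_⟩
  · rw [relHermitian_eq_reflectionGens]
    exact exists_straightening_hlBlock _ r
  · let := h2.invertible
    exact exists_straightening_relSymmetric q ε r
  · rw [relAlternating_eq_reflectionGens]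
    exact exists_straightening_hlBlock _ r

theorem mainTheorem3 (p : ℕ) (hp : p.Prime)
    (F₀ : Type*) [Field F₀] [CharZero F₀] [ValuativeRel F₀] [TopologicalSpace F₀]
    [IsNonarchimedeanLocalField F₀] [CharP 𝓀[F₀] p]
    (R : Type*) [CommRing R] (r : ℕ) :
    -- the unramified Hermitian case
    (∃ str : ((Typ Unit r →₀ R) ⧸
          relPart R (relHermitian R (Nat.card 𝓀[F₀])) r) ≃ₗ[R]
          (TypZeroOfRank Unit r →₀ R),
        IsStraightening str.toLinearMap ∧
          ∀ f, IsStraightening f → f = str.toLinearMap) ∧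
    -- the symmetric case
    (p ≠ 2 → IsUnit (2 : R) →
      ∃ str : ((Typ ℤˣ r →₀ R) ⧸
          relPart R (relSymmetric R (Nat.card 𝓀[F₀])
            (sign 𝓀[F₀] (-1))) r) ≃ₗ[R] (TypZeroOfRank ℤˣ r →₀ R),
        IsStraightening str.toLinearMap ∧
          ∀ f, IsStraightening f → f = str.toLinearMap) ∧
    -- the alternating case
    (∃ str : ((Typ Unit r →₀ R) ⧸
          relPart R (relAlternating R (Nat.card 𝓀[F₀])) r) ≃ₗ[R]
          (TypZeroOfRank Unit r →₀ R),
        IsStraightening str.toLinearMap ∧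
          ∀ f, IsStraightening f → f = str.toLinearMap) := by
  obtain ⟨hermitian, symmetric, alternating⟩ :=
    mainTheorem3_general R (Nat.card 𝓀[F₀]) (sign 𝓀[F₀] (-1)) r
  exact ⟨hermitian, fun _ => symmetric, alternating⟩
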